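/- **Setting.** Let $0<q<1$ and let $m\ge 1$ be an integer. For $p>0$, $p\neq1$, put $[u]_p=\frac{p^u-1}{p-1}$ and $[n]_p!=[n]_p[n-1]_p\cdots[1]_p$, and for $0<p<1$, $t>0$ put $\Gamma_p(t)=\prod_{n\ge0}\frac{1-p^{n+1}}{1-p^{t+n}}\,(1-p)^{1-t}$. Let $\mu=1+q^{2-m}$. Repeated indices are summed. Index coordinates by $i=1,\dots,m$, put $i'=m+1-i$, and let $\rho_i=\frac m2-i$ for $i<i'$, $\rho_i=0$ for $i=i'$, $\rho_i=-\rho_{i'}$ for $i>i'$. Let $C_{ij}=C^{ij}=q^{-\rho_i}\delta_{ji'}$, $C=C^{ij}C_{ij}$, $(P_1)^{ij}_{kl}=C^{ij}C_{kl}/C$, and let $\hat R$ be the $R$-matrix of $O_q(m)$, $$\hat R^{ij}_{kl}=w_{ij}\,\delta_{il}\delta_{jk}+(q-q^{-1})\,\mathbf 1_{i<j}\,\delta_{ik}\delta_{jl}-(q-q^{-1})\,\mathbf 1_{i<l}\,C_{ij}C_{kl},$$ where $w_{ij}=q$ if $i=j\ne j'$, $w_{ij}=q^{-1}$ if $i=j'\neq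 j$, and $w_{ij}=1$ otherwise. Let $P_A$ be the $q$-antisymmetrizer, i.e. the matrix determined by $\hat R=qP_S-q^{-1}P_A+q^{1-m}P_1$ and $P_S+P_A+P_1=1$. Let $\mathcal P$ be the complex unital algebra generated by $x^1,\dots,x^m$ with relations $(P_A)^{ij}_{kl}x^kx^l=0$ (polynomials on the quantum Euclidean space $\mathbb R^m_q$). Put $\mathbf x^2=x^iC_{ij}x^j$. The partial derivatives $\partial^i:\mathcal P\to\mathcal P$ are the linear operators with $\partial^i(1)=0$ and $\partial^ix^j=C^{ij}+q(\hat R^{-1})^{ij}_{kl}x^k\partial^l$. Put $\Delta=\partial^iC_{ij}\partial^j$ and $$\Lambda=1+(q^2-1)x^iC_{ij}\partial^j+\frac{(q^2-1)^2}{q^{m-2}\mu^2}\mathbf x^2\Delta ,$$ $$\mathcal P_k=\{P\in\mathcal P:\Lambda P=q^{2k}P\},\qquad \mathcal S_k=\mathcal P_k\cap\ker\Delta .$$ The quantum sphere integral of $f\in\mathcal P$ is the finite sum $$\int_{\mathbb S^{m-1}_q}f=\sum_{k\ge0}\frac{2\,\Gamma_{q^2}(\frac12)^m}{\mu^{2k}[k]_{q^2}!\,\Gamma_{q^2}(k+\frac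 m2)}\,(\Delta^kf)(0),$$ where $g(0)$ is the constant term of $g$. Polynomials in $\mathbf x$ and a second copy $\mathbf y$ of the variables are written with the $\mathbf x$ to the left of the $\mathbf y$, i.e. as elements of $\mathcal P\otimes\mathcal P$; operators and integrals with index $\mathbf x$ act on the first factor. **Theorem.** There is exactly one sequence $(\mathbf x;\mathbf y)^{(l)}$, $l\ge 0$, of polynomials with $(\mathbf x;\mathbf y)^{(l)}\in\mathcal P_l\otimes\mathcal P_l$, $(\mathbf x;\mathbf y)^{(0)}=1$ and $$\partial_{\mathbf x}^j(\mathbf x;\mathbf y)^{(l)}=[l]_{q^{-2}}\,(\mathbf x;\mathbf y)^{(l-1)}y^j\qquad(l\ge1,\ 1\le j\le m).$$ Put $\langle\mathbf x|\mathbf y\rangle^{(l)}=\frac{[l]_q!}{[l]_{q^{-2}}!}(\mathbf x;\mathbf y)^{(l)}$. Then for all integers $k,l\ge0$ and all $S_k\in\mathcal S_k$, $$\int_{\mathbb S^{m-1}_q,\mathbf x}S_k(\mathbf x)\,\langle\mathbf x|\mathbf y\rangle^{(l)}=\alpha_{k,l}\,S_k(\mathbf y)\,\mathbf y^{l-k},$$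 where $\mathbf y^{l-k}=(\mathbf y^2)^{(l-k)/2}$ and $$\alpha_{k,l}=\frac{2\,\Gamma_{q^2}(\frac12)^m\,[l]_q!}{\mu^l\,\big[\frac{l-k}2\big]_{q^2}!\,\Gamma_{q^2}\big(\frac{k+l+m}2\big)}\quad\text{if }k+l\text{ is even and }l\ge k,$$ and $\alpha_{k,l}=0$ (so that the integral vanishes) if $k+l$ is odd or $l<k$. -/

import Mathlib

open scoped TensorProduct

namespace QEuclid

set_option linter.all false

set_option linter.unusedSimpArgs false

set_option linter.unusedTactic false

set_option linter.unreachableTactic false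

set_option linter.unnecessarySeqFocus false

set_option linter.unusedVariables false

set_option linter.unusedSectionVars false

open Finset

/-- The vector `rho` of the orthogonal series: `(m/2-1, m/2-2, ..., -(m/2-1))`, with one middle
entry `0` if `m` is odd and two middle entries `0` if `m` is even. Indices run from `0` to `m-1`,
and `Fin.rev i` is the conjugate index `i'`. -/
noncomputable def rho {m : ℕ} (i : Fin m) : ℝ :=
  if i = i.rev then 0
  else if i < i.rev then (m : ℝ) / 2 - 1 - (i : ℕ)
  else -((m : ℝ) / 2 - 1 - (i.rev : ℕ))

/-- The nonzero entries `q ^ (-rho i)` of the metric. -/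
noncomputable def metricCoeff {m : ℕ} (q : Set.Ioo (0 : ℝ) 1) (i : Fin m) : ℂ :=
  (((q : ℝ) ^ (-rho i) : ℝ) : ℂ)

/-- The quantum Euclidean metric `C_{ij} = C^{ij} = q ^ (-rho i) δ_{j,i'}`. It is its own inverse. -/
noncomputable def metric (m : ℕ) (q : Set.Ioo (0 : ℝ) 1) : Matrix (Fin m) (Fin m) ℂ :=
  Matrix.of fun i j => if j = i.rev then metricCoeff q i else 0

/-- The Faddeev--Reshetikhin--Takhtajan matrix `R̂^{ij}_{kl}` of `O_q(m)`; rows are the pairs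
`(i,j)`, columns the pairs `(k,l)`. With `i'` the conjugate index,
`R̂^{ij}_{kl} = q ^ (δ_{ij} - δ_{ij'}) δ_{il} δ_{jk}` (exponent `0` if `i = j = i'`)
`+ (q - q⁻¹) [i<j] δ_{ik} δ_{jl} - (q - q⁻¹) [i<l] C_{ij} C_{kl}`. -/
noncomputable def Rhat (m : ℕ) (q : Set.Ioo (0 : ℝ) 1) :
    Matrix (Fin m × Fin m) (Fin m × Fin m) ℂ :=
  Matrix.of fun p r =>
    let i := p.1
    let j := p.2
    let k := r.1
    let l := r.2
    let Q : ℂ := ((q : ℝ) : ℂ)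
    (if i = l ∧ j = k then
        (if i = j ∧ i ≠ j.rev then Q else if i = j.rev ∧ i ≠ j then Q⁻¹ else 1) else 0)
      + (if i = k ∧ j = l ∧ i < j then Q - Q⁻¹ else 0)
      - (if i < l then (Q - Q⁻¹) * metric m q i j * metric m q k l else 0)

/-- The number `C = C^{ij} C_{ij}`. -/
noncomputable def metricTrace (m : ℕ) (q : Set.Ioo (0 : ℝ) 1) : ℂ :=
  ∑ i, ∑ j, metric m q i j * metric m q i j

/-- The rank one projector `(P_1)^{ij}_{kl} = C^{ij} C_{kl} / C`. -/
noncomputable def projTrace (m : ℕ) (q : Set.Ioo (0 : ℝ) 1) :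
    Matrix (Fin m × Fin m) (Fin m × Fin m) ℂ :=
  Matrix.of fun p r => metric m q p.1 p.2 * metric m q r.1 r.2 / metricTrace m q

/-- The `q`-antisymmetric projector `P_A`, determined by the spectral decomposition
`R̂ = q P_S - q⁻¹ P_A + q^{1-m} P_1` and `P_S + P_A + P_1 = 1`. -/
noncomputable def projAnti (m : ℕ) (q : Set.Ioo (0 : ℝ) 1) :
    Matrix (Fin m × Fin m) (Fin m × Fin m) ℂ :=
  let Q : ℂ := ((q : ℝ) : ℂ)
  (Q + Q⁻¹)⁻¹ • (Q • (1 : Matrix (Fin m × Fin m) (Fin m × Fin m) ℂ) - Rhat m q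
    + (Q ^ (1 - (m : ℤ)) - Q) • projTrace m q)

/-- The defining relations `(P_A)^{ij}_{kl} x^k x^l = 0` of quantum Euclidean space. -/
inductive PolyRel (m : ℕ) (q : Set.Ioo (0 : ℝ) 1) :
    FreeAlgebra ℂ (Fin m) → FreeAlgebra ℂ (Fin m) → Prop
  | mk (i j : Fin m) :
      PolyRel m q (∑ k, ∑ l, projAnti m q (i, j) (k, l) • (FreeAlgebra.ι ℂ k * FreeAlgebra.ι ℂ l)) 0

/-- The algebra `𝒫` of polynomials on quantum Euclidean space: the complex unital algebra generated
by `x^0, ..., x^{m-1}` with the relations `(P_A)^{ij}_{kl} x^k x^l = 0`. -/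
abbrev Poly (m : ℕ) (q : Set.Ioo (0 : ℝ) 1) : Type := RingQuot (PolyRel m q)

/-- The generator (coordinate) `x^i`. -/
noncomputable def gen {m : ℕ} (q : Set.Ioo (0 : ℝ) 1) (i : Fin m) : Poly m q :=
  RingQuot.mkAlgHom ℂ (PolyRel m q) (FreeAlgebra.ι ℂ i)


/-! Well-definedness of the partial derivatives: the relations of `𝒫` are preserved by the
commutation relation between derivatives and coordinates. -/

section
variable {A : Type*} [Ring A] [Algebra ℂ A] {m : ℕ}

noncomputable def dw (q : ℂ) (a k : Fin m) : ℂ :=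
  if a = k ∧ a ≠ a.rev then q⁻¹ else if a = k.rev ∧ a ≠ k then q else 1

noncomputable def NN (q : ℂ) (c : Fin m → ℂ) (x : Fin m → A) (k a e : Fin m) : A :=
  (if a = e then dw q a k • x k else 0)
  - (if e = k ∧ k < a then (q - q⁻¹) • x a else 0)
  + (if a = k.rev ∧ e < a then ((q - q⁻¹) * c a * c e.rev) • x e.rev else 0)

noncomputable def TT (c : Fin m → ℂ) (x : Fin m → A) (p : Fin m) : A :=
  ∑ j, if j < p then c j • (x j * x j.rev) else 0

theorem sumA (q : ℂ) (c : Fin m → ℂ) (x : Fin m → A) (k a : Fin m) (f : Fin m → A) :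
    ∑ e, NN q c x k a e * f e = dw q a k • (x k * f a)
      - (if k < a then (q - q⁻¹) • (x a * f k) else 0)
      + (if a = k.rev then ((q - q⁻¹) * c a) • ∑ e, (if e < a then c e.rev • (x e.rev * f e) else 0) else 0) := by
  simp only [NN, add_mul, sub_mul, Finset.sum_add_distrib, Finset.sum_sub_distrib]
  congr 1
  · congr 1
    · simp
    · rw [Finset.sum_eq_single k] <;> simp +contextual
  · split_ifs with h
    · rw [Finset.smul_sum]
      refine Finset.sum_congr rfl fun e _ => ?_
      subst h
      by_cases he : e < k.rev
      · simp only [he, and_self, if_true, smul_smul, smul_mul_assoc]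
        congr 1; ring
      · simp [he]
    · simp [h]

theorem sumB (q : ℂ) (c : Fin m → ℂ) (hc : ∀ i, c i * c i.rev = 1) (x : Fin m → A) (l a b : Fin m) :
    ∑ e, (if e < a then c e.rev • (x e.rev * NN q c x l e b) else 0)
     = (if b < a then (c b.rev * dw q b l) • (x b.rev * x l) else 0)
      - (if b = l then (q - q⁻¹) • (∑ e, if l < e ∧ e < a then c e.rev • (x e.rev * x e) else 0) else 0)
      + (if l.rev < a ∧ b < l.rev then ((q - q⁻¹) * c b.rev) • (x l * x b.rev) else 0) := by
  have : ∀ e, (if e < a then c e.rev • (x e.rev * NN q c x l e b) else 0)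
     = (if e = b then (if b < a then (c b.rev * dw q b l) • (x b.rev * x l) else 0) else 0)
       - (if b = l then (q - q⁻¹) • (if l < e ∧ e < a then c e.rev • (x e.rev * x e) else 0) else 0)
       + (if e = l.rev then (if l.rev < a ∧ b < l.rev then ((q - q⁻¹) * c b.rev) • (x l * x b.rev) else 0) else 0) := by
    intro e
    by_cases hea : e < a
    · simp only [NN, hea, if_true, mul_add, mul_sub, smul_add, smul_sub]
      congr 1
      · congr 1
        · by_cases h : e = b
          · subst h; simp [hea, smul_smul]
          · simp [h]
        · by_cases h : b = l <;> by_cases h2 : l < e <;> simp [h, h2, smul_smul, mul_comm]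
      · by_cases h : e = l.rev
        · subst h
          by_cases h2 : b < l.rev
          · simp only [hea, h2, and_self, if_true, mul_smul_comm, smul_smul, Fin.rev_rev]
            congr 1
            linear_combination (q - q⁻¹) * c b.rev * hc l
          · simp [h2]
        · simp [h]
    · have : ¬ (l.rev < a ∧ e = l.rev) := by grind
      simp only [hea, if_false, and_false, smul_zero]
      by_cases h : e = b <;> by_cases h2 : e = l.rev <;> grind
  simp only [this, Finset.sum_add_distrib, Finset.sum_sub_distrib]
  congr 1
  · congr 1
    · simp
    · split_ifs
      · rw [Finset.smul_sum]
      · simp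
  · simp

theorem prodN (q : ℂ) (c : Fin m → ℂ) (hc : ∀ i, c i * c i.rev = 1) (x : Fin m → A) (k l a b : Fin m) :
    ∑ e, NN q c x k a e * NN q c x l e b =
     dw q a k • (x k * NN q c x l a b)
      - (if k < a then (q - q⁻¹) • (x a * NN q c x l k b) else 0)
      + (if a = k.rev then ((q - q⁻¹) * c a) • (
       (if b < a then (c b.rev * dw q b l) • (x b.rev * x l) else 0)
      - (if b = l then (q - q⁻¹) • (∑ e, if l < e ∧ e < a then c e.rev • (x e.rev * x e) else 0) else 0)
      + (if l.rev < a ∧ b < l.rev then ((q - q⁻¹) * c b.rev) • (x l * x b.rev) else 0)) else 0) := by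
  rw [sumA, sumB _ _ hc]

theorem sumT (c : Fin m → ℂ) (x : Fin m → A) (l a : Fin m) :
    (∑ e, if l < e ∧ e < a then c e.rev • (x e.rev * x e) else 0) =
      if a.rev < l.rev then TT c x l.rev - TT c x a.rev - c a.rev • (x a.rev * x a) else 0 := by
  rw [← Equiv.sum_comp Fin.revPerm]
  split_ifs with h
  · rw [sub_sub, eq_sub_iff_add_eq]
    have : c a.rev • (x a.rev * x a) = ∑ j, if j = a.rev then c j • (x j * x j.rev) else 0 := by simp
    rw [this, TT, TT, ← Finset.sum_add_distrib, ← Finset.sum_add_distrib]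
    refine Finset.sum_congr rfl fun e _ => ?_
    simp only [Fin.revPerm_apply, Fin.rev_rev]
    have h1 : (l < e.rev ∧ e.rev < a) ↔ (a.rev < e ∧ e < l.rev) := by grind
    simp only [h1]
    rcases lt_trichotomy e a.rev with h2 | h2 | h2
    · have := h2.trans h
      simp [h2, this, h2.ne, h2.not_gt]
    · subst h2; simp [h]
    · simp [h2, h2.ne', h2.not_gt]
  · apply Finset.sum_eq_zero; intro e _
    rw [if_neg]; simp only [Fin.revPerm_apply]; grind

/-- The relations of `𝒫`, written out. -/
structure QRel (q g : ℂ) (c : Fin m → ℂ) (x : Fin m → A) : Prop where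
  h1 : ∀ i j, i < j → j ≠ i.rev → x i * x j = q • (x j * x i)
  h2 : ∀ i, (q - if i < i.rev then q - q⁻¹ else 0) • (x i * x i.rev)
      - (if i = i.rev then 1 else q⁻¹) • (x i.rev * x i)
      + ((q - q⁻¹) * c i) • TT c x i.rev + (g * c i) • (∑ j, c j • (x j * x j.rev)) = 0

variable {q g : ℂ} {c : Fin m → ℂ} {x : Fin m → A}


theorem prodN' (hc : ∀ i, c i * c i.rev = 1) (k l a b : Fin m) (hba : b < a) :
    ∑ e, NN q c x k a e * NN q c x l e b =
      - (if b = l then ((q - q⁻¹) * dw q a k) • (x k * x a) else 0)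
      + (if a = l.rev then ((q - q⁻¹) * c a * c b.rev * dw q a k) • (x k * x b.rev) else 0)
      - (if b = k then ((q - q⁻¹) * dw q b l) • (x a * x l) else 0)
      + (if b = l ∧ l < k ∧ k < a then ((q - q⁻¹) ^ 2) • (x a * x k) else 0)
      - (if k = l.rev ∧ b < k ∧ k < a then ((q - q⁻¹) ^ 2 * c k * c b.rev) • (x a * x b.rev) else 0)
      + (if a = k.rev then ((q - q⁻¹) * c a * c b.rev * dw q b l) • (x b.rev * x l) else 0)
      - (if a = k.rev ∧ b = l then ((q - q⁻¹) ^ 2 * c a) •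
          (∑ e, if l < e ∧ e < a then c e.rev • (x e.rev * x e) else 0) else 0)
      + (if a = k.rev ∧ l.rev < a ∧ b < l.rev then
          ((q - q⁻¹) ^ 2 * c a * c b.rev) • (x l * x b.rev) else 0) := by
  rw [prodN q c hc]
  generalize (∑ e, if l < e ∧ e < a then c e.rev • (x e.rev * x e) else 0) = S
  have e1 : dw q a k • (x k * NN q c x l a b) =
      - (if b = l then ((q - q⁻¹) * dw q a k) • (x k * x a) else 0)
      + (if a = l.rev then ((q - q⁻¹) * c a * c b.rev * dw q a k) • (x k * x b.rev) else 0) := by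
    have h0 : (b = l ∧ l < a) ↔ b = l := by grind
    simp only [NN, h0, hba, hba.ne', and_true, if_false]
    by_cases h1 : b = l <;> by_cases h2 : a = l.rev <;>
      simp only [h1, h2, if_true, if_false, mul_add, mul_sub, mul_zero, mul_smul_comm] <;> module
  have e2 : (if k < a then (q - q⁻¹) • (x a * NN q c x l k b) else 0) =
      (if b = k then ((q - q⁻¹) * dw q b l) • (x a * x l) else 0)
      - (if b = l ∧ l < k ∧ k < a then ((q - q⁻¹) ^ 2) • (x a * x k) else 0)
      + (if k = l.rev ∧ b < k ∧ k < a then ((q - q⁻¹) ^ 2 * c k * c b.rev) • (x a * x b.rev) else 0) := by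
    by_cases hka : k < a
    · simp only [NN, hka, if_true, and_true]
      by_cases h1 : k = b
      · subst h1
        simp only [lt_irrefl, and_false, if_true, if_false]
        have : ¬ (k = l ∧ l < k) := by grind
        simp only [this, if_false, mul_add, mul_sub, mul_zero, mul_smul_comm]; module
      · have h1' : ¬ b = k := fun h => h1 h.symm
        simp only [if_neg h1, if_neg h1']
        split_ifs <;> simp only [mul_add, mul_sub, mul_zero, mul_smul_comm] <;> module
    · have : b ≠ k := by grind
      simp [hka, this]
  rw [e1, e2]
  by_cases h1 : a = k.rev
  · simp only [h1, if_true, true_and]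
    simp only [← h1, hba, if_true]
    split_ifs <;> module
  · simp only [h1, if_false, false_and]; module

theorem prodN0 (hc : ∀ i, c i * c i.rev = 1) (k l a b : Fin m) (hab : a < b) :
    ∑ e, NN q c x k a e * NN q c x l e b = 0 := by
  have : ∀ k a b : Fin m, a < b → NN q c x k a b = 0 := by
    intro k a b h
    simp only [NN]; grind
  apply Finset.sum_eq_zero; intro e _
  rcases lt_or_ge a e with h | h
  · simp [this k a e h]
  · simp [this l e b (h.trans_lt hab)]

theorem prodNd (k l a : Fin m) :
    ∑ e, NN q c x k a e * NN q c x l e a = (dw q a k * dw q a l) • (x k * x l) := by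
  have : ∀ k a b : Fin m, a < b → NN q c x k a b = 0 := by
    intro k a b h
    simp only [NN]; grind
  rw [Finset.sum_eq_single a]
  · have e1 : ∀ k a : Fin m, NN q c x k a a = dw q a k • x k := by
      intro k a; simp only [NN]; grind
    rw [e1, e1, smul_mul_smul_comm]
  · intro e _ he
    rcases lt_or_gt_of_ne he with h | h
    · simp [this l e a h]
    · simp [this k a e h]
  · simp

theorem H1N (hq : q ≠ 0) (hc : ∀ i, c i * c i.rev = 1) (hcm : ∀ i, i = i.rev → c i = 1)
    (H : QRel q g c x) (k l a b : Fin m)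
    (hkl : k < l) (hl : l ≠ k.rev) :
    ∑ e, NN q c x k a e * NN q c x l e b = q • ∑ e, NN q c x l a e * NN q c x k e b := by
  rcases lt_trichotomy b a with hba | hab | hab
  swap
  · subst hab
    rw [prodNd, prodNd, H.h1 k l hkl hl]; module
  swap
  · rw [prodN0 hc _ _ _ _ hab, prodN0 hc _ _ _ _ hab, smul_zero]
  rw [prodN' hc _ _ _ _ hba, prodN' hc _ _ _ _ hba]
  have f1 : ¬ l < k := hkl.not_gt
  have f2 : k ≠ l.rev := by grind
  have f3 : ¬ (k.rev < l.rev) := by grind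
  have f4 : l.rev < k.rev := by grind
  have f5 : l ≠ k := hkl.ne'
  have f6 : l.rev ≠ k.rev := by grind
  have f7 := f5.symm
  have f8 := f6.symm
  have d1 : ∀ i j : Fin m, i ≠ j → i ≠ j.rev → dw q i j = 1 := by
    intro i j h1 h2; simp only [dw]; grind
  have d2 : ∀ i j : Fin m, i = j.rev → i ≠ j → dw q i j = q := by
    intro i j h1 h2; simp only [dw]; grind
  have d3 : ∀ i : Fin m, dw q i i = if i = i.rev then 1 else q⁻¹ := by
    intro i; simp only [dw]; grind
  by_cases hbl : b = l
  · subst hbl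
    by_cases hak : a = k.rev
    · subst hak
      have g1 : k < k.rev := by grind
      have g2 : ¬ k.rev < k := g1.not_gt
      have g3 : k.rev ≠ k := g1.ne'
      have g4 : k < b.rev := by grind
      have I := H.h2 b
      have II := H.h2 k.rev
      rw [sumT]
      simp only [Fin.rev_rev, g2, g3, g4, if_true, if_false] at I II ⊢
      rw [d2 _ _ rfl g3, d1 k.rev b (by grind) (by grind), d1 b k f5 hl, d3]
      simp only [if_true, f1, f2, f5, f8, hl, f4, true_and, and_true, if_false, false_and, and_false]
      generalize (∑ j, c j • (x j * x j.rev)) = X at I II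
      split_ifs at I ⊢ <;>
      linear_combination (norm := match_scalars <;> field) (-(q - q⁻¹) * c k.rev * c b.rev) • I + (q - q⁻¹) • II
        + hc b • (((q - q⁻¹) ^ 2 * c k.rev) • TT c x b.rev + ((q - q⁻¹) * g * c k.rev) • X)
        + hc k • ((q - q⁻¹) ^ 2 • (x k * x k.rev))
    by_cases hal : a = b.rev
    · subst hal
      rw [H.h1 k b.rev (by grind) (by grind), d1 b.rev k (by grind) (by grind), d1 b k (by grind) (by grind)]
      simp [*]
      module
    rw [H.h1 k a (by grind) hak, d1 a k (by grind) (by grind), d1 b k (by grind) (by grind)]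
    simp [*]
    module
  by_cases hbk : b = k
  · subst hbk
    by_cases hak : a = b.rev
    · subst hak
      have g1 : b < l.rev ↔ l < b.rev := by grind
      rw [d1 b l (by grind) (by grind), d1 b.rev l (by grind) (by grind)]
      simp [*]
      rcases lt_or_gt_of_ne hl with h | h
      · rw [H.h1 l b.rev h (by grind)]
        simp only [h, if_true]
        match_scalars <;> field
      · rw [H.h1 b.rev l h (by grind)]
        simp only [h.not_gt, if_false]
        match_scalars <;> field
    by_cases hal : a = l.rev
    · subst hal
      have g1 : b < b.rev := by grind
      have g2 : b ≠ b.rev := g1.ne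
      have g4 : l < b.rev := by grind
      have I := H.h2 b
      have II := H.h2 l.rev
      rw [sumT c x b l.rev]
      rw [d1 _ _ (show l.rev ≠ b by grind) (by grind), d1 b l (by grind) (by grind), d3]
      generalize (∑ j, c j • (x j * x j.rev)) = X at I II
      have g5 : (dw q l.rev l) = if l = l.rev then 1 else q := by simp only [dw]; grind
      have g6 : (l.rev = l) = (l = l.rev) := by simp only [eq_comm]
      rw [g5]
      simp only [Fin.rev_rev, g1, g2, g4, hbl, f1, f2, f3, f6, hl, hkl, hba, true_and, and_true, false_and, and_false, if_true, if_false, g6] at I II ⊢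
      rcases lt_trichotomy l l.rev with h | h | h
      · simp only [h, h.ne, h.not_gt, if_true, if_false] at II ⊢
        linear_combination (norm := match_scalars <;> field) (q * (q - q⁻¹) * c l.rev * c b.rev) • I - (q * (q - q⁻¹)) • II
          - hc b • ((q * (q - q⁻¹) ^ 2 * c l.rev) • TT c x b.rev + (q * (q - q⁻¹) * g * c l.rev) • X)
          - hc l • ((q * (q - q⁻¹) ^ 2) • (x l * x l.rev))
      · have hx : x l.rev = x l := congrArg x h.symm
        have hT : TT c x l.rev = TT c x l := congrArg _ h.symm
        have hcl : c l.rev = 1 := (congrArg c h.symm).trans (hcm l h)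
        have hcl' : c l = 1 := hcm l h
        have h' : ¬ l.rev < l := by grind
        have h'' : ¬ l < l.rev := by grind
        rw [if_pos h] at II ⊢
        simp only [h', h'', if_false, hcl, hx, hcl'] at II ⊢
        linear_combination (norm := match_scalars <;> field) (q * (q - q⁻¹) * c b.rev) • I - (q * (q - q⁻¹)) • II
          - hc b • ((q * (q - q⁻¹) ^ 2) • TT c x b.rev + (q * (q - q⁻¹) * g) • X)
      · simp only [h, h.ne', h.not_gt, if_true, if_false] at II ⊢
        linear_combination (norm := match_scalars <;> field) (q * (q - q⁻¹) * c l.rev * c b.rev) • I - (q * (q - q⁻¹)) • II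
          - hc b • ((q * (q - q⁻¹) ^ 2 * c l.rev) • TT c x b.rev + (q * (q - q⁻¹) * g * c l.rev) • X)
          - hc l • ((q * (q - q⁻¹) ^ 2) • (x l * x l.rev))
    have g7 : dw q a l = if a = l ∧ l ≠ l.rev then q⁻¹ else 1 := by simp only [dw]; grind
    rw [d1 b l (by grind) (by grind), g7]
    simp [*]
    rcases lt_trichotomy a l with h | h | h
    · rw [H.h1 a l h (by grind)]
      simp only [h.ne, h.not_gt, false_and, if_false]
      module
    · subst h
      simp [hal]
      match_scalars; field
    · rw [H.h1 l a h (by grind)]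
      simp only [h, h.ne', false_and, if_true, if_false]
      match_scalars <;> field
  by_cases hak : a = k.rev
  · subst hak
    have g7 : dw q b l = if b = l.rev then q else 1 := by simp only [dw]; grind
    rw [d1 k.rev l (by grind) (by grind), g7]
    simp [*]
    rcases lt_trichotomy b l.rev with h | h | h
    · rw [H.h1 l b.rev (by grind) (by grind)]
      simp only [h, h.ne, if_true, if_false]
      match_scalars <;> field
    · subst h
      simp
      module
    · rw [H.h1 b.rev l (by grind) (by grind)]
      simp only [h.ne', h.not_gt, if_true, if_false]
      module
  by_cases hal : a = l.rev
  · subst hal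
    simp [*]
    rw [H.h1 k b.rev (by grind) (by grind), d1 l.rev k (by grind) (by grind), d1 b k (by grind) (by grind)]
    module
  simp [*]


set_option maxHeartbeats 4000000 in
theorem scalNat (M : ℕ) (q : ℂ) (hq : q ≠ 0) (c : ℕ → ℂ)
   (hc : ∀ i j, i + j = M → c i * c j = 1) (hcm : ∀ i, i + i = M → c i = 1) (a b p a' b' p' : ℕ) (hab : b < a)
   (ha : a + a' = M) (hb : b + b' = M) (hp : p + p' = M) :
   let l := q - q⁻¹
   let F : ℕ → ℕ → ℂ := fun p p' => (if p = p' then 1 else q⁻¹) * c p ^2 + (if p' < p then l else 0) 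
   let η := if b' < a then q else if b' = a then 1 else q⁻¹
   let d : ℕ → ℕ → ℕ → ℂ := fun a k k' => if a = k then (if a = k' then 1 else q⁻¹) else if a = k' then q else 1
   let n : ℕ → ℕ → ℂ := fun k k' => - (if b = k' then l * d a k k' * η else 0)
     + (if a = k then l * c a * c b' * d a k k' else 0) - (if b = k then l * d b k' k else 0)
     + (if b = k' ∧ k' < k ∧ k < a then l^2 else 0) - (if b < k ∧ k < a then l^2 * c k * c b' else 0)
     + (if a = k' then l * c a * c b' * d b k' k * η else 0)
     + (if a = k' ∧ k < a ∧ b < k then l^2 * c a * c b' else 0)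
   let S : ℂ := (if b' < p then c b' * (- l * d a b' b * η + if b < b' ∧ b' < a then l^2 else 0) else 0)
     + (if a < p then l * c a ^2 * c b' * d a a a' else 0)
     - (if b < p then l * c b * d b b' b else 0)
     + (if a' < p then c b' * (l * d b a a' * η + if a' < a ∧ b < a' then l^2 else 0) else 0)
     - l * c b' * (if p ≤ b then 0 else if p ≤ a then F p p' - F b b' - l * c b ^ 2 else F a a' - F b b' - l * c b^2)
   (q - if p' < p then l else 0) * (c p * n p' p) - (if p = p' then 1 else q⁻¹) * (c p * n p p') + l * S = 0 := by
  intro l F η d n S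
  have ea := hc a a' ha
  have eb := hc b b' hb
  have ep := hc p p' hp
  have na : c a ≠ 0 := left_ne_zero_of_mul_eq_one ea
  have nb : c b ≠ 0 := left_ne_zero_of_mul_eq_one eb
  have np : c p ≠ 0 := left_ne_zero_of_mul_eq_one ep
  have ea' : c a' = (c a)⁻¹ := eq_inv_of_mul_eq_one_right ea
  have eb' : c b' = (c b)⁻¹ := eq_inv_of_mul_eq_one_right eb
  have ep' : c p' = (c p)⁻¹ := eq_inv_of_mul_eq_one_right ep
  have rm : ∀ i j, i + j = M → i = j → c i = 1 := fun i j h h' => hcm i (by omega)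
  clear hc hcm
  simp only [S, n, d, η, F, l]
  clear S n d η F l
  rcases lt_trichotomy b' a with h2 | h2 | h2 <;>
  rcases lt_trichotomy p a with h3 | h3 | h3 <;>
  rcases lt_trichotomy p b with h4 | h4 | h4 <;> (try (exfalso; omega))
  all_goals
    simp (disch := omega) only [if_pos, if_neg, 
      if_true, add_zero, zero_add, sub_zero, zero_sub, mul_zero, zero_mul, neg_zero, mul_one, one_mul, sub_self]
  all_goals
  rcases lt_trichotomy p p' with h1 | h1 | h1 <;> (try (exfalso; omega)) <;>
  rcases lt_trichotomy p b' with h8 | h8 | h8 <;> (try (exfalso; omega)) <;>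
  rcases lt_trichotomy p a' with h7 | h7 | h7 <;> (try (exfalso; omega))
  all_goals
    try simp (disch := omega) only [if_pos, if_neg, 
      if_true, add_zero, zero_add, sub_zero, zero_sub, mul_zero, zero_mul, neg_zero, mul_one, one_mul, sub_self]
  all_goals
  rcases lt_trichotomy b b' with h5 | h5 | h5 <;> (try (exfalso; omega)) <;>
  rcases lt_trichotomy a a' with h6 | h6 | h6 <;> (try (exfalso; omega)) 
  all_goals
    try simp (disch := omega) only [if_pos, if_neg, ea', eb', ep', (fun h : p = p' => rm p p' hp h), (fun h : b = b' => rm b b' hb h), (fun h : a = a' => rm a a' ha h),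
      (fun h : p = a => congrArg c h), (fun h : p = b => congrArg c h), (fun h : p = a' => (congrArg c h).trans ea'),
      (fun h : p = b' => (congrArg c h).trans eb'), (fun h : b' = a => (congrArg c h.symm).trans eb'),
      if_true, add_zero, zero_add, sub_zero, zero_sub, mul_zero, zero_mul, neg_zero, mul_one, one_mul, sub_self]
  all_goals field

theorem scalTotNat (M : ℕ) (q : ℂ) (hq : q ≠ 0) (c : ℕ → ℂ)
   (hc : ∀ i j, i + j = M → c i * c j = 1) (hcm : ∀ i, i + i = M → c i = 1) (a b a' b' : ℕ) (hab : b < a)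
   (ha : a + a' = M) (hb : b + b' = M) :
   let l := q - q⁻¹
   let F : ℕ → ℕ → ℂ := fun p p' => (if p = p' then 1 else q⁻¹) * c p ^2 + (if p' < p then l else 0)
   let η := if b' < a then q else if b' = a then 1 else q⁻¹
   let d : ℕ → ℕ → ℕ → ℂ := fun a k k' => if a = k then (if a = k' then 1 else q⁻¹) else if a = k' then q else 1
   c b' * (- l * d a b' b * η + if b < b' ∧ b' < a then l^2 else 0)
     + l * c a ^2 * c b' * d a a a' - l * c b * d b b' b
     + c b' * (l * d b a a' * η + if a' < a ∧ b < a' then l^2 else 0)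
     - l * c b' * (F a a' - F b b' - l * c b^2) = 0 := by
  intro l F η d
  have ea := hc a a' ha
  have eb := hc b b' hb
  have na : c a ≠ 0 := left_ne_zero_of_mul_eq_one ea
  have nb : c b ≠ 0 := left_ne_zero_of_mul_eq_one eb
  have ea' : c a' = (c a)⁻¹ := eq_inv_of_mul_eq_one_right ea
  have eb' : c b' = (c b)⁻¹ := eq_inv_of_mul_eq_one_right eb
  have r2 : b = b' → c b = 1 := fun h => hcm b (by omega)
  have r3 : a = a' → c a = 1 := fun h => hcm a (by omega)
  have r8 : b' = a → c a = (c b)⁻¹ := fun h => by rw [← h, eb']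
  clear hc hcm ea eb
  simp only [d, η, F, l]
  rcases lt_trichotomy b' a with h2 | h2 | h2 <;>
  rcases lt_trichotomy b b' with h5 | h5 | h5 <;> (try (exfalso; omega)) <;>
  rcases lt_trichotomy a a' with h6 | h6 | h6 <;> (try (exfalso; omega))
  all_goals
    simp (disch := omega) only [if_pos, if_neg, ea', eb', r2, r3, r8,
      if_true, add_zero, zero_add, sub_zero, zero_sub, mul_zero, zero_mul, neg_zero, mul_one, one_mul, sub_self]
  all_goals field

noncomputable def eta (q : ℂ) (a b : Fin m) : ℂ := if b.rev < a then q else if b.rev = a then 1 else q⁻¹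

noncomputable def nn (q : ℂ) (c : Fin m → ℂ) (a b k : Fin m) : ℂ :=
  - (if b = k.rev then (q - q⁻¹) * dw q a k * eta q a b else 0)
     + (if a = k then (q - q⁻¹) * c a * c b.rev * dw q a k else 0) - (if b = k then (q - q⁻¹) * dw q b k.rev else 0)
     + (if b = k.rev ∧ k.rev < k ∧ k < a then (q - q⁻¹)^2 else 0)
     - (if b < k ∧ k < a then (q - q⁻¹)^2 * c k * c b.rev else 0)
     + (if a = k.rev then (q - q⁻¹) * c a * c b.rev * dw q b k.rev * eta q a b else 0)
     + (if a = k.rev ∧ k < a ∧ b < k then (q - q⁻¹)^2 * c a * c b.rev else 0)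

noncomputable def FF (q : ℂ) (c : Fin m → ℂ) (p : Fin m) : ℂ :=
  (if p = p.rev then 1 else q⁻¹) * c p ^2 + (if p.rev < p then (q - q⁻¹) else 0)

noncomputable def SS (q : ℂ) (c : Fin m → ℂ) (a b p : Fin m) : ℂ :=
  (if b.rev < p then c b.rev * (- (q - q⁻¹) * dw q a b.rev * eta q a b + if b < b.rev ∧ b.rev < a then (q - q⁻¹)^2 else 0) else 0)
     + (if a < p then (q - q⁻¹) * c a ^2 * c b.rev * dw q a a else 0)
     - (if b < p then (q - q⁻¹) * c b * dw q b b.rev else 0)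
     + (if a.rev < p then c b.rev * ((q - q⁻¹) * dw q b a * eta q a b + if a.rev < a ∧ b < a.rev then (q - q⁻¹)^2 else 0) else 0)
     - (q - q⁻¹) * c b.rev * (if p ≤ b then 0 else if p ≤ a then FF q c p - FF q c b - (q - q⁻¹) * c b ^ 2
        else FF q c a - FF q c b - (q - q⁻¹) * c b^2)

theorem dw_eq (q : ℂ) (a k : Fin m) :
    dw q a k = if (a : ℕ) = k then (if (a : ℕ) = k.rev then 1 else q⁻¹) else if (a : ℕ) = k.rev then q else 1 := by
  simp only [dw, ← Fin.ext_iff]; grind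

theorem scal (hq : q ≠ 0) (hc : ∀ i, c i * c i.rev = 1) (hcm : ∀ i, i = i.rev → c i = 1)
    (a b p : Fin m) (hab : b < a) :
    (q - if p.rev < p then q - q⁻¹ else 0) * (c p * nn q c a b p.rev)
      - (if p = p.rev then 1 else q⁻¹) * (c p * nn q c a b p) + (q - q⁻¹) * SS q c a b p = 0 := by
  let cN : ℕ → ℂ := fun i => if h : i < m then c ⟨i, h⟩ else 1
  have hcN : ∀ i : Fin m, c i = cN i := by intro i; simp [cN]
  have hv : ∀ i : Fin m, (i : ℕ) + (i.rev : ℕ) = m - 1 := by intro i; rw [Fin.val_rev]; omega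
  have e1 : ∀ i j, i + j = m - 1 → cN i * cN j = 1 := by
    intro i j hij
    have := a.isLt
    have hi : i < m := by omega
    have : j = (Fin.rev ⟨i, hi⟩ : Fin m) := by rw [Fin.val_rev]; show j = m - (i + 1); omega
    rw [this, ← hcN, ← hc ⟨i, hi⟩]; simp [cN, hi]
  have e2 : ∀ i, i + i = m - 1 → cN i = 1 := by
    intro i hij
    have := a.isLt
    have hi : i < m := by omega
    have := hcm ⟨i, hi⟩ (by rw [Fin.ext_iff, Fin.val_rev]; simp only; omega)
    rw [← this]; simp [cN, hi]
  have := scalNat (m - 1) q hq cN e1 e2 a b p a.rev b.rev p.rev hab (hv a) (hv b) (hv p)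
  simp only at this
  refine Eq.trans ?_ this
  simp only [nn, SS, FF, eta, dw_eq, hcN, Fin.lt_def, Fin.le_def, Fin.ext_iff, Fin.rev_rev]

theorem scalTot (hq : q ≠ 0) (hc : ∀ i, c i * c i.rev = 1) (hcm : ∀ i, i = i.rev → c i = 1)
    (a b : Fin m) (hab : b < a) :
    c b.rev * (- (q - q⁻¹) * dw q a b.rev * eta q a b + if b < b.rev ∧ b.rev < a then (q - q⁻¹)^2 else 0)
     + (q - q⁻¹) * c a ^2 * c b.rev * dw q a a - (q - q⁻¹) * c b * dw q b b.rev
     + c b.rev * ((q - q⁻¹) * dw q b a * eta q a b + if a.rev < a ∧ b < a.rev then (q - q⁻¹)^2 else 0)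
     - (q - q⁻¹) * c b.rev * (FF q c a - FF q c b - (q - q⁻¹) * c b^2) = 0 := by
  let cN : ℕ → ℂ := fun i => if h : i < m then c ⟨i, h⟩ else 1
  have hcN : ∀ i : Fin m, c i = cN i := by intro i; simp [cN]
  have hv : ∀ i : Fin m, (i : ℕ) + (i.rev : ℕ) = m - 1 := by intro i; rw [Fin.val_rev]; omega
  have e1 : ∀ i j, i + j = m - 1 → cN i * cN j = 1 := by
    intro i j hij
    have := a.isLt
    have hi : i < m := by omega
    have : j = (Fin.rev ⟨i, hi⟩ : Fin m) := by rw [Fin.val_rev]; show j = m - (i + 1); omega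
    rw [this, ← hcN, ← hc ⟨i, hi⟩]; simp [cN, hi]
  have e2 : ∀ i, i + i = m - 1 → cN i = 1 := by
    intro i hij
    have := a.isLt
    have hi : i < m := by omega
    have := hcm ⟨i, hi⟩ (by rw [Fin.ext_iff, Fin.val_rev]; simp only; omega)
    rw [← this]; simp [cN, hi]
  have := scalTotNat (m - 1) q hq cN e1 e2 a b a.rev b.rev hab (hv a) (hv b)
  simp only at this
  refine Eq.trans ?_ this
  simp only [FF, eta, dw_eq, hcN, Fin.lt_def, Fin.ext_iff, Fin.rev_rev]


def Phi (q : ℂ) (c : Fin m → ℂ) (κ : ℂ) : Prop :=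
  ∀ p : Fin m, (q - q⁻¹) * (∑ j, if j < p then c j ^ 2 else 0) = FF q c p - κ

theorem midSum (κ : ℂ) (hΦ : Phi q c κ) (p b : Fin m) (h : b < p) :
    (q - q⁻¹) * (∑ j, if b < j ∧ j < p then c j ^ 2 else 0) = FF q c p - FF q c b - (q - q⁻¹) * c b ^ 2 := by
  have h1 := hΦ p
  have h2 := hΦ b
  have h3 : (∑ j, if j < p then c j ^ 2 else 0) = (∑ j, if b < j ∧ j < p then c j ^ 2 else 0)
      + (∑ j, if j < b then c j ^ 2 else 0) + c b ^ 2 := by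
    have h4 : c b ^ 2 = ∑ j, if j = b then c j ^ 2 else 0 := by simp
    rw [h4, ← Finset.sum_add_distrib, ← Finset.sum_add_distrib]
    refine Finset.sum_congr rfl fun j _ => ?_
    rcases lt_trichotomy j b with h5 | h5 | h5
    · simp [h5, h5.trans h, h5.ne, h5.not_gt]
    · subst h5; simp [h]
    · simp [h5, h5.ne', h5.not_gt]
  rw [h3] at h1
  linear_combination h1 - h2

theorem midSum' (κ : ℂ) (hΦ : Phi q c κ) (p a b : Fin m) (h : b < a) :
    (q - q⁻¹) * (∑ j, if j < p ∧ b < j ∧ j < a then c j ^ 2 else 0) =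
      if p ≤ b then 0 else if p ≤ a then FF q c p - FF q c b - (q - q⁻¹) * c b ^ 2
        else FF q c a - FF q c b - (q - q⁻¹) * c b^2 := by
  split_ifs with h1 h2
  · rw [Finset.sum_eq_zero, mul_zero]
    intro j _; rw [if_neg]; grind
  · rw [← midSum κ hΦ p b (by grind)]
    congr 1; refine Finset.sum_congr rfl fun j _ => ?_
    congr 1; grind
  · rw [← midSum κ hΦ a b h]
    congr 1; refine Finset.sum_congr rfl fun j _ => ?_
    congr 1; grind

theorem sumnn (hc : ∀ i, c i * c i.rev = 1) (a b : Fin m) (h : b < a) (φ : Fin m → Prop) [DecidablePred φ] :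
    (∑ j, if φ j then c j * nn q c a b j else 0) =
      (if φ b.rev then c b.rev * (- (q - q⁻¹) * dw q a b.rev * eta q a b + if b < b.rev ∧ b.rev < a then (q - q⁻¹)^2 else 0) else 0)
     + (if φ a then (q - q⁻¹) * c a ^2 * c b.rev * dw q a a else 0)
     - (if φ b then (q - q⁻¹) * c b * dw q b b.rev else 0)
     + (if φ a.rev then c b.rev * ((q - q⁻¹) * dw q b a * eta q a b + if a.rev < a ∧ b < a.rev then (q - q⁻¹)^2 else 0) else 0)
     - (q - q⁻¹) * c b.rev * ((q - q⁻¹) * ∑ j, if φ j ∧ b < j ∧ j < a then c j ^ 2 else 0) := by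
  have e : ∀ j, (if φ j then c j * nn q c a b j else 0) =
      (if j = b.rev then (if φ b.rev then c b.rev * (- (q - q⁻¹) * dw q a b.rev * eta q a b + if b < b.rev ∧ b.rev < a then (q - q⁻¹)^2 else 0) else 0) else 0)
     + (if j = a then (if φ a then (q - q⁻¹) * c a ^2 * c b.rev * dw q a a else 0) else 0)
     - (if j = b then (if φ b then (q - q⁻¹) * c b * dw q b b.rev else 0) else 0)
     + (if j = a.rev then (if φ a.rev then c b.rev * ((q - q⁻¹) * dw q b a * eta q a b + if a.rev < a ∧ b < a.rev then (q - q⁻¹)^2 else 0) else 0) else 0)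
     - (q - q⁻¹) * c b.rev * ((q - q⁻¹) * if φ j ∧ b < j ∧ j < a then c j ^ 2 else 0) := by
    intro j
    by_cases hj : φ j
    swap
    · simp only [hj, if_false, false_and]
      have h1 : (if j = b.rev then (if φ b.rev then c b.rev * (- (q - q⁻¹) * dw q a b.rev * eta q a b + if b < b.rev ∧ b.rev < a then (q - q⁻¹)^2 else 0) else 0) else 0) = 0 := by grind
      have h2 : (if j = a then (if φ a then (q - q⁻¹) * c a ^2 * c b.rev * dw q a a else 0) else 0) = 0 := by grind
      have h3 : (if j = b then (if φ b then (q - q⁻¹) * c b * dw q b b.rev else 0) else 0) = 0 := by grind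
      have h4 : (if j = a.rev then (if φ a.rev then c b.rev * ((q - q⁻¹) * dw q b a * eta q a b + if a.rev < a ∧ b < a.rev then (q - q⁻¹)^2 else 0) else 0) else 0) = 0 := by grind
      rw [h1, h2, h3, h4]; ring
    simp only [hj, if_true, true_and, nn]
    have ea := hc a
    have t1 : c j * -(if b = j.rev then (q - q⁻¹) * dw q a j * eta q a b else 0)
        + c j * (if b = j.rev ∧ j.rev < j ∧ j < a then (q - q⁻¹)^2 else 0) =
      (if j = b.rev then (if φ b.rev then c b.rev * (- (q - q⁻¹) * dw q a b.rev * eta q a b + if b < b.rev ∧ b.rev < a then (q - q⁻¹)^2 else 0) else 0) else 0) := by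
      by_cases hb : j = b.rev
      · subst hb; simp only [Fin.rev_rev, if_true, hj, true_and]; ring
      · have : b ≠ j.rev := by grind
        simp [hb, this]
    have t2 : c j * (if a = j then (q - q⁻¹) * c a * c b.rev * dw q a j else 0) =
       (if j = a then (if φ a then (q - q⁻¹) * c a ^2 * c b.rev * dw q a a else 0) else 0) := by
      by_cases hb : j = a
      · subst hb; simp only [if_true, hj]; ring
      · have : a ≠ j := by grind
        simp [hb, this]
    have t3 : c j * (if b = j then (q - q⁻¹) * dw q b j.rev else 0) =
       (if j = b then (if φ b then (q - q⁻¹) * c b * dw q b b.rev else 0) else 0) := by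
      by_cases hb : j = b
      · subst hb; simp only [if_true, hj]; ring
      · have : b ≠ j := by grind
        simp [hb, this]
    have t4 : c j * (if a = j.rev then (q - q⁻¹) * c a * c b.rev * dw q b j.rev * eta q a b else 0)
       + c j * (if a = j.rev ∧ j < a ∧ b < j then (q - q⁻¹)^2 * c a * c b.rev else 0) =
       (if j = a.rev then (if φ a.rev then c b.rev * ((q - q⁻¹) * dw q b a * eta q a b + if a.rev < a ∧ b < a.rev then (q - q⁻¹)^2 else 0) else 0) else 0) := by
      by_cases hb : j = a.rev
      · subst hb; simp only [Fin.rev_rev, if_true, hj, true_and]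
        split_ifs
        · linear_combination ((q - q⁻¹) * c b.rev * dw q b a * eta q a b + (q - q⁻¹) ^ 2 * c b.rev) * ea
        · linear_combination ((q - q⁻¹) * c b.rev * dw q b a * eta q a b) * ea
      · have : a ≠ j.rev := by grind
        simp [hb, this]
    have t5 : c j * (if b < j ∧ j < a then (q - q⁻¹)^2 * c j * c b.rev else 0) =
       (q - q⁻¹) * c b.rev * ((q - q⁻¹) * if b < j ∧ j < a then c j ^ 2 else 0) := by
      split_ifs <;> ring
    linear_combination t1 + t2 - t3 + t4 - t5
  simp only [e, Finset.sum_add_distrib, Finset.sum_sub_distrib, Finset.sum_ite_eq', Finset.mem_univ, if_true, Finset.mul_sum]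

theorem offDiag (hq : q ≠ 0) (hc : ∀ i, c i * c i.rev = 1)
    (H : QRel q g c x) (k a b : Fin m) (hba : b < a) :
    ∑ e, NN q c x k a e * NN q c x k.rev e b = nn q c a b k • (x a * x b.rev) := by
  rw [prodN' hc _ _ _ _ hba]
  have hZ : x b.rev * x a = eta q a b • (x a * x b.rev) := by
    simp only [eta]
    rcases lt_trichotomy b.rev a with h | h | h
    · rw [H.h1 b.rev a h (by grind)]; simp [h]
    · simp [h]
    · rw [H.h1 a b.rev h (by grind)]; simp [h.not_gt, h.ne', smul_smul, hq]
  have t0 : ¬ (a = k.rev ∧ b = k.rev) := by grind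
  rw [if_neg t0]
  simp only [Fin.rev_rev, true_and, nn]
  have T1 : (if b = k.rev then ((q - q⁻¹) * dw q a k) • (x k * x a) else 0) =
      (if b = k.rev then (q - q⁻¹) * dw q a k * eta q a b else 0) • (x a * x b.rev) := by
    by_cases h : b = k.rev
    · have : k = b.rev := by grind
      subst this; simp only [Fin.rev_rev, if_true, hZ, smul_smul]
    · simp [h]
  have T2 : (if a = k then ((q - q⁻¹) * c a * c b.rev * dw q a k) • (x k * x b.rev) else 0) =
      (if a = k then (q - q⁻¹) * c a * c b.rev * dw q a k else 0) • (x a * x b.rev) := by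
    by_cases h : a = k
    · subst h; simp only [if_true]
    · simp [h]
  have T3 : (if b = k then ((q - q⁻¹) * dw q b k.rev) • (x a * x k.rev) else 0) =
      (if b = k then (q - q⁻¹) * dw q b k.rev else 0) • (x a * x b.rev) := by
    by_cases h : b = k
    · subst h; simp only [if_true]
    · simp [h]
  have T4 : (if b = k.rev ∧ k.rev < k ∧ k < a then ((q - q⁻¹) ^ 2) • (x a * x k) else 0) =
      (if b = k.rev ∧ k.rev < k ∧ k < a then (q - q⁻¹) ^ 2 else 0) • (x a * x b.rev) := by
    by_cases h : b = k.rev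
    · have : k = b.rev := by grind
      subst this; simp only [Fin.rev_rev, true_and, ite_smul, zero_smul]
    · simp [h]
  have T5 : (if b < k ∧ k < a then ((q - q⁻¹) ^ 2 * c k * c b.rev) • (x a * x b.rev) else 0) =
      (if b < k ∧ k < a then (q - q⁻¹) ^ 2 * c k * c b.rev else 0) • (x a * x b.rev) := by
    simp only [ite_smul, zero_smul]
  have T6 : (if a = k.rev then ((q - q⁻¹) * c a * c b.rev * dw q b k.rev) • (x b.rev * x k.rev) else 0) =
      (if a = k.rev then (q - q⁻¹) * c a * c b.rev * dw q b k.rev * eta q a b else 0) • (x a * x b.rev) := by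
    by_cases h : a = k.rev
    · have : k = a.rev := by grind
      subst this; simp only [Fin.rev_rev, if_true, hZ, smul_smul]
    · simp [h]
  have T7 : (if a = k.rev ∧ k < a ∧ b < k then ((q - q⁻¹) ^ 2 * c a * c b.rev) • (x k.rev * x b.rev) else 0) =
      (if a = k.rev ∧ k < a ∧ b < k then (q - q⁻¹) ^ 2 * c a * c b.rev else 0) • (x a * x b.rev) := by
    by_cases h : a = k.rev
    · have : k = a.rev := by grind
      subst this; simp only [Fin.rev_rev, true_and, ite_smul, zero_smul]
    · simp [h]
  rw [T1, T2, T3, T4, T5, T6, T7]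
  module

theorem H2N (hq : q ≠ 0) (hc : ∀ i, c i * c i.rev = 1) (hcm : ∀ i, i = i.rev → c i = 1)
    (κ : ℂ) (hΦ : Phi q c κ) (H : QRel q g c x) (i a b : Fin m) :
    (q - if i < i.rev then q - q⁻¹ else 0) • (∑ e, NN q c x i a e * NN q c x i.rev e b)
      - (if i = i.rev then 1 else q⁻¹) • (∑ e, NN q c x i.rev a e * NN q c x i e b)
      + ((q - q⁻¹) * c i) • (∑ j, if j < i.rev then c j • (∑ e, NN q c x j a e * NN q c x j.rev e b) else 0)
      + (g * c i) • (∑ j, c j • (∑ e, NN q c x j a e * NN q c x j.rev e b)) = 0 := by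
  rcases lt_trichotomy b a with hba | hab | hab
  · have e1 : ∑ e, NN q c x i.rev a e * NN q c x i e b = nn q c a b i.rev • (x a * x b.rev) := by
      have := offDiag hq hc H i.rev a b hba
      rwa [Fin.rev_rev] at this
    simp only [offDiag hq hc H _ a b hba, e1, smul_smul, ← Finset.sum_smul]
    have e2 : (∑ j, if j < i.rev then (c j * nn q c a b j) • (x a * x b.rev) else 0) =
       SS q c a b i.rev • (x a * x b.rev) := by
      have := sumnn (q := q) hc a b hba (fun j => j < i.rev)
      rw [midSum' κ hΦ _ _ _ hba] at this
      rw [SS, ← this, Finset.sum_smul]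
      simp only [ite_smul, zero_smul]
    have e3 : ∑ j, c j * nn q c a b j = 0 := by
      have := sumnn (q := q) hc a b hba (fun j => True)
      simp only [if_true, true_and] at this
      rw [midSum κ hΦ _ _ hba] at this
      rw [this]
      exact scalTot hq hc hcm a b hba
    have e4 := scal hq hc hcm a b i.rev hba
    rw [e2, e3, mul_zero, zero_smul, add_zero]
    rw [Fin.rev_rev] at e4
    have e5 : (i.rev = i) = (i = i.rev) := by simp only [eq_comm]
    simp only [e5] at e4
    have e6 := hc i
    have e7 : ((q - if i < i.rev then q - q⁻¹ else 0) * nn q c a b i - (if i = i.rev then 1 else q⁻¹) * nn q c a b i.rev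
      + (q - q⁻¹) * c i * SS q c a b i.rev) = 0 := by
      linear_combination c i * e4 - ((q - if i < i.rev then q - q⁻¹ else 0) * nn q c a b i - (if i = i.rev then 1 else q⁻¹) * nn q c a b i.rev) * e6
    rw [smul_smul, ← sub_smul, ← add_smul, e7, zero_smul]
  · subst hab
    have e0 : ∀ k : Fin m, dw q b k * dw q b k.rev = 1 := by
      intro k; simp only [dw]; grind
    have e1 : ∀ k, ∑ e, NN q c x k b e * NN q c x k.rev e b = x k * x k.rev := by
      intro k; rw [prodNd, e0, one_smul]
    have e2 : ∀ k, ∑ e, NN q c x k.rev b e * NN q c x k e b = x k.rev * x k := by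
      intro k; rw [prodNd, mul_comm, e0, one_smul]
    simp only [e1, e2]
    exact H.h2 i
  · simp only [prodN0 hc _ _ _ _ hab]; simp


theorem scalCNat (M : ℕ) (q : ℂ) (hq : q ≠ 0) (c : ℕ → ℂ)
   (hc : ∀ i j, i + j = M → c i * c j = 1) (hcm : ∀ i, i + i = M → c i = 1) (a p a' p' : ℕ)
   (ha : a + a' = M) (hp : p + p' = M) :
   let l := q - q⁻¹
   let d : ℕ → ℕ → ℂ := fun p p' => if p = p' then 1 else q⁻¹
   let F : ℕ → ℕ → ℂ := fun p p' => d p p' * c p ^ 2 + (if p' < p then l else 0)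
   let n : ℕ → ℕ → ℂ := fun k k' => (if a = k' then c a * (1 + if k < a then q * l else 0) else 0)
     + (if a = k then q * c a * d a a' else 0) - (if k < a then q * l * c k else 0)
   (q - if p' < p then l else 0) * n p' p - d p p' * n p p' + l * c p' *
     ((if a' < p then 1 + (if a' < a then q * l else 0) else 0) + (if a < p then q * c a ^ 2 * d a a' else 0)
       - q * (if p < a then F p p' else F a a')) = 0 := by
  intro l d F n
  have ea := hc a a' ha
  have ep := hc p p' hp
  have na : c a ≠ 0 := left_ne_zero_of_mul_eq_one ea
  have np : c p ≠ 0 := left_ne_zero_of_mul_eq_one ep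
  have ea' : c a' = (c a)⁻¹ := eq_inv_of_mul_eq_one_right ea
  have ep' : c p' = (c p)⁻¹ := eq_inv_of_mul_eq_one_right ep
  have r1 : p = p' → c p = 1 := fun h => hcm p (by omega)
  have r3 : a = a' → c a = 1 := fun h => hcm a (by omega)
  have r4 : p = a → c p = c a := fun h => by rw [h]
  have r6 : p = a' → c p = (c a)⁻¹ := fun h => by rw [h, ea']
  clear hc hcm ea ep
  simp only [n, d, F, l]
  rcases lt_trichotomy p a with h3 | h3 | h3 <;>
  rcases lt_trichotomy p p' with h1 | h1 | h1 <;> (try (exfalso; omega)) <;>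
  rcases lt_trichotomy p a' with h7 | h7 | h7 <;> (try (exfalso; omega)) <;>
  rcases lt_trichotomy a a' with h6 | h6 | h6 <;> (try (exfalso; omega)) 
  all_goals
    simp (disch := omega) only [if_pos, if_neg, ea', ep', r1, r3, r4, r6,
      if_true, add_zero, zero_add, sub_zero, zero_sub, mul_zero, zero_mul, neg_zero, mul_one, one_mul, sub_self]
  all_goals (first | done | field)

noncomputable def vv (q : ℂ) (c : Fin m → ℂ) (x : Fin m → A) (a k l : Fin m) : A :=
  (if a = k.rev then c a • x l else 0) + (q * c l.rev) • NN q c x k a l.rev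

theorem vv_eq (hc : ∀ i, c i * c i.rev = 1) (a k l : Fin m) : vv q c x a k l =
   (if a = k.rev then (c a * (1 + if l.rev < a then q * (q - q⁻¹) else 0)) • x l else 0)
   + (if a = l.rev then (q * c a * dw q a k) • x k else 0)
   - (if k = l.rev ∧ k < a then (q * (q - q⁻¹) * c k) • x a else 0) := by
  have e := hc l
  simp only [vv, NN, Fin.rev_rev]
  have t1 : (q * c l.rev) • (if a = l.rev then dw q a k • x k else 0) =
      (if a = l.rev then (q * c a * dw q a k) • x k else 0) := by
    by_cases h : a = l.rev
    · subst h; simp [smul_smul]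
    · simp [h]
  have t2 : (q * c l.rev) • (if l.rev = k ∧ k < a then (q - q⁻¹) • x a else 0) =
      (if k = l.rev ∧ k < a then (q * (q - q⁻¹) * c k) • x a else 0) := by
    by_cases h : k = l.rev
    · subst h; simp only [true_and, if_true, smul_ite, smul_zero, smul_smul]
      split_ifs
      · congr 1; ring
      · rfl
    · have : ¬ l.rev = k := fun h' => h h'.symm
      simp [h, this]
  have t3 : (q * c l.rev) • (if a = k.rev ∧ l.rev < a then ((q - q⁻¹) * c a * c l) • x l else 0) =
      (if a = k.rev ∧ l.rev < a then (c a * (q * (q - q⁻¹))) • x l else 0) := by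
    split_ifs
    · rw [smul_smul]; congr 1; linear_combination (q * (q - q⁻¹) * c a) * e
    · simp
  rw [smul_add, smul_sub, t1, t2, t3]
  generalize (if k = l.rev ∧ k < a then (q * (q - q⁻¹) * c k) • x a else 0) = Y
  generalize (if a = l.rev then (q * c a * dw q a k) • x k else 0) = Z
  split_ifs <;> first | module | (exfalso; grind)

theorem H1C (hq : q ≠ 0) (hc : ∀ i, c i * c i.rev = 1) (k l a : Fin m) (hkl : k < l) (hl : l ≠ k.rev) :
    vv q c x a k l = q • vv q c x a l k := by
  rw [vv_eq hc, vv_eq hc]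
  have f1 : ¬ k = l.rev := by grind
  have f3 : ¬ k.rev < l.rev := by grind
  have f4 : l.rev < k.rev := by grind
  have d1 : ∀ i j : Fin m, i ≠ j → i ≠ j.rev → dw q i j = 1 := by
    intro i j h1 h2; simp only [dw]; grind
  simp only [f1, hl, false_and, if_false, sub_zero]
  by_cases h1 : a = k.rev
  · subst h1
    have : k.rev ≠ l.rev := by grind
    simp only [this, f4, if_true, if_false]
    rw [d1 _ _ (by grind) (by grind)]
    match_scalars; field
  by_cases h2 : a = l.rev
  · subst h2
    simp only [h1, f3, if_true, if_false]
    rw [d1 _ _ (by grind) (by grind)]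
    module
  simp [h1, h2]

noncomputable def nC (q : ℂ) (c : Fin m → ℂ) (a k : Fin m) : ℂ :=
  (if a = k.rev then c a * (1 + if k < a then q * (q - q⁻¹) else 0) else 0)
     + (if a = k then q * c a * (if a = a.rev then 1 else q⁻¹) else 0) - (if k < a then q * (q - q⁻¹) * c k else 0)

theorem vv_diag (hc : ∀ i, c i * c i.rev = 1) (a k : Fin m) : vv q c x a k k.rev = nC q c a k • x a := by
  rw [vv_eq hc, nC]
  simp only [Fin.rev_rev, true_and, sub_smul, add_smul, ite_smul, zero_smul]
  congr 2
  · split_ifs with h <;> simp [h]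
  · by_cases h : a = k
    · subst h; simp only [if_true, dw, true_and]
      congr 2; grind
    · simp [h]

theorem scalC (hq : q ≠ 0) (hc : ∀ i, c i * c i.rev = 1) (hcm : ∀ i, i = i.rev → c i = 1)
    (a p : Fin m) :
    (q - if p.rev < p then q - q⁻¹ else 0) * nC q c a p.rev
      - (if p = p.rev then 1 else q⁻¹) * nC q c a p + (q - q⁻¹) * c p.rev *
     ((if a.rev < p then 1 + (if a.rev < a then q * (q - q⁻¹) else 0) else 0)
       + (if a < p then q * c a ^ 2 * (if a = a.rev then 1 else q⁻¹) else 0)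
       - q * (if p < a then FF q c p else FF q c a)) = 0 := by
  let cN : ℕ → ℂ := fun i => if h : i < m then c ⟨i, h⟩ else 1
  have hcN : ∀ i : Fin m, c i = cN i := by intro i; simp [cN]
  have hv : ∀ i : Fin m, (i : ℕ) + (i.rev : ℕ) = m - 1 := by intro i; rw [Fin.val_rev]; omega
  have e1 : ∀ i j, i + j = m - 1 → cN i * cN j = 1 := by
    intro i j hij
    have := a.isLt
    have hi : i < m := by omega
    have : j = (Fin.rev ⟨i, hi⟩ : Fin m) := by rw [Fin.val_rev]; show j = m - (i + 1); omega
    rw [this, ← hcN, ← hc ⟨i, hi⟩]; simp [cN, hi]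
  have e2 : ∀ i, i + i = m - 1 → cN i = 1 := by
    intro i hij
    have := a.isLt
    have hi : i < m := by omega
    have := hcm ⟨i, hi⟩ (by rw [Fin.ext_iff, Fin.val_rev]; simp only; omega)
    rw [← this]; simp [cN, hi]
  have := scalCNat (m - 1) q hq cN e1 e2 a p a.rev p.rev (hv a) (hv p)
  simp only at this
  refine Eq.trans ?_ this
  simp only [nC, FF, hcN, Fin.lt_def, Fin.ext_iff, Fin.rev_rev]

theorem sumnC (hc : ∀ i, c i * c i.rev = 1) (a : Fin m) (φ : Fin m → Prop) [DecidablePred φ] :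
    (∑ j, if φ j then c j * nC q c a j else 0) =
      (if φ a.rev then 1 + (if a.rev < a then q * (q - q⁻¹) else 0) else 0)
       + (if φ a then q * c a ^ 2 * (if a = a.rev then 1 else q⁻¹) else 0)
       - q * ((q - q⁻¹) * ∑ j, if φ j ∧ j < a then c j ^ 2 else 0) := by
  have e : ∀ j, (if φ j then c j * nC q c a j else 0) =
      (if j = a.rev then (if φ a.rev then 1 + (if a.rev < a then q * (q - q⁻¹) else 0) else 0) else 0)
     + (if j = a then (if φ a then q * c a ^ 2 * (if a = a.rev then 1 else q⁻¹) else 0) else 0)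
     - q * ((q - q⁻¹) * if φ j ∧ j < a then c j ^ 2 else 0) := by
    intro j
    by_cases hj : φ j
    swap
    · have h1 : (if j = a.rev then (if φ a.rev then 1 + (if a.rev < a then q * (q - q⁻¹) else 0) else 0) else 0) = 0 := by grind
      have h2 : (if j = a then (if φ a then q * c a ^ 2 * (if a = a.rev then 1 else q⁻¹) else 0) else 0) = 0 := by grind
      rw [h1, h2]; simp [hj]
    simp only [hj, if_true, true_and, nC]
    have ea := hc a
    have t1 : c j * (if a = j.rev then c a * (1 + if j < a then q * (q - q⁻¹) else 0) else 0) =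
        (if j = a.rev then (if φ a.rev then 1 + (if a.rev < a then q * (q - q⁻¹) else 0) else 0) else 0) := by
      by_cases h : j = a.rev
      · subst h; simp only [Fin.rev_rev, if_true, hj]
        linear_combination (1 + if a.rev < a then q * (q - q⁻¹) else 0) * ea
      · have : a ≠ j.rev := by grind
        simp [h, this]
    have t2 : c j * (if a = j then q * c a * (if a = a.rev then 1 else q⁻¹) else 0) =
        (if j = a then (if φ a then q * c a ^ 2 * (if a = a.rev then 1 else q⁻¹) else 0) else 0) := by
      by_cases h : j = a
      · subst h; simp only [if_true, hj]; ring
      · have : a ≠ j := by grind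
        simp [h, this]
    have t3 : c j * (if j < a then q * (q - q⁻¹) * c j else 0) = q * ((q - q⁻¹) * if j < a then c j ^ 2 else 0) := by
      split_ifs <;> ring
    linear_combination t1 + t2 - t3
  simp only [e, Finset.sum_add_distrib, Finset.sum_sub_distrib, Finset.sum_ite_eq', Finset.mem_univ, if_true, Finset.mul_sum]

theorem H2C (hq : q ≠ 0) (hc : ∀ i, c i * c i.rev = 1) (hcm : ∀ i, i = i.rev → c i = 1)
    (κ : ℂ) (hΦ : Phi q c κ) (hg : g * (1 + q * κ) = - (q * κ * (q - q⁻¹))) (i a : Fin m) :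
    (q - if i < i.rev then q - q⁻¹ else 0) • vv q c x a i i.rev
      - (if i = i.rev then 1 else q⁻¹) • vv q c x a i.rev i
      + ((q - q⁻¹) * c i) • (∑ j, if j < i.rev then c j • vv q c x a j j.rev else 0)
      + (g * c i) • (∑ j, c j • vv q c x a j j.rev) = 0 := by
  have e1 : vv q c x a i.rev i = nC q c a i.rev • x a := by
    have := vv_diag (q := q) (x := x) hc a i.rev
    rwa [Fin.rev_rev] at this
  simp only [e1, vv_diag hc, smul_smul, ← Finset.sum_smul]
  have e2 : (∑ j, if j < i.rev then (c j * nC q c a j) • x a else 0) =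
      (∑ j, if j < i.rev then (c j * nC q c a j) else 0) • x a := by
    rw [Finset.sum_smul]; simp only [ite_smul, zero_smul]
  rw [e2, sumnC hc a (fun j => j < i.rev)]
  have e3 := sumnC (q := q) hc a (fun j => True)
  simp only [if_true, true_and] at e3
  rw [hΦ a] at e3
  have e4 : (q - q⁻¹) * (∑ j, if j < i.rev ∧ j < a then c j ^ 2 else 0) =
      (if i.rev < a then FF q c i.rev else FF q c a) - κ := by
    split_ifs with h
    · rw [← hΦ]; congr 1; refine Finset.sum_congr rfl fun j _ => ?_; congr 1; grind
    · rw [← hΦ]; congr 1; refine Finset.sum_congr rfl fun j _ => ?_; congr 1; grind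
  have e5 := scalC hq hc hcm a i.rev
  rw [e3, e4]
  simp only [smul_smul, ← add_smul, ← sub_smul]
  refine (congrArg (· • x a) ?_).trans (zero_smul ℂ (x a))
  simp only [Fin.rev_rev] at e5
  have e6 : (i.rev = i) = (i = i.rev) := by simp only [eq_comm]
  simp only [e6] at e5
  refine Eq.trans ?_ e5
  have e7 : (q * c a ^ 2 * if a = a.rev then 1 else q⁻¹) = q * ((if a = a.rev then 1 else q⁻¹) * c a ^ 2) := by ring
  have e8 : (if a.rev < a then q * (q - q⁻¹) else 0) = q * (if a.rev < a then (q - q⁻¹) else 0) := by split_ifs <;> ring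
  have e9 : FF q c a = (if a = a.rev then 1 else q⁻¹) * c a ^2 + (if a.rev < a then (q - q⁻¹) else 0) := rfl
  rw [e8, e7, e9]
  linear_combination c i * hg

noncomputable def MM (q : ℂ) (c : Fin m → ℂ) (x : Fin m → A) (k : Fin m) : Matrix (Option (Fin m)) (Option (Fin m)) A
  | none, none => x k
  | none, some _ => 0
  | some a, none => if a = k.rev then algebraMap ℂ A (c a) else 0
  | some a, some b => q • NN q c x k a b

theorem MM_mul (k l : Fin m) (r s : Option (Fin m)) : (MM q c x k * MM q c x l) r s =
    match r, s with
    | none, none => x k * x l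
    | none, some _ => 0
    | some a, none => vv q c x a k l
    | some a, some b => (q ^ 2) • ∑ e, NN q c x k a e * NN q c x l e b := by
  rw [Matrix.mul_apply, Fintype.sum_option]
  rcases r with _ | a <;> rcases s with _ | b <;> simp only [MM, mul_zero, zero_mul, Finset.sum_const_zero, add_zero, zero_add]
  · simp only [vv]
    congr 1
    · split_ifs
      · rw [Algebra.smul_def]
      · simp
    · rw [Finset.sum_eq_single l.rev]
      · rw [if_pos rfl, ← Algebra.commutes, ← Algebra.smul_def, smul_smul, mul_comm]
      · intro e _ he; simp [he]
      · simp
  · rw [Finset.smul_sum]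
    refine Finset.sum_congr rfl fun e _ => ?_
    rw [smul_mul_smul_comm, sq]

theorem QRel_MM (hq : q ≠ 0) (hc : ∀ i, c i * c i.rev = 1) (hcm : ∀ i, i = i.rev → c i = 1)
    (κ : ℂ) (hΦ : Phi q c κ) (hg : g * (1 + q * κ) = - (q * κ * (q - q⁻¹))) (H : QRel q g c x) :
    QRel q g c (MM q c x) := by
  constructor
  · intro k l hkl hl
    ext r s
    rw [Matrix.smul_apply, MM_mul, MM_mul]
    rcases r with _ | a <;> rcases s with _ | b <;> simp only
    · exact H.h1 k l hkl hl
    · simp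
    · exact H1C hq hc k l a hkl hl
    · rw [H1N hq hc hcm H k l a b hkl hl]; module
  · intro i
    ext r s
    have e : (TT c (MM q c x) i.rev) r s = ∑ j, if j < i.rev then c j • (MM q c x j * MM q c x j.rev) r s else 0 := by
      rw [TT, Matrix.sum_apply]
      refine Finset.sum_congr rfl fun j _ => ?_
      split_ifs <;> simp
    simp only [Matrix.add_apply, Matrix.sub_apply, Matrix.smul_apply, Matrix.sum_apply, Matrix.zero_apply, e]
    simp only [MM_mul]
    rcases r with _ | a <;> rcases s with _ | b <;> simp only
    · exact H.h2 i
    · simp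
    · exact H2C hq hc hcm κ hΦ hg i a
    · have := congrArg (fun y => q ^ 2 • y) (H2N hq hc hcm κ hΦ H i a b)
      simp only [smul_add, smul_sub, smul_zero, Finset.smul_sum, smul_ite] at this ⊢
      refine Eq.trans ?_ this
      simp only [smul_comm (q ^ 2)]


variable (qq : Set.Ioo (0 : ℝ) 1)

theorem Q_ne : ((qq : ℝ) : ℂ) ≠ 0 := by
  exact_mod_cast qq.2.1.ne'

theorem cc_mul (i : Fin m) : metricCoeff qq i * metricCoeff qq i.rev = 1 := by
  have h : rho i.rev = - rho i := by
    simp only [rho, Fin.rev_rev]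
    rcases lt_trichotomy i i.rev with h | h | h
    · simp [h, h.ne, h.ne', h.not_gt]
    · simp only [if_pos h, if_pos h.symm, neg_zero]
    · simp [h, h.ne, h.ne', h.not_gt]
  rw [metricCoeff, metricCoeff, h, ← Complex.ofReal_mul, ← Real.rpow_add qq.2.1]
  simp

theorem cc_mid (i : Fin m) (h : i = i.rev) : metricCoeff qq i = 1 := by
  simp [metricCoeff, rho, if_pos h]

theorem cc_sq (i : Fin m) : metricCoeff qq i ^ 2 = ((qq : ℝ) : ℂ) ^ (2 * (i : ℕ) + 2 - m +
    (if i = i.rev then -1 else if i < i.rev then 0 else -2) : ℤ) := by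
  have h0 : ((qq : ℝ) ^ (-rho i)) ^ 2 = (qq : ℝ) ^ (2 * (i : ℕ) + 2 - m +
    (if i = i.rev then -1 else if i < i.rev then 0 else -2) : ℤ) := by
    rw [← Real.rpow_natCast, ← Real.rpow_mul qq.2.1.le, ← Real.rpow_intCast]
    congr 1
    have := i.isLt
    rcases lt_trichotomy i i.rev with h | h | h
    · simp only [rho, h, h.ne, if_true, if_false]; push_cast; ring
    · have h' : (i : ℕ) = m - (i + 1) := by have := congrArg Fin.val h; rwa [Fin.val_rev] at this
      have h'' : ((m : ℕ) : ℝ) = i + i + 1 := by exact_mod_cast (by omega : m = i + i + 1)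
      simp only [rho, if_pos h, Nat.cast_ofNat]; push_cast; rw [h'']; ring
    · have h'' : ((i.rev : ℕ) : ℝ) = m - (i + 1) := by
        rw [Fin.val_rev, Nat.cast_sub (by omega)]; push_cast; ring
      simp only [rho, h.ne', h.not_gt, if_false, h'']; push_cast; ring
  rw [metricCoeff]
  exact_mod_cast congrArg (fun t : ℝ => (t : ℂ)) h0

theorem sum_lt_succ (f : Fin m → ℂ) (p r : Fin m) (h : (r : ℕ) = p + 1) :
    (∑ j, if j < r then f j else 0) = (∑ j, if j < p then f j else 0) + f p := by
  have h4 : f p = ∑ j, if j = p then f j else 0 := by simp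
  conv_rhs => rw [h4]
  rw [← Finset.sum_add_distrib]
  refine Finset.sum_congr rfl fun j _ => ?_
  have h1 : j < r ↔ j < p ∨ j = p := by
    rw [Fin.lt_def, Fin.lt_def, Fin.ext_iff]; omega
  rcases lt_trichotomy j p with h5 | h5 | h5
  · simp [h1, h5, h5.ne]
  · subst h5; simp [h1]
  · simp [h1, h5.ne', h5.not_gt]

theorem Phi_cc : Phi (m := m) ((qq : ℝ) : ℂ) (metricCoeff qq) (((qq : ℝ) : ℂ) ^ (1 - (m : ℤ))) := by
  have hq := Q_ne qq
  set Q : ℂ := ((qq : ℝ) : ℂ) with hQ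
  have key : ∀ n : ℕ, ∀ p : Fin m, (p : ℕ) = n →
      (Q - Q⁻¹) * (∑ j, if j < p then metricCoeff qq j ^ 2 else 0) = FF Q (metricCoeff qq) p - Q ^ (1 - (m : ℤ)) := by
    intro n
    induction n with
    | zero =>
      intro p hp
      have e0 : (∑ j : Fin m, if j < p then metricCoeff qq j ^ 2 else 0) = 0 := by
        apply Finset.sum_eq_zero; intro j _; rw [if_neg]; rw [Fin.lt_def]; omega
      rw [e0, FF, cc_sq, ← hQ]
      have := p.isLt
      have hr := Fin.val_rev p
      have h3 : ¬ p.rev < p := by rw [Fin.lt_def]; omega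
      rw [if_neg h3]
      by_cases h : p = p.rev
      · have h' := congrArg Fin.val h
        have : m = 1 := by omega
        rw [if_pos h, if_pos h, hp, this]; norm_num
      · have h2 : p < p.rev := by rw [Fin.ext_iff] at h; rw [Fin.lt_def]; omega
        rw [if_neg h, if_neg h, if_pos h2, hp, ← zpow_neg_one, ← zpow_add₀ hq]
        rw [show (-1 + (2 * ((0 : ℕ) : ℤ) + 2 - m + 0) : ℤ) = 1 - m by push_cast; ring]; ring
    | succ n ih =>
      intro r hr
      have hlt : n < m := by have := r.isLt; omega
      have hi := ih ⟨n, hlt⟩ rfl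
      set p : Fin m := ⟨n, hlt⟩ with hp
      have hpv : (p : ℕ) = n := rfl
      rw [sum_lt_succ _ p r (by rw [hr]), mul_add, hi]
      have e1 := Fin.val_rev p
      have e2 := Fin.val_rev r
      have e3 := r.isLt
      suffices h : (Q - Q⁻¹) * metricCoeff qq p ^ 2 + FF Q (metricCoeff qq) p = FF Q (metricCoeff qq) r by linear_combination h
      rw [FF, FF, cc_sq, cc_sq, ← hQ]
      simp only [Fin.lt_def, Fin.ext_iff]
      have hz : ∀ a b : ℤ, a + 1 = b → Q ^ a * Q = Q ^ b := by
        intro a b hab; rw [← hab, zpow_add_one₀ hq]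
      have hz' : ∀ a b : ℤ, a - 1 = b → Q ^ a * Q⁻¹ = Q ^ b := by
        intro a b hab; rw [← hab, zpow_sub_one₀ hq]
      have hz0 : ∀ a : ℤ, a = 0 → Q ^ a = 1 := by intro a h; rw [h, zpow_zero]
      rcases lt_trichotomy (p : ℕ) p.rev with h | h | h
      · rcases lt_trichotomy (r : ℕ) r.rev with h' | h' | h'
        · simp (disch := omega) only [if_pos, if_neg]
          linear_combination hz (2 * (p : ℕ) + 2 - m + 0) (2 * (p : ℕ) + 2 - m + 1) (by ring)
            - hz' (2 * (r : ℕ) + 2 - m + 0) (2 * (p : ℕ) + 2 - m + 1) (by omega)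
        · simp (disch := omega) only [if_pos, if_neg]
          linear_combination hz (2 * (p : ℕ) + 2 - m + 0) (2 * (r : ℕ) + 2 - m + -1) (by omega)
        · simp (disch := omega) only [if_pos, if_neg]
          rw [hz0 (2 * (p : ℕ) + 2 - m + 0) (by omega), hz0 (2 * (r : ℕ) + 2 - m + -2) (by omega)]; ring
      · simp (disch := omega) only [if_pos, if_neg]
        rw [hz0 (2 * (p : ℕ) + 2 - m + -1) (by omega)]
        linear_combination - hz' (2 * (r : ℕ) + 2 - m + -2) 0 (by omega) - zpow_zero Q
      · simp (disch := omega) only [if_pos, if_neg]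
        linear_combination hz (2 * (p : ℕ) + 2 - m + -2) (2 * (p : ℕ) + 2 - m + -1) (by omega)
          - hz' (2 * (r : ℕ) + 2 - m + -2) (2 * (p : ℕ) + 2 - m + -1) (by omega)
  intro p
  exact key p p rfl

theorem metricTrace_eq : metricTrace m qq = ∑ i : Fin m, metricCoeff qq i ^ 2 := by
  rw [metricTrace]
  refine Finset.sum_congr rfl fun i _ => ?_
  simp [metric, sq]

theorem sum_sq (hm : 1 ≤ m) : (((qq : ℝ) : ℂ) - ((qq : ℝ) : ℂ)⁻¹) * metricTrace m qq =
    (1 + ((qq : ℝ) : ℂ) * ((qq : ℝ) : ℂ) ^ (1 - (m : ℤ))) *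
      (((qq : ℝ) : ℂ) ^ ((m : ℤ) - 1) - ((qq : ℝ) : ℂ)⁻¹) := by
  have hq := Q_ne qq
  set Q : ℂ := ((qq : ℝ) : ℂ) with hQ
  let p : Fin m := ⟨m - 1, by omega⟩
  have hpv : (p : ℕ) = m - 1 := rfl
  have e := Fin.val_rev p
  have h := Phi_cc (m := m) qq p
  have h2 : metricTrace m qq = (∑ j, if j < p then metricCoeff qq j ^ 2 else 0) + metricCoeff qq p ^ 2 := by
    have h4 : metricCoeff qq p ^ 2 = ∑ j : Fin m, if j = p then metricCoeff qq j ^ 2 else 0 := by simp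
    rw [metricTrace_eq, h4, ← Finset.sum_add_distrib]
    refine Finset.sum_congr rfl fun j _ => ?_
    have := j.isLt
    by_cases hj : j = p
    · simp [hj]
    · have : j < p := by rw [Fin.ext_iff] at hj; rw [Fin.lt_def]; omega
      simp [hj, this]
  rw [h2, mul_add, h, FF, cc_sq, ← hQ]
  simp only [Fin.lt_def, Fin.ext_iff]
  obtain ⟨n, rfl⟩ : ∃ n, m = n + 1 := ⟨m - 1, by omega⟩
  have hn : ((p : ℕ) : ℤ) = n := by rw [hpv]; simp
  by_cases hn0 : n = 0
  · subst hn0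
    simp (disch := omega) only [if_pos, if_neg]
    rw [hn]; norm_num; field
  · simp (disch := omega) only [if_pos, if_neg]
    rw [hn]
    have z1 : Q ^ (2 * (n : ℤ) + 2 - ((n + 1 : ℕ) : ℤ) + -2) = Q ^ (n : ℤ) * Q⁻¹ := by
      rw [← zpow_sub_one₀ hq]; congr 1; push_cast; ring
    have z2 : Q ^ (1 - ((n + 1 : ℕ) : ℤ)) = (Q ^ (n : ℤ))⁻¹ := by
      rw [← zpow_neg]; congr 1; push_cast; ring
    have z3 : Q ^ (((n + 1 : ℕ) : ℤ) - 1) = Q ^ (n : ℤ) := by congr 1; push_cast; ring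
    have z4 : Q ^ (n : ℤ) ≠ 0 := zpow_ne_zero _ hq
    rw [z1, z2, z3]
    generalize Q ^ (n : ℤ) = z at *
    field

noncomputable def gam (m : ℕ) (qq : Set.Ioo (0 : ℝ) 1) : ℂ :=
  (((qq : ℝ) : ℂ) ^ (1 - (m : ℤ)) - ((qq : ℝ) : ℂ)) / metricTrace m qq

theorem gam_eq (hm : 1 ≤ m) : gam m qq * (1 + ((qq : ℝ) : ℂ) * ((qq : ℝ) : ℂ) ^ (1 - (m : ℤ))) =
    - (((qq : ℝ) : ℂ) * ((qq : ℝ) : ℂ) ^ (1 - (m : ℤ)) * (((qq : ℝ) : ℂ) - ((qq : ℝ) : ℂ)⁻¹)) := by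
  have hC : metricTrace m qq ≠ 0 := by
    have h1 : metricTrace m qq = ((∑ i : Fin m, ((qq : ℝ) ^ (-rho i)) ^ 2 : ℝ) : ℂ) := by
      rw [metricTrace_eq]; simp [metricCoeff]
    rw [h1]
    have : (0 : ℝ) < ∑ i : Fin m, ((qq : ℝ) ^ (-rho i)) ^ 2 := by
      apply Finset.sum_pos
      · intro i _; have := Real.rpow_pos_of_pos qq.2.1 (-rho i); positivity
      · exact ⟨⟨0, hm⟩, Finset.mem_univ _⟩
    exact_mod_cast this.ne'
  have h := sum_sq qq hm
  have hq := Q_ne qq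
  rw [gam, div_mul_eq_mul_div, div_eq_iff hC]
  set Q : ℂ := ((qq : ℝ) : ℂ) with hQ
  have z1 : Q ^ ((m : ℤ) - 1) * Q ^ (1 - (m : ℤ)) = 1 := by
    rw [← zpow_add₀ hq]; simp
  have z2 : Q * Q⁻¹ = 1 := mul_inv_cancel₀ hq
  linear_combination (Q * Q ^ (1 - (m : ℤ))) * h + (1 + Q * Q ^ (1 - (m : ℤ))) * Q * z1
    - (1 + Q * Q ^ (1 - (m : ℤ))) * Q ^ (1 - (m : ℤ)) * z2


theorem sumRhat (f : Fin m → Fin m → A) (i j : Fin m) :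
    ∑ k, ∑ l, Rhat m qq (i, j) (k, l) • f k l =
      (if i = j ∧ i ≠ j.rev then ((qq : ℝ) : ℂ) else if i = j.rev ∧ i ≠ j then ((qq : ℝ) : ℂ)⁻¹ else 1) • f j i
      + (if i < j then (((qq : ℝ) : ℂ) - ((qq : ℝ) : ℂ)⁻¹) • f i j else 0)
      - (if j = i.rev then ((((qq : ℝ) : ℂ) - ((qq : ℝ) : ℂ)⁻¹) * metricCoeff qq i) •
          (∑ k, if k < i.rev then metricCoeff qq k • f k k.rev else 0) else 0) := by
  simp only [Rhat, Matrix.of_apply, add_smul, sub_smul, Finset.sum_add_distrib, Finset.sum_sub_distrib]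
  congr 1
  · congr 1
    · rw [Finset.sum_eq_single j, Finset.sum_eq_single i]
      · simp
      · intro b _ hb; simp [hb.symm]
      · simp
      · intro b _ hb; simp [hb.symm]
      · simp
    · rw [Finset.sum_eq_single i, Finset.sum_eq_single j]
      · simp only [true_and, ite_smul, zero_smul, sub_smul]
      · intro b _ hb; simp [hb.symm]
      · simp
      · intro b _ hb; simp [hb.symm]
      · simp
  · by_cases h : j = i.rev
    · rw [if_pos h, Finset.smul_sum]
      refine Finset.sum_congr rfl fun k _ => ?_
      rw [Finset.sum_eq_single k.rev]
      · have e : i < k.rev ↔ k < i.rev := by grind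
        simp only [metric, Matrix.of_apply, h, if_true, e]
        split_ifs
        · rw [smul_smul]
        · simp
      · intro b _ hb; simp [metric, hb]
      · simp
    · rw [if_neg h]
      apply Finset.sum_eq_zero; intro k _
      apply Finset.sum_eq_zero; intro l _
      simp [metric, h]

theorem sumProjTrace (x : Fin m → A) (i j : Fin m) :
    ∑ k, ∑ l, projTrace m qq (i, j) (k, l) • (x k * x l) =
      if j = i.rev then (metricCoeff qq i / metricTrace m qq) • ∑ k, metricCoeff qq k • (x k * x k.rev) else 0 := by
  by_cases h : j = i.rev
  · rw [if_pos h, Finset.smul_sum]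
    refine Finset.sum_congr rfl fun k _ => ?_
    rw [Finset.sum_eq_single k.rev]
    · simp only [projTrace, metric, Matrix.of_apply, h, if_true, smul_smul]
      congr 1; ring
    · intro b _ hb; simp [projTrace, metric, hb]
    · simp
  · rw [if_neg h]
    apply Finset.sum_eq_zero; intro k _
    apply Finset.sum_eq_zero; intro l _
    simp [projTrace, metric, h]

theorem sumProjAnti (x : Fin m → A) (i j : Fin m) :
    ∑ k, ∑ l, projAnti m qq (i, j) (k, l) • (x k * x l) =
      (((qq : ℝ) : ℂ) + ((qq : ℝ) : ℂ)⁻¹)⁻¹ • (((qq : ℝ) : ℂ) • (x i * x j)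
      - (if i = j ∧ i ≠ j.rev then ((qq : ℝ) : ℂ) else if i = j.rev ∧ i ≠ j then ((qq : ℝ) : ℂ)⁻¹ else 1) • (x j * x i)
      - (if i < j then (((qq : ℝ) : ℂ) - ((qq : ℝ) : ℂ)⁻¹) • (x i * x j) else 0)
      + (if j = i.rev then ((((qq : ℝ) : ℂ) - ((qq : ℝ) : ℂ)⁻¹) * metricCoeff qq i) • TT (metricCoeff qq) x i.rev else 0)
      + (if j = i.rev then (gam m qq * metricCoeff qq i) • ∑ k, metricCoeff qq k • (x k * x k.rev) else 0)) := by
  have e1 : ∑ k, ∑ l, (1 : Matrix (Fin m × Fin m) (Fin m × Fin m) ℂ) (i, j) (k, l) • (x k * x l) = x i * x j := by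
    rw [Finset.sum_eq_single i, Finset.sum_eq_single j]
    · simp
    · intro b _ hb; simp [Matrix.one_apply, hb.symm]
    · simp
    · intro b _ hb; simp [Matrix.one_apply, hb.symm]
    · simp
  have e2 := sumRhat (A := A) qq (fun k l => x k * x l) i j
  rw [← TT] at e2
  have e3 := sumProjTrace (A := A) qq x i j
  have e4 : ∑ k, ∑ l, projAnti m qq (i, j) (k, l) • (x k * x l) =
     (((qq : ℝ) : ℂ) + ((qq : ℝ) : ℂ)⁻¹)⁻¹ • (((qq : ℝ) : ℂ) •
      (∑ k, ∑ l, (1 : Matrix (Fin m × Fin m) (Fin m × Fin m) ℂ) (i, j) (k, l) • (x k * x l))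
      - (∑ k, ∑ l, Rhat m qq (i, j) (k, l) • (x k * x l))
      + (((qq : ℝ) : ℂ) ^ (1 - (m : ℤ)) - ((qq : ℝ) : ℂ)) • ∑ k, ∑ l, projTrace m qq (i, j) (k, l) • (x k * x l)) := by
    simp only [Finset.smul_sum, ← Finset.sum_add_distrib, ← Finset.sum_sub_distrib]
    refine Finset.sum_congr rfl fun k _ => Finset.sum_congr rfl fun l _ => ?_
    simp only [projAnti, Matrix.smul_apply, Matrix.add_apply, Matrix.sub_apply, smul_eq_mul]
    module
  rw [e4, e1, e2, e3]
  congr 1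
  by_cases h : j = i.rev
  · simp only [if_pos h, smul_smul, gam]
    rw [show (((qq : ℝ) : ℂ) ^ (1 - (m : ℤ)) - ((qq : ℝ) : ℂ)) * (metricCoeff qq i / metricTrace m qq) =
      (((qq : ℝ) : ℂ) ^ (1 - (m : ℤ)) - ((qq : ℝ) : ℂ)) / metricTrace m qq * metricCoeff qq i by ring]
    abel
  · simp only [if_neg h, smul_zero]; abel

theorem Q_add_ne : (((qq : ℝ) : ℂ) + ((qq : ℝ) : ℂ)⁻¹) ≠ 0 := by
  have h := qq.2.1
  have : (0 : ℝ) < (qq : ℝ) + (qq : ℝ)⁻¹ := by positivity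
  exact_mod_cast this.ne'

theorem stepA (q : ℂ) (i : Fin m) (X Y : A) :
    q • X - (if i = i.rev ∧ i ≠ i then q else if True ∧ i ≠ i.rev then q⁻¹ else 1) • Y
      - (if i < i.rev then (q - q⁻¹) • X else 0) =
    (q - if i < i.rev then q - q⁻¹ else 0) • X - (if i = i.rev then 1 else q⁻¹) • Y := by
  have e1 : (if i = i.rev ∧ i ≠ i then q else if True ∧ i ≠ i.rev then q⁻¹ else 1) =
      if i = i.rev then 1 else q⁻¹ := by grind
  rw [e1]
  split_ifs <;> module

theorem QRel_of_rel (x : Fin m → A) (h : ∀ i j, ∑ k, ∑ l, projAnti m qq (i, j) (k, l) • (x k * x l) = 0) :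
    QRel ((qq : ℝ) : ℂ) (gam m qq) (metricCoeff qq) x := by
  have hq := Q_ne qq
  have h' : ∀ i j, _ := fun i j => (smul_eq_zero_iff_right (inv_ne_zero (Q_add_ne qq))).1
    ((sumProjAnti (A := A) qq x i j).symm.trans (h i j))
  set Q : ℂ := ((qq : ℝ) : ℂ) with hQ
  constructor
  · intro i j hij hj
    have := h' i j
    have n1 : ¬ i = j.rev := by grind
    simp only [hij, hij.ne, n1, hj, false_and, if_true, if_false, add_zero] at this
    linear_combination (norm := match_scalars <;> field) Q • this
  · intro i
    have := h' i i.rev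
    refine Eq.trans ?_ this
    have n1 : ¬ (i = i.rev ∧ i ≠ i.rev.rev) := by grind
    simp only [Fin.rev_rev, if_true]
    rw [stepA]

theorem rel_of_QRel (x : Fin m → A) (H : QRel ((qq : ℝ) : ℂ) (gam m qq) (metricCoeff qq) x) (i j : Fin m) :
    ∑ k, ∑ l, projAnti m qq (i, j) (k, l) • (x k * x l) = 0 := by
  have hq := Q_ne qq
  rw [sumProjAnti]
  set Q : ℂ := ((qq : ℝ) : ℂ) with hQ
  by_cases hj : j = i.rev
  · subst hj
    have := H.h2 i
    have e : ∀ y : A, y = 0 → (Q + Q⁻¹)⁻¹ • y = 0 := by rintro y rfl; simp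
    apply e
    refine Eq.trans ?_ this
    simp only [Fin.rev_rev, if_true]
    rw [stepA]
  · have n1 : ¬ i = j.rev := by grind
    simp only [hj, n1, false_and, if_false, add_zero]
    rcases lt_trichotomy i j with h | h | h
    · rw [H.h1 i j h hj]
      simp only [h, h.ne, false_and, if_true, if_false]
      match_scalars; field
    · subst h; simp [n1]
    · rw [H.h1 j i h n1]
      simp [h.not_gt, h.ne']

theorem scalInvNat (M : ℕ) (q : ℂ) (hq : q ≠ 0) (c : ℕ → ℂ)
   (hc : ∀ i j, i + j = M → c i * c j = 1) (hcm : ∀ i, i + i = M → c i = 1) (s p s' p' : ℕ)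
   (hs : s + s' = M) (hp : p + p' = M) :
   let l := q - q⁻¹
   let d : ℕ → ℕ → ℂ := fun p p' => if p = p' then 1 else q⁻¹
   let e : ℕ → ℕ → ℂ := fun p p' => if p = p' then 1 else q
   let F : ℕ → ℕ → ℂ := fun p p' => d p p' * c p ^ 2 + (if p' < p then l else 0)
   d p p' * ((if p = s' then e p p' else 0) - (if p' < p then if p = s then l else 0 else 0)
      + (if s' < p then l * c p * c s else 0))
    + (if p' < p then l * ((if p = s then e p p' else 0) + (if s' < p' then l * c p' * c s else 0)) else 0)
    - c p' * (l * ((if s' < p then c s' * e s s' else 0) - (if s < p then if s' < s then c s * l else 0 else 0))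
       + l * c s * (if s' < p then F p p' - F s' s - l * c s' ^ 2 else 0)) = if p = s' then 1 else 0 := by
  intro l d e F
  have es := hc s s' hs
  have ep := hc p p' hp
  have na : c s ≠ 0 := left_ne_zero_of_mul_eq_one es
  have np : c p ≠ 0 := left_ne_zero_of_mul_eq_one ep
  have es' : c s' = (c s)⁻¹ := eq_inv_of_mul_eq_one_right es
  have ep' : c p' = (c p)⁻¹ := eq_inv_of_mul_eq_one_right ep
  have r1 : p = p' → c p = 1 := fun h => hcm p (by omega)
  have r3 : s = s' → c s = 1 := fun h => hcm s (by omega)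
  have r4 : p = s → c p = c s := fun h => by rw [h]
  have r6 : p = s' → c p = (c s)⁻¹ := fun h => by rw [h, es']
  clear hc hcm es ep
  simp only [d, e, F, l]
  rcases lt_trichotomy p s with h3 | h3 | h3 <;>
  rcases lt_trichotomy p p' with h1 | h1 | h1 <;> (try (exfalso; omega)) <;>
  rcases lt_trichotomy p s' with h7 | h7 | h7 <;> (try (exfalso; omega)) <;>
  rcases lt_trichotomy s s' with h6 | h6 | h6 <;> (try (exfalso; omega))
  all_goals
    simp (disch := omega) only [if_pos, if_neg, es', ep', r1, r3, r4, r6,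
      if_true, add_zero, zero_add, sub_zero, zero_sub, mul_zero, zero_mul, neg_zero, mul_one, one_mul, sub_self]
  all_goals (first | done | field)



noncomputable def RhatInv (m : ℕ) (qq : Set.Ioo (0 : ℝ) 1) :
    Matrix (Fin m × Fin m) (Fin m × Fin m) ℂ :=
  Matrix.of fun p r =>
    (if p.1 = r.2 ∧ p.2 = r.1 then dw ((qq : ℝ) : ℂ) p.1 p.2 else 0)
      - (if p.1 = r.1 ∧ p.2 = r.2 ∧ p.2 < p.1 then ((qq : ℝ) : ℂ) - ((qq : ℝ) : ℂ)⁻¹ else 0)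
      + (if r.1.rev < p.1 then
          (((qq : ℝ) : ℂ) - ((qq : ℝ) : ℂ)⁻¹) * metric m qq p.1 p.2 * metric m qq r.1 r.2 else 0)

theorem RhatInv_diag (k s : Fin m) : RhatInv m qq (k, k.rev) (s, s.rev) =
    (if k = s.rev then (if k = k.rev then 1 else ((qq : ℝ) : ℂ)) else 0)
     - (if k.rev < k then (if k = s then ((qq : ℝ) : ℂ) - ((qq : ℝ) : ℂ)⁻¹ else 0) else 0)
     + (if s.rev < k then (((qq : ℝ) : ℂ) - ((qq : ℝ) : ℂ)⁻¹) * metricCoeff qq k * metricCoeff qq s else 0) := by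
  simp only [RhatInv, Matrix.of_apply, metric, if_true]
  congr 1
  congr 1
  · simp only [dw, Fin.rev_rev]; grind
  · grind

theorem Rhat_mul_inv : Rhat m qq * RhatInv m qq = 1 := by
  have hq := Q_ne qq
  ext ⟨i, j⟩ ⟨s, t⟩
  rw [Matrix.mul_apply, Fintype.sum_prod_type]
  have h0 := sumRhat (A := ℂ) qq (fun k l => RhatInv m qq (k, l) (s, t)) i j
  simp only [smul_eq_mul] at h0
  rw [h0]
  by_cases hj : j = i.rev
  swap
  · have n1 : ¬ i = j.rev := by grind
    have n2 : ¬ i.rev = j := by grind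
    rw [if_neg hj]
    simp only [RhatInv, Matrix.of_apply, metric, if_neg hj, if_neg n1, mul_zero, zero_mul, ite_self, n1,
      false_and, if_false, Matrix.one_apply, Prod.mk.injEq, dw]
    clear h0
    have q1 : ((qq : ℝ) : ℂ) * ((qq : ℝ) : ℂ)⁻¹ = 1 := mul_inv_cancel₀ hq
    grind
  · subst hj
    by_cases ht : t = s.rev
    swap
    · have e0 : ∀ k : Fin m, RhatInv m qq (k, k.rev) (s, t) = 0 := by
        intro k
        have n1 : ¬ (k = t ∧ k.rev = s) := by grind
        have n2 : ¬ (k = s ∧ k.rev = t ∧ k.rev < k) := by grind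
        simp [RhatInv, metric, ht, n1, n2]
      have e1 : RhatInv m qq (i.rev, i) (s, t) = 0 := by
        have := e0 i.rev
        rwa [Fin.rev_rev] at this
      have n3 : ¬ (i = s ∧ i.rev = t) := by grind
      simp [e0, e1, n3]
    · subst ht
      have e1 : ∑ k : Fin m, (if k < i.rev then metricCoeff qq k * RhatInv m qq (k, k.rev) (s, s.rev) else 0) =
          ((if s.rev < i.rev then metricCoeff qq s.rev * (if s = s.rev then 1 else ((qq : ℝ) : ℂ)) else 0)
           - (if s < i.rev then (if s.rev < s then metricCoeff qq s * (((qq : ℝ) : ℂ) - ((qq : ℝ) : ℂ)⁻¹) else 0) else 0))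
           + metricCoeff qq s * ((((qq : ℝ) : ℂ) - ((qq : ℝ) : ℂ)⁻¹) *
              ∑ k : Fin m, if s.rev < k ∧ k < i.rev then metricCoeff qq k ^ 2 else 0) := by
        have e : ∀ k : Fin m, (if k < i.rev then metricCoeff qq k * RhatInv m qq (k, k.rev) (s, s.rev) else 0) =
           (if k = s.rev then (if s.rev < i.rev then metricCoeff qq s.rev * (if s = s.rev then 1 else ((qq : ℝ) : ℂ)) else 0) else 0)
           - (if k = s then (if s < i.rev then (if s.rev < s then metricCoeff qq s * (((qq : ℝ) : ℂ) - ((qq : ℝ) : ℂ)⁻¹) else 0) else 0) else 0)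
           + metricCoeff qq s * ((((qq : ℝ) : ℂ) - ((qq : ℝ) : ℂ)⁻¹) * if s.rev < k ∧ k < i.rev then metricCoeff qq k ^ 2 else 0) := by
          intro k
          rw [RhatInv_diag]
          by_cases hk : k < i.rev
          · rw [if_pos hk, mul_add, mul_sub]
            congr 1
            · congr 1
              · by_cases h : k = s.rev
                · subst h
                  have : (s.rev = s) = (s = s.rev) := by simp only [eq_comm]
                  simp only [if_true, Fin.rev_rev, this, if_pos hk]
                · simp [h]
              · by_cases h : k = s
                · subst h; simp [hk]
                · simp [h]
            · simp only [hk, and_true]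
              split_ifs <;> ring
          · have n1 : ¬ (k = s.rev ∧ s.rev < i.rev) := by grind
            have n2 : ¬ (k = s ∧ s < i.rev) := by grind
            simp only [hk, if_false, and_false, ← ite_and, n1, mul_zero, add_zero]
            grind
        simp only [e, Finset.sum_add_distrib, Finset.sum_sub_distrib, Finset.mul_sum]
        simp
      have e2 : (((qq : ℝ) : ℂ) - ((qq : ℝ) : ℂ)⁻¹) * (∑ k : Fin m, if s.rev < k ∧ k < i.rev then metricCoeff qq k ^ 2 else 0) =
          if s.rev < i.rev then FF ((qq : ℝ) : ℂ) (metricCoeff qq) i.rev - FF ((qq : ℝ) : ℂ) (metricCoeff qq) s.rev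
            - (((qq : ℝ) : ℂ) - ((qq : ℝ) : ℂ)⁻¹) * metricCoeff qq s.rev ^ 2 else 0 := by
        split_ifs with h
        · exact midSum _ (Phi_cc qq) _ _ h
        · rw [Finset.sum_eq_zero, mul_zero]
          intro k _; rw [if_neg]; grind
      have e3 := RhatInv_diag qq i.rev s
      rw [Fin.rev_rev] at e3
      rw [if_pos rfl, e1, e2, e3, RhatInv_diag]
      let cN : ℕ → ℂ := fun i => if h : i < m then metricCoeff qq ⟨i, h⟩ else 1
      have hcN : ∀ i : Fin m, metricCoeff qq i = cN i := by intro i; simp [cN]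
      have hv : ∀ i : Fin m, (i : ℕ) + (i.rev : ℕ) = m - 1 := by intro i; rw [Fin.val_rev]; omega
      have f1 : ∀ i j, i + j = m - 1 → cN i * cN j = 1 := by
        intro i j hij
        have := s.isLt
        have hi : i < m := by omega
        have : j = (Fin.rev ⟨i, hi⟩ : Fin m) := by rw [Fin.val_rev]; show j = m - (i + 1); omega
        rw [this, ← hcN, ← cc_mul qq ⟨i, hi⟩]; simp [cN, hi]
      have f2 : ∀ i, i + i = m - 1 → cN i = 1 := by
        intro i hij
        have := s.isLt
        have hi : i < m := by omega
        have := cc_mid qq ⟨i, hi⟩ (by rw [Fin.ext_iff, Fin.val_rev]; simp only; omega)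
        rw [← this]; simp [cN, hi]
      have key := scalInvNat (m - 1) ((qq : ℝ) : ℂ) hq cN f1 f2 s i.rev s.rev i (hv s)
        (by have := hv i; omega)
      simp only at key
      have hone : (1 : Matrix (Fin m × Fin m) (Fin m × Fin m) ℂ) (i, i.rev) (s, s.rev) =
          if (i.rev : ℕ) = s.rev then 1 else 0 := by
        have h1 : ((i, i.rev) = (s, s.rev)) = ((i.rev : ℕ) = s.rev) := by
          rw [← Fin.ext_iff, Prod.mk.injEq]; grind
        rw [Matrix.one_apply]; simp only [h1]
      rw [hone]
      refine Eq.trans ?_ key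
      have m1 : (if i = i.rev ∧ i ≠ i.rev.rev then ((qq : ℝ) : ℂ) else if i = i.rev.rev ∧ i ≠ i.rev
          then ((qq : ℝ) : ℂ)⁻¹ else 1) = if (i.rev : ℕ) = i then 1 else ((qq : ℝ) : ℂ)⁻¹ := by
        simp only [← Fin.ext_iff]; clear h0 e1 e2 e3 key hone hcN f1 f2 hv
        grind
      rw [m1]
      have m3 : ∀ a b : Fin m, a.rev < b.rev ↔ (b : ℕ) < a := by
        intro a b; rw [← Fin.lt_def]; grind
      have m4 : (i = i.rev) = (((i.rev : Fin m) : ℕ) = i) := by rw [← Fin.ext_iff]; simp only [eq_comm]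
      have m5 : (i = s.rev) = ((i.rev : ℕ) = s) := by rw [← Fin.ext_iff]; grind
      have m6 : (s.rev = s) = ((s : ℕ) = s.rev) := by rw [← Fin.ext_iff]; grind
      have m7 : (i = s) = ((i.rev : ℕ) = s.rev) := by rw [← Fin.ext_iff]; grind
      simp only [FF, hcN, Fin.rev_rev]
      simp only [Fin.lt_def, Fin.ext_iff]
      have m8 : ((i : ℕ) = s) = ((i.rev : ℕ) = s.rev) := by rw [← Fin.ext_iff, m7]
      have m9 : ((i : ℕ) = s.rev) = ((i.rev : ℕ) = s) := by rw [← Fin.ext_iff, m5]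
      have m10 : ((i : ℕ) = i.rev) = (((i.rev : Fin m) : ℕ) = i) := by rw [← Fin.ext_iff, m4]
      have m11 : (((s.rev : Fin m) : ℕ) = s) = ((s : ℕ) = s.rev) := by rw [← Fin.ext_iff, m6]
      simp only [m8, m9, m10, m11]
      clear key
      by_cases hlt : (i : ℕ) < i.rev
      · have hlt' : ¬ (i.rev : ℕ) < i := hlt.not_gt
        simp only [if_pos hlt, if_neg hlt']; ring
      · simp only [if_neg hlt]; ring

theorem Rhat_inv : (Rhat m qq)⁻¹ = RhatInv m qq := Matrix.inv_eq_right_inv (Rhat_mul_inv qq)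

theorem NN_eq (x : Fin m → A) (k a e : Fin m) :
    ∑ b, ((Rhat m qq)⁻¹ (a, k) (b, e)) • x b = NN ((qq : ℝ) : ℂ) (metricCoeff qq) x k a e := by
  simp only [Rhat_inv, RhatInv, Matrix.of_apply, add_smul, sub_smul, Finset.sum_add_distrib,
    Finset.sum_sub_distrib, NN]
  congr 1
  · congr 1
    · rw [Finset.sum_eq_single k]
      · simp
      · intro b _ hb; simp [hb.symm]
      · simp
    · rw [Finset.sum_eq_single a]
      · simp only [true_and, ← sub_smul, ite_smul, zero_smul]; grind
      · intro b _ hb; simp [hb.symm]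
      · simp
  · rw [Finset.sum_eq_single e.rev]
    · have : (k = a.rev) = (a = k.rev) := by grind
      simp only [metric, Matrix.of_apply, Fin.rev_rev, if_true, this]
      by_cases h1 : a = k.rev <;> by_cases h2 : e < a <;> simp [h1, h2]
    · intro b _ hb
      have : ¬ e = b.rev := by grind
      simp [metric, this]
    · simp


end

section
variable {m : ℕ} (q : Set.Ioo (0 : ℝ) 1)

theorem gen_rel (i j : Fin m) :
    ∑ k, ∑ l, projAnti m q (i, j) (k, l) • (gen q k * gen q l) = 0 := by
  have h := RingQuot.mkAlgHom_rel ℂ (PolyRel.mk (m := m) (q := q) i j)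
  rw [map_zero] at h
  rw [← h]
  simp only [map_sum, map_smul, map_mul, gen]

/-- The block matrix of left multiplication by `x^j` on the column `(f, ∂^0 f, ..., ∂^{m-1} f)`, as
dictated by `∂^i x^j = C^{ij} + q (R̂⁻¹)^{ij}_{kl} x^k ∂^l`. -/
noncomputable def partialMatrix (j : Fin m) :
    Matrix (Option (Fin m)) (Option (Fin m)) (Poly m q)
  | none, none => gen q j
  | none, some _ => 0
  | some i, none => algebraMap ℂ (Poly m q) (metric m q i j)
  | some i, some l =>
      (((q : ℝ) : ℂ)) • ∑ k, (Rhat m q)⁻¹ (i, j) (k, l) • gen q k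

theorem partialMatrix_eq (j : Fin m) :
    partialMatrix q j = MM ((q : ℝ) : ℂ) (metricCoeff q) (gen q) j := by
  ext r s
  rcases r with _ | a <;> rcases s with _ | b
  · rfl
  · rfl
  · have h : (j = a.rev) = (a = j.rev) := by grind
    simp only [partialMatrix, MM, metric, Matrix.of_apply, h]
    split_ifs <;> simp
  · exact congrArg (fun y => ((q : ℝ) : ℂ) • y) (NN_eq q (gen q) j a b)

theorem partialMatrix_rel (i j : Fin m) :
    ∑ k, ∑ l, projAnti m q (i, j) (k, l) • (partialMatrix q k * partialMatrix q l) = 0 := by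
  have hm : 1 ≤ m := by have := i.isLt; omega
  refine rel_of_QRel q (partialMatrix q) ?_ i j
  have e : (partialMatrix q : Fin m → _) = MM ((q : ℝ) : ℂ) (metricCoeff q) (gen q) :=
    funext (partialMatrix_eq q)
  rw [e]
  exact QRel_MM (Q_ne q) (cc_mul q) (cc_mid q) _ (Phi_cc q) (gam_eq q hm)
    (QRel_of_rel q (gen q) (gen_rel q))

/-- The representation of `𝒫` extending `partialMatrix`. Applied to the column `(1, 0, ..., 0)` it
yields `(f, ∂^0 f, ..., ∂^{m-1} f)`. -/
noncomputable def partialHom (m : ℕ) (q : Set.Ioo (0 : ℝ) 1) :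
    Poly m q →ₐ[ℂ] Matrix (Option (Fin m)) (Option (Fin m)) (Poly m q) :=
  RingQuot.liftAlgHom ℂ ⟨FreeAlgebra.lift ℂ (partialMatrix q), by
    rintro _ _ ⟨i, j⟩
    simp only [map_sum, map_smul, map_mul, map_zero, FreeAlgebra.lift_ι_apply]
    exact partialMatrix_rel q i j⟩

/-- The partial derivative `∂^i` on `𝒫`. It is the unique linear operator family satisfying
`partialD_one` and `partialD_gen_mul` below. -/
noncomputable def partialD (i : Fin m) : Poly m q →ₗ[ℂ] Poly m q where
  toFun f := partialHom m q f (some i) none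
  map_add' f g := by rw [map_add, Matrix.add_apply]
  map_smul' c f := by rw [map_smul, Matrix.smul_apply, RingHom.id_apply]

theorem partialHom_gen (j : Fin m) : partialHom m q (gen q j) = partialMatrix q j := by
  simp [partialHom, gen]

theorem poly_induction {P : Poly m q → Prop} (h0 : P 1)
    (h1 : ∀ j f, P f → P (gen q j * f)) (h2 : ∀ f g, P f → P g → P (f + g))
    (h3 : ∀ (c : ℂ) f, P f → P (c • f)) (f : Poly m q) : P f := by
  obtain ⟨a, rfl⟩ := RingQuot.mkAlgHom_surjective ℂ (PolyRel m q) f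
  have key : ∀ a : FreeAlgebra ℂ (Fin m), ∀ g : Poly m q, P g →
      P (RingQuot.mkAlgHom ℂ (PolyRel m q) a * g) := by
    intro a
    induction a using FreeAlgebra.induction with
    | grade0 r =>
      intro g hg
      rw [AlgHom.commutes, ← Algebra.smul_def]
      exact h3 r g hg
    | grade1 x => intro g hg; exact h1 x g hg
    | mul a b ha hb => intro g hg; rw [map_mul, mul_assoc]; exact ha _ (hb _ hg)
    | add a b ha hb => intro g hg; rw [map_add, add_mul]; exact h2 _ _ (ha _ hg) (hb _ hg)
  have := key a 1 h0
  rwa [mul_one] at this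

theorem partialHom_none (f : Poly m q) :
    partialHom m q f none none = f ∧ ∀ b, partialHom m q f none (some b) = 0 := by
  induction f using poly_induction with
  | h0 => rw [map_one]; exact ⟨rfl, fun b => rfl⟩
  | h1 j f hf =>
    rw [map_mul, partialHom_gen]
    simp only [Matrix.mul_apply, Fintype.sum_option, partialMatrix, zero_mul, Finset.sum_const_zero, add_zero]
    exact ⟨by rw [hf.1], fun b => by rw [hf.2, mul_zero]⟩
  | h2 f g hf hg =>
    rw [map_add]; simp only [Matrix.add_apply]
    exact ⟨by rw [hf.1, hg.1], fun b => by rw [hf.2, hg.2, add_zero]⟩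
  | h3 c f hf =>
    rw [map_smul]; simp only [Matrix.smul_apply]
    exact ⟨by rw [hf.1], fun b => by rw [hf.2, smul_zero]⟩

theorem partialD_one (i : Fin m) : partialD q i 1 = 0 := by
  simp [partialD]

/-- The commutation relation `∂^i x^j = C^{ij} + q (R̂⁻¹)^{ij}_{kl} x^k ∂^l`. -/
theorem partialD_gen_mul (i j : Fin m) (f : Poly m q) :
    partialD q i (gen q j * f) = metric m q i j • f
      + (((q : ℝ) : ℂ)) • ∑ k, ∑ l, (Rhat m q)⁻¹ (i, j) (k, l) • (gen q k * partialD q l f) := by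
  have h : partialD q i (gen q j * f) = partialHom m q (gen q j * f) (some i) none := rfl
  rw [h, map_mul, partialHom_gen, Matrix.mul_apply, Fintype.sum_option]
  simp only [partialMatrix, (partialHom_none q f).1]
  congr 1
  rw [Finset.sum_comm, Finset.smul_sum]
  refine Finset.sum_congr rfl fun l _ => ?_
  rw [smul_mul_assoc, Finset.sum_mul]
  congr 1
  refine Finset.sum_congr rfl fun k _ => ?_
  rw [smul_mul_assoc]
  rfl

/-- The constant term `f ↦ f(0)`: the algebra homomorphism with `x^i ↦ 0`. -/
noncomputable def constTerm (m : ℕ) (q : Set.Ioo (0 : ℝ) 1) : Poly m q →ₐ[ℂ] ℂ :=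
  RingQuot.liftAlgHom ℂ ⟨FreeAlgebra.lift ℂ (fun _ : Fin m => (0 : ℂ)), by
    rintro _ _ ⟨i, j⟩
    simp⟩

theorem constTerm_gen (i : Fin m) : constTerm m q (gen q i) = 0 := by
  simp [constTerm, gen]

/-- The squared norm `x² = x^i C_{ij} x^j`. -/
noncomputable def normSq (m : ℕ) (q : Set.Ioo (0 : ℝ) 1) : Poly m q :=
  ∑ i, ∑ j, metric m q i j • (gen q i * gen q j)

/-- The Laplacian `Δ = ∂^i C_{ij} ∂^j`. -/
noncomputable def laplacian (m : ℕ) (q : Set.Ioo (0 : ℝ) 1) : Module.End ℂ (Poly m q) :=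
  ∑ i, ∑ j, metric m q i j • (partialD q i ∘ₗ partialD q j)

/-- The number `μ = 1 + q^{2-m}`. -/
noncomputable def mu (m : ℕ) (q : Set.Ioo (0 : ℝ) 1) : ℝ := 1 + (q : ℝ) ^ (2 - (m : ℤ))

/-- The scaling operator
`Λ = 1 + (q²-1) x^i C_{ij} ∂^j + (q²-1)² / (q^{m-2} μ²) x² Δ`. -/
noncomputable def euler (m : ℕ) (q : Set.Ioo (0 : ℝ) 1) : Module.End ℂ (Poly m q) :=
  LinearMap.id
    + (((q : ℝ) : ℂ) ^ 2 - 1) •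
        ∑ i, ∑ j, metric m q i j • (LinearMap.mulLeft ℂ (gen q i) ∘ₗ partialD q j)
    + ((((q : ℝ) : ℂ) ^ 2 - 1) ^ 2 / (((q : ℝ) : ℂ) ^ ((m : ℤ) - 2) * ((mu m q : ℝ) : ℂ) ^ 2)) •
        (LinearMap.mulLeft ℂ (normSq m q) ∘ₗ laplacian m q)

/-- The space `𝒫_k` of homogeneous polynomials of degree `k`: the `P` with `Λ P = q^{2k} P`. -/
noncomputable def homogeneous (m : ℕ) (q : Set.Ioo (0 : ℝ) 1) (k : ℕ) : Submodule ℂ (Poly m q) :=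
  Module.End.eigenspace (euler m q) (((q : ℝ) : ℂ) ^ (2 * k))

/-- The space `𝒮_k` of spherical harmonics of degree `k`: the `P ∈ 𝒫_k` with `Δ P = 0`. -/
noncomputable def harmonic (m : ℕ) (q : Set.Ioo (0 : ℝ) 1) (k : ℕ) : Submodule ℂ (Poly m q) :=
  homogeneous m q k ⊓ LinearMap.ker (laplacian m q)

/-- The `q`-number `[u]_p = (p^u - 1)/(p - 1)`. -/
noncomputable def qNumber (p u : ℝ) : ℝ := (p ^ u - 1) / (p - 1)

/-- The `q`-factorial `[n]_p! = [1]_p [2]_p ⋯ [n]_p`. -/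
noncomputable def qFactorial (p : ℝ) (n : ℕ) : ℝ := ∏ i ∈ Finset.range n, qNumber p ((i : ℝ) + 1)

/-- The `q`-Gamma function `Γ_p(t) = (p;p)_∞ / (p^t;p)_∞ (1-p)^{1-t}` (for `0 < p < 1`, `t > 0`). -/
noncomputable def qGamma (p t : ℝ) : ℝ :=
  (∏' n : ℕ, (1 - p ^ (n + 1))) / (∏' n : ℕ, (1 - p ^ (t + n))) * (1 - p) ^ (1 - t)

/-- The span of the words of length at most `n` in the generators. -/
noncomputable def lowDegree (m : ℕ) (q : Set.Ioo (0 : ℝ) 1) : ℕ → Submodule ℂ (Poly m q)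
  | 0 => Submodule.span ℂ {1}
  | n + 1 => Submodule.span ℂ {1} ⊔ ⨆ j, (lowDegree m q n).map (LinearMap.mulLeft ℂ (gen q j))

theorem lowDegree_mul (n : ℕ) (j : Fin m) (f : Poly m q) (hf : f ∈ lowDegree m q n) :
    gen q j * f ∈ lowDegree m q (n + 1) := by
  rw [lowDegree]
  exact Submodule.mem_sup_right (Submodule.mem_iSup_of_mem j (Submodule.mem_map_of_mem hf))

theorem lowDegree_induction {P : ℕ → Poly m q → Prop} (h0 : ∀ n, P n 1)
    (h1 : ∀ n j f, f ∈ lowDegree m q n → P n f → P (n + 1) (gen q j * f))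
    (h2 : ∀ n f g, P n f → P n g → P n (f + g))
    (h3 : ∀ n (c : ℂ) f, P n f → P n (c • f)) (n : ℕ) :
    ∀ f ∈ lowDegree m q n, P n f := by
  induction n with
  | zero =>
    intro f hf
    rw [lowDegree, Submodule.mem_span_singleton] at hf
    obtain ⟨c, rfl⟩ := hf
    exact h3 _ _ _ (h0 _)
  | succ n ih =>
    intro f hf
    rw [lowDegree, Submodule.mem_sup] at hf
    obtain ⟨a, ha, b, hb, rfl⟩ := hf
    rw [Submodule.mem_span_singleton] at ha
    obtain ⟨c, rfl⟩ := ha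
    refine h2 _ _ _ (h3 _ _ _ (h0 _)) ?_
    induction hb using Submodule.iSup_induction' with
    | mem j x hx =>
      obtain ⟨y, hy, rfl⟩ := hx
      exact h1 n j y hy (ih y hy)
    | zero => simpa using h3 (n + 1) 0 1 (h0 _)
    | add x y _ _ hx hy => exact h2 _ _ _ hx hy

theorem lowDegree_succ (n : ℕ) : ∀ f ∈ lowDegree m q n, f ∈ lowDegree m q (n + 1) := by
  refine lowDegree_induction q (P := fun n f => f ∈ lowDegree m q (n + 1)) ?_ ?_ ?_ ?_ n
  · intro n; rw [lowDegree]; exact Submodule.mem_sup_left (Submodule.mem_span_singleton_self 1)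
  · intro n j f _ hf; exact lowDegree_mul q _ j f hf
  · intro n f g hf hg; exact add_mem hf hg
  · intro n c f hf; exact Submodule.smul_mem _ c hf

theorem exists_lowDegree (f : Poly m q) : ∃ n, f ∈ lowDegree m q n := by
  have mono : ∀ k n, ∀ f ∈ lowDegree m q n, f ∈ lowDegree m q (n + k) := by
    intro k
    induction k with
    | zero => intro n f hf; exact hf
    | succ k ih => intro n f hf; exact lowDegree_succ q _ _ (ih n f hf)
  induction f using poly_induction with
  | h0 => exact ⟨0, Submodule.mem_span_singleton_self 1⟩
  | h1 j f hf => obtain ⟨n, hn⟩ := hf; exact ⟨n + 1, lowDegree_mul q n j f hn⟩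
  | h2 f g hf hg =>
    obtain ⟨a, ha⟩ := hf
    obtain ⟨b, hb⟩ := hg
    refine ⟨a + b, add_mem (mono b a f ha) ?_⟩
    rw [add_comm a b]
    exact mono a b g hb
  | h3 c f hf => obtain ⟨n, hn⟩ := hf; exact ⟨n, Submodule.smul_mem _ c hn⟩

theorem partialD_lowDegree (n : ℕ) : ∀ f ∈ lowDegree m q n,
    ∀ i, (n = 0 → partialD q i f = 0) ∧ (∀ k, n = k + 1 → partialD q i f ∈ lowDegree m q k) := by
  refine lowDegree_induction q (P := fun n f =>
    ∀ i, (n = 0 → partialD q i f = 0) ∧ (∀ k, n = k + 1 → partialD q i f ∈ lowDegree m q k))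
    ?_ ?_ ?_ ?_ n
  · intro n i; rw [partialD_one]; exact ⟨fun _ => rfl, fun k _ => zero_mem _⟩
  · intro n j f hfn hf i
    refine ⟨fun h => by omega, fun k hk => ?_⟩
    obtain rfl : n = k := by omega
    rw [partialD_gen_mul]
    refine add_mem (Submodule.smul_mem _ _ hfn) (Submodule.smul_mem _ _ ?_)
    refine sum_mem fun a _ => sum_mem fun b _ => Submodule.smul_mem _ _ ?_
    rcases n with _ | n
    · rw [(hf b).1 rfl, mul_zero]; exact zero_mem _
    · exact lowDegree_mul q n a _ ((hf b).2 n rfl)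
  · intro n f g hf hg i
    rw [map_add]
    exact ⟨fun h => by rw [(hf i).1 h, (hg i).1 h, add_zero],
      fun k hk => add_mem ((hf i).2 k hk) ((hg i).2 k hk)⟩
  · intro n c f hf i
    rw [map_smul]
    exact ⟨fun h => by rw [(hf i).1 h, smul_zero], fun k hk => Submodule.smul_mem _ c ((hf i).2 k hk)⟩

theorem laplacian_lowDegree (n : ℕ) (f : Poly m q) (hf : f ∈ lowDegree m q n) :
    (n = 0 → laplacian m q f = 0) ∧ (∀ k, n = k + 1 → laplacian m q f ∈ lowDegree m q k) := by
  have e : laplacian m q f = ∑ i, ∑ j, metric m q i j • partialD q i (partialD q j f) := by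
    simp [laplacian, LinearMap.sum_apply]
  rw [e]
  constructor
  · intro hn
    refine Finset.sum_eq_zero fun i _ => Finset.sum_eq_zero fun j _ => ?_
    rw [(partialD_lowDegree q n f hf j).1 hn, map_zero, smul_zero]
  · intro k hk
    refine sum_mem fun i _ => sum_mem fun j _ => Submodule.smul_mem _ _ ?_
    have h := (partialD_lowDegree q n f hf j).2 k hk
    rcases k with _ | k
    · rw [(partialD_lowDegree q 0 _ h i).1 rfl]; exact zero_mem _
    · exact lowDegree_succ q _ _ ((partialD_lowDegree q (k + 1) _ h i).2 k rfl)

/-- The Laplacian is locally nilpotent. -/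
theorem laplacian_pow_lowDegree (n : ℕ) : ∀ f ∈ lowDegree m q n, ∀ k, n < k → (laplacian m q ^ k) f = 0 := by
  induction n with
  | zero =>
    intro f hf k hk
    obtain ⟨k, rfl⟩ : ∃ j, k = j + 1 := ⟨k - 1, by omega⟩
    rw [pow_succ, Module.End.mul_apply, (laplacian_lowDegree q 0 f hf).1 rfl, map_zero]
  | succ n ih =>
    intro f hf k hk
    obtain ⟨k, rfl⟩ : ∃ j, k = j + 1 := ⟨k - 1, by omega⟩
    rw [pow_succ, Module.End.mul_apply]
    exact ih _ ((laplacian_lowDegree q (n + 1) f hf).2 n rfl) k (by omega)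

/-- The coefficients `2 Γ_{q²}(1/2)^m / (μ^{2k} [k]_{q²}! Γ_{q²}(k + m/2))` of the sphere integral. -/
noncomputable def pizzettiCoeff (m : ℕ) (q : Set.Ioo (0 : ℝ) 1) (k : ℕ) : ℝ :=
  2 * qGamma ((q : ℝ) ^ 2) (1 / 2) ^ m /
    (mu m q ^ (2 * k) * qFactorial ((q : ℝ) ^ 2) k * qGamma ((q : ℝ) ^ 2) ((k : ℝ) + m / 2))

theorem pizzetti_finite (f : Poly m q) : (Function.support fun k : ℕ =>
    ((pizzettiCoeff m q k : ℝ) : ℂ) * constTerm m q ((laplacian m q ^ k) f)).Finite := by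
  obtain ⟨n, hn⟩ := exists_lowDegree q f
  refine (Set.finite_Iic n).subset fun k hk => ?_
  by_contra h
  rw [Set.mem_Iic, not_le] at h
  apply hk
  show _ * _ = _
  rw [laplacian_pow_lowDegree q n f hn k h, map_zero, mul_zero]

/-- The integral over the quantum sphere,
`∫ f = ∑_k 2 Γ_{q²}(1/2)^m / (μ^{2k} [k]_{q²}! Γ_{q²}(k + m/2)) (Δ^k f)(0)`, a finite sum for each `f`. -/
noncomputable def sphereIntegral (m : ℕ) (q : Set.Ioo (0 : ℝ) 1) : Poly m q →ₗ[ℂ] ℂ where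
  toFun f := ∑ᶠ k : ℕ, ((pizzettiCoeff m q k : ℝ) : ℂ) * constTerm m q ((laplacian m q ^ k) f)
  map_add' f g := by
    rw [← finsum_add_distrib (pizzetti_finite q f) (pizzetti_finite q g)]
    refine finsum_congr fun k => ?_
    rw [map_add, map_add, mul_add]
  map_smul' c f := by
    rw [RingHom.id_apply, smul_finsum]
    refine finsum_congr fun k => ?_
    rw [map_smul, map_smul, smul_eq_mul, smul_eq_mul]; ring

/-- The sphere integral over `x` of a polynomial in `x` and `y`. Such polynomials are written with
the `x` to the left of the `y`, so they form `𝒫 ⊗ 𝒫`; the result is a polynomial in `y`. -/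
noncomputable def sphereIntegralLeft (m : ℕ) (q : Set.Ioo (0 : ℝ) 1) :
    Poly m q ⊗[ℂ] Poly m q →ₗ[ℂ] Poly m q :=
  (TensorProduct.lid ℂ (Poly m q)).toLinearMap ∘ₗ (sphereIntegral m q).rTensor (Poly m q)

/-- The family `E l = (x;y)^{(l)}` of polynomials in `x` and `y`, written with the `x` to the left
of the `y`: `(x;y)^{(0)} = 1`, `(x;y)^{(l)}` is homogeneous of degree `l` in `x` and in `y`, and
`∂_x^j (x;y)^{(l+1)} = [l+1]_{q^{-2}} (x;y)^{(l)} y^j`. -/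
structure IsInnerPowers (E : ℕ → Poly m q ⊗[ℂ] Poly m q) : Prop where
  zero : E 0 = 1 ⊗ₜ[ℂ] 1
  degree : ∀ l, E l ∈ LinearMap.range
    (TensorProduct.map (homogeneous m q l).subtype (homogeneous m q l).subtype)
  partialD_succ : ∀ l (j : Fin m), (partialD q j).rTensor (Poly m q) (E (l + 1)) =
    ((qNumber (((q : ℝ) ^ 2)⁻¹) ((l : ℝ) + 1) : ℝ) : ℂ) •
      (LinearMap.mulRight ℂ (gen q j)).lTensor (Poly m q) (E l)

/-- The generalized powers `⟨x|y⟩^{(l)} = [l]_q! / [l]_{q^{-2}}! (x;y)^{(l)}`, where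
`E l = (x;y)^{(l)}`. -/
noncomputable def innerPow (E : ℕ → Poly m q ⊗[ℂ] Poly m q) (l : ℕ) : Poly m q ⊗[ℂ] Poly m q :=
  ((qFactorial (q : ℝ) l / qFactorial (((q : ℝ) ^ 2)⁻¹) l : ℝ) : ℂ) • E l

/-- The coefficient `α_{k,l}`. In the first case `l - k` is a nonnegative even number, so the
subtraction and the division of natural numbers are exact. -/
noncomputable def funkHeckeCoeff (m : ℕ) (q : Set.Ioo (0 : ℝ) 1) (k l : ℕ) : ℝ :=
  if Even (k + l) ∧ k ≤ l then
    2 * qGamma ((q : ℝ) ^ 2) (1 / 2) ^ m * qFactorial (q : ℝ) l /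
      (mu m q ^ l * qFactorial ((q : ℝ) ^ 2) ((l - k) / 2) *
        qGamma ((q : ℝ) ^ 2) (((k : ℝ) + l + m) / 2))
  else 0

end

end QEuclid

open QEuclid

/-! The derivatives ∂^i satisfy the same quadratic relations as the coordinates
(`projAnti_partialD`). Hence every polynomial a defines an operator a(∂), with Δ = x²(∂), and there
is a bilinear form ⟨a, b⟩ = (a(∂)b)(0). Both halves of the theorem are statements about this form.

The kernel. Since Λ x^i = q² x^i Λ, the eigenspace 𝒫_l is the finite-dimensional span of the words
of length l (`homogeneous_eq_words`). A polynomial of positive degree l killed by all derivatives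
would be fixed by Λ and also multiplied by q^{2l}, so it is zero; therefore the form is
nondegenerate on 𝒫_l. Contracting the x-factor of (x;y)^{(l)} with a x^j amounts to contracting its
∂^j-derivative with a. The recursion thus says that contraction with a ∈ 𝒫_l returns [l]_{q^{-2}}!
a(y) (`IsInnerPowers.contract_eq`). So (x;y)^{(l)} is [l]_{q^{-2}}! times the canonical tensor of
the form: dual bases give existence, nondegeneracy gives uniqueness.

The integral. On words of odd length it vanishes; on words of length 2s it is a constant times
⟨x^{2s}, ·⟩. The anti-automorphism x^i ↦ x^{i'}, written f ↦ f~, commutes with Δ and transposes the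
form (`laplacian_flip`, `pairing_flip`), whence ⟨x^{2s}, S g⟩ = ⟨g~, S~(∂) x^{2s}⟩. For S harmonic
of degree k, a Hobson-type formula (`partialAlg_harmonic_normSq_pow`) gives S(∂) x^{2s} = 0 for s <
k and S(∂) x^{2(k+t)} = μ^k ([k+t]_{q²}!/[t]_{q²}!) x^{2t} S. Consequently ∫ S g is a constant times
⟨S x^{2t}, g⟩ for g ∈ 𝒫_{k+2t}, and inserting the kernel for g reproduces S(y) y^{2t}. It remains to
collect the constants (`pizzettiCoeff_mul_hobson`).

The noncommutative input consists of a few contraction identities for R̂⁻¹, the centrality of x²,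
and the rules for moving ∂^i and Δ past coordinates from the left and from the right. -/

namespace QEuclid

open Finset

/-! ### Contraction identities for the quadratic relations, and centrality of x². -/

section QuadraticRelations
variable {A : Type*} [Ring A] [Algebra ℂ A] {m : ℕ} {q g κ : ℂ} {c : Fin m → ℂ} {x : Fin m → A}

/-- The central quadratic element `∑ c_j x_j x_{j'}`. -/
noncomputable def sqSum (c : Fin m → ℂ) (x : Fin m → A) : A := ∑ j, c j • (x j * x j.rev)

/-- `NN` is R̂⁻¹ with one leg filled by x, and the invariant combination x² passes through an index
without braiding. Below the diagonal every term is a multiple of x_a x_{b'}, and the scalars add up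
to zero by `scalTot`. The identity supplies the q² x² ∂^a term of `partialD_normSq_mul` and, in the
opposite algebra, the q² x^k Δ term of `laplacian_gen_mul`. -/
theorem sum_NN_mul_NN (hq : q ≠ 0) (hc : ∀ i, c i * c i.rev = 1) (hcm : ∀ i, i = i.rev → c i = 1)
    (hΦ : Phi q c κ) (H : QRel q g c x) (a b : Fin m) :
    ∑ j, c j • ∑ e, NN q c x j a e * NN q c x j.rev e b = if a = b then sqSum c x else 0 := by
  rcases lt_trichotomy b a with hba | hab | hab
  · simp only [offDiag hq hc H _ a b hba, smul_smul, ← Finset.sum_smul]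
    have e3 : ∑ j, c j * nn q c a b j = 0 := by
      have := sumnn (q := q) hc a b hba (fun j => True)
      simp only [if_true, true_and] at this
      rw [midSum κ hΦ _ _ hba] at this
      rw [this]
      exact scalTot hq hc hcm a b hba
    rw [e3, zero_smul, if_neg hba.ne']
  · subst hab
    have e0 : ∀ k : Fin m, dw q b k * dw q b k.rev = 1 := by
      intro k; simp only [dw]; grind
    simp only [prodNd, e0, one_smul, if_true, sqSum]
  · simp only [prodN0 hc _ _ _ _ hab, hab.ne, if_false, smul_zero, Finset.sum_const_zero]

/-- The inhomogeneous part of moving a derivative past x². For κ = q^{1-m} the factor is μ; this is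
how μ enters the Leibniz rules. -/
theorem sum_vv (hc : ∀ i, c i * c i.rev = 1) (hΦ : Phi q c κ) (a : Fin m) :
    ∑ j, c j • vv q c x a j j.rev = (1 + q * κ) • x a := by
  simp only [vv_diag hc, smul_smul, ← Finset.sum_smul]
  have e3 := sumnC (q := q) hc a (fun j => True)
  simp only [if_true, true_and] at e3
  rw [hΦ a] at e3
  rw [e3]
  congr 1
  have e8 : (if a.rev < a then q * (q - q⁻¹) else 0) = q * (if a.rev < a then (q - q⁻¹) else 0) := by split_ifs <;> ring
  have e9 : FF q c a = (if a = a.rev then 1 else q⁻¹) * c a ^2 + (if a.rev < a then (q - q⁻¹) else 0) := rfl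
  rw [e8, e9]
  ring

theorem sum_rev_gt (c : Fin m → ℂ) (x : Fin m → A) (i : Fin m) :
    ∑ e, (if e < i then c e.rev • (x e.rev * x e) else 0)
      = sqSum c x - TT c x i.rev - c i.rev • (x i.rev * x i) := by
  rw [← Equiv.sum_comp Fin.revPerm, sub_sub, eq_sub_iff_add_eq]
  have : c i.rev • (x i.rev * x i) = ∑ j, if j = i.rev then c j • (x j * x j.rev) else 0 := by simp
  rw [this, TT, ← Finset.sum_add_distrib, ← Finset.sum_add_distrib, sqSum]
  refine Finset.sum_congr rfl fun e _ => ?_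
  simp only [Fin.revPerm_apply, Fin.rev_rev]
  grind

/-- For the actual constants the reason is spectral: P_A kills x ⊗ x, so q R̂⁻¹ acts on it as 1 +
(q^m − 1) P_1, and (q^m − 1)/C equals q(q − q⁻¹) + q g. In coordinates only i = k' needs more than
q-commutation; there `QRel.h2` evaluates the truncated sum. -/
theorem sum_NN_mul (hq : q ≠ 0) (hc : ∀ i, c i * c i.rev = 1) (H : QRel q g c x) (k i : Fin m) :
    q • ∑ l, NN q c x k i l * x l = x i * x k
      + if i = k.rev then ((q * (q - q⁻¹) + q * g) * c i) • sqSum c x else 0 := by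
  rw [sumA, sum_rev_gt]
  by_cases h : i = k.rev
  · subst h
    have I := H.h2 k.rev
    simp only [Fin.rev_rev, if_true] at I ⊢
    rw [← sqSum] at I
    have hd : dw q k.rev k = if k = k.rev then 1 else q := by simp only [dw]; grind
    have e : (k.rev = k) = (k = k.rev) := by simp only [eq_comm]
    have ck := hc k
    rw [hd]
    simp only [e] at I
    rcases lt_trichotomy k k.rev with h | h | h
    · simp only [h, h.ne, h.not_gt, if_true, if_false] at I ⊢
      linear_combination (norm := match_scalars <;> field) (-q) • I - (q * (q - q⁻¹)) • (ck • (x k * x k.rev))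
    · have h' : ¬ k.rev < k := h.le.not_gt
      have h'' : ¬ k < k.rev := h.ge.not_gt
      have hx : x k.rev = x k := congrArg x h.symm
      simp only [h', h'', if_pos h, if_false, hx] at I ⊢
      linear_combination (norm := match_scalars <;> field) (-q) • I - (q * (q - q⁻¹)) • (ck • (x k * x k))
    · simp only [h, h.ne', h.not_gt, if_true, if_false] at I ⊢
      linear_combination (norm := match_scalars <;> field) (-q) • I - (q * (q - q⁻¹)) • (ck • (x k * x k.rev))
  · simp only [h, if_false, add_zero]
    rcases lt_trichotomy k i with hk | hk | hk
    · have hd : dw q i k = 1 := by simp only [dw]; grind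
      rw [H.h1 k i hk h, hd]; simp only [hk, if_true]; match_scalars; field
    · subst hk
      have hd : dw q k k = q⁻¹ := by simp only [dw]; grind
      rw [hd]; simp [smul_smul, hq]
    · have hd : dw q i k = 1 := by simp only [dw]; grind
      rw [H.h1 i k hk (by grind), hd]; simp [hk.not_gt]

/-- Used in `radial_gen_mul`: the first term puts x^k in front of x^i C_{ij} ∂^j, the second leaves
the multiple of x² ∂^k that the Laplacian term of Λ has to absorb. -/
theorem sum_metric_NN (hq : q ≠ 0) (hc : ∀ i, c i * c i.rev = 1) (H : QRel q g c x) (k b : Fin m) :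
    q • ∑ e, c e.rev • (x e.rev * NN q c x k e b) = (q ^ 2 * c b.rev) • (x k * x b.rev)
      + if k = b then (q * g) • sqSum c x else 0 := by
  have e : ∀ e, c e.rev • (x e.rev * NN q c x k e b) =
      (if e = b then (c b.rev * dw q b k) • (x b.rev * x k) else 0)
      - (if b = k then (q - q⁻¹) • (if k < e then c e.rev • (x e.rev * x e) else 0) else 0)
      + (if e = k.rev then (if b < k.rev then ((q - q⁻¹) * c b.rev) • (x k * x b.rev) else 0) else 0) := by
    intro e
    simp only [NN, mul_add, mul_sub, smul_add, smul_sub]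
    congr 1
    · congr 1
      · by_cases h : e = b
        · subst h; simp [smul_smul]
        · simp [h]
      · by_cases h : b = k <;> by_cases h2 : k < e <;> simp [h, h2, smul_smul, mul_comm]
    · by_cases h : e = k.rev
      · subst h
        by_cases h2 : b < k.rev
        · simp only [h2, and_self, if_true, mul_smul_comm, smul_smul, Fin.rev_rev]
          congr 1
          linear_combination (q - q⁻¹) * c b.rev * hc k
        · simp [h2]
      · simp [h]
  have eT : ∑ e, (if k < e then c e.rev • (x e.rev * x e) else 0) = TT c x k.rev := by
    rw [← Equiv.sum_comp Fin.revPerm, TT]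
    refine Finset.sum_congr rfl fun e _ => ?_
    simp only [Fin.revPerm_apply, Fin.rev_rev]
    grind
  simp only [e, Finset.sum_add_distrib, Finset.sum_sub_distrib, Finset.sum_ite_eq', Finset.mem_univ, if_true]
  by_cases h : k = b
  · subst h
    have I := H.h2 k
    rw [← sqSum] at I
    have hd : dw q k k = if k = k.rev then 1 else q⁻¹ := by simp only [dw]; grind
    simp only [if_true, ← Finset.smul_sum, eT, hd]
    have ck := hc k
    split_ifs at I ⊢ <;>
    linear_combination (norm := match_scalars <;> field) (-q * c k.rev) • I
      + (q * (q - q⁻¹)) • (ck • TT c x k.rev) + (q * g) • (ck • sqSum c x)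
  · have h' : b ≠ k := fun h' => h h'.symm
    simp only [h, h', if_false, Finset.sum_const_zero, sub_zero, add_zero]
    by_cases hb : b = k.rev
    · subst hb
      have hd : dw q k.rev k = q := by simp only [dw]; grind
      simp only [hd, Fin.rev_rev, lt_irrefl, if_false]; module
    have hd : dw q b k = 1 := by simp only [dw]; grind
    rw [hd]
    rcases lt_or_gt_of_ne hb with h2 | h2
    · rw [H.h1 k b.rev (by grind) (by grind)]
      simp only [h2, if_true]; match_scalars; field
    · rw [H.h1 b.rev k (by grind) (by grind)]
      simp only [h2.not_gt, if_false]; module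

/-- The part of `sqSum` strictly between `i` and `i'`. -/
noncomputable def innerSum (c : Fin m → ℂ) (x : Fin m → A) (i : Fin m) : A :=
  ∑ j, if i < j ∧ j < i.rev then c j • (x j * x j.rev) else 0

/-- Combining `QRel.h2` at i and i' with weights c_{i'} and −c_i eliminates x². Since c_i c_{i'} =
1, the two truncated sums then differ only by the indices j with i ≤ j < i'. -/
theorem commutator_rev (hq : q ≠ 0) (hc : ∀ i, c i * c i.rev = 1) (H : QRel q g c x) (i : Fin m)
    (hi : i < i.rev) :
    (q * c i + q⁻¹ * c i.rev) • (x i * x i.rev - x i.rev * x i) = -((q - q⁻¹) • innerSum c x i) := by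
  have I := H.h2 i
  have J := H.h2 i.rev
  rw [← sqSum] at I J
  have hT : TT c x i.rev = TT c x i + c i • (x i * x i.rev) + innerSum c x i := by
    have : c i • (x i * x i.rev) = ∑ j, if j = i then c j • (x j * x j.rev) else 0 := by simp
    rw [this, TT, TT, innerSum, ← Finset.sum_add_distrib, ← Finset.sum_add_distrib]
    refine Finset.sum_congr rfl fun e _ => ?_
    grind
  simp only [Fin.rev_rev, hi, hi.not_gt, hi.ne, hi.ne', if_true, if_false, hT] at I J
  have ci := hc i
  linear_combination (norm := match_scalars <;> field) (c i.rev) • I - (c i) • J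
    - ((q - q⁻¹) ) • (ci • (TT c x i + c i • (x i * x i.rev) + innerSum c x i))
    + (q - q⁻¹) • (ci • TT c x i)

/-- Both letters of each summand lie strictly between k and k', and each contributes one factor q.
-/
theorem mul_innerSum (H : QRel q g c x) (k : Fin m) :
    x k * innerSum c x k = q ^ 2 • (innerSum c x k * x k) := by
  rw [innerSum, Finset.mul_sum, Finset.sum_mul, Finset.smul_sum]
  refine Finset.sum_congr rfl fun j _ => ?_
  split_ifs with h
  · rw [mul_smul_comm, ← mul_assoc, H.h1 k j h.1 h.2.ne, smul_mul_assoc, mul_assoc (x j),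
      H.h1 k j.rev (by grind) (by grind), mul_smul_comm, smul_mul_assoc, ← mul_assoc]
    module
  · simp

/-- The factor q from one letter of the pair cancels the factor q⁻¹ from the other. -/
theorem commute_pair (hq : q ≠ 0) (H : QRel q g c x) (k j : Fin m) (h : j < k) (h' : k < j.rev) :
    Commute (x k) (x j * x j.rev) ∧ Commute (x k) (x j.rev * x j) := by
  have e1 := H.h1 j k h h'.ne
  have e2 := H.h1 k j.rev h' (by grind)
  have e3 : x k * x j = q⁻¹ • (x j * x k) := by rw [e1, smul_smul, inv_mul_cancel₀ hq, one_smul]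
  have e4 : x j.rev * x k = q⁻¹ • (x k * x j.rev) := by rw [e2, smul_smul, inv_mul_cancel₀ hq, one_smul]
  constructor
  · show x k * (x j * x j.rev) = x j * x j.rev * x k
    rw [← mul_assoc, e3, mul_assoc, e4, smul_mul_assoc, mul_smul_comm, mul_assoc]
  · show x k * (x j.rev * x j) = x j.rev * x j * x k
    rw [← mul_assoc, e2, mul_assoc (x j.rev) (x j), e1, smul_mul_assoc, mul_smul_comm, mul_assoc]

/-- The pairs outside the interval from k to k' commute with x_k one at a time. The rest commutes
only as a whole: x_k picks up q² on `innerSum`, and this is compensated by the commutator of x_k and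
x_{k'}, itself a multiple of `innerSum`. -/
theorem sqSum_comm_of_lt (hq : q ≠ 0) (hc : ∀ i, c i * c i.rev = 1)
    (hne : ∀ i, q * c i + q⁻¹ * c i.rev ≠ 0) (H : QRel q g c x) (k : Fin m) (hk : k ≤ k.rev) :
    Commute (x k) (sqSum c x) := by
  have hout : Commute (x k) (∑ j, if j < k ∨ k.rev < j then c j • (x j * x j.rev) else 0) := by
    refine Commute.sum_right _ _ _ fun j _ => ?_
    split_ifs with h
    · refine Commute.smul_right ?_ _
      rcases h with h | h
      · exact (commute_pair hq H k j h (by grind)).1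
      · have := (commute_pair hq H k j.rev (by grind) (by grind)).2
        rwa [Fin.rev_rev] at this
    · exact Commute.zero_right _
  rcases hk.lt_or_eq with hk | hk
  · have e : sqSum c x = (∑ j, if j < k ∨ k.rev < j then c j • (x j * x j.rev) else 0)
        + (c k • (x k * x k.rev) + c k.rev • (x k.rev * x k) + innerSum c x k) := by
      have h1 : c k • (x k * x k.rev) = ∑ j, if j = k then c j • (x j * x j.rev) else 0 := by simp
      have h2 : c k.rev • (x k.rev * x k) = ∑ j, if j = k.rev then c j • (x j * x j.rev) else 0 := by simp
      rw [h1, h2, innerSum, ← Finset.sum_add_distrib, ← Finset.sum_add_distrib, ← Finset.sum_add_distrib, sqSum]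
      refine Finset.sum_congr rfl fun j _ => ?_
      grind
    rw [e]
    refine hout.add_right ?_
    have h1 := mul_innerSum (c := c) H k
    have h2 := commutator_rev hq hc H k hk
    have n := hne k
    have h3 := congrArg (fun y => x k * y) h2
    have h4 := congrArg (fun y => y * x k) h2
    simp only [mul_smul_comm, smul_mul_assoc, mul_neg, neg_mul, h1, mul_sub, sub_mul] at h3 h4
    show x k * _ = _ * x k
    -- Multiplying by q c_k + q⁻¹ c_{k'} allows `commutator_rev` to be used without division.
    rw [← sub_eq_zero, ← smul_eq_zero_iff_right n]
    simp only [mul_add, add_mul, mul_smul_comm, smul_mul_assoc, h1]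
    simp only [mul_assoc] at h3 h4 ⊢
    linear_combination (norm := match_scalars <;> field) (c k) • h3 + (c k.rev) • h4
  · have e : sqSum c x = (∑ j, if j < k ∨ k.rev < j then c j • (x j * x j.rev) else 0)
        + c k • (x k * x k.rev) := by
      have h1 : c k • (x k * x k.rev) = ∑ j, if j = k then c j • (x j * x j.rev) else 0 := by simp
      rw [h1, ← Finset.sum_add_distrib, sqSum]
      refine Finset.sum_congr rfl fun j _ => ?_
      grind
    rw [e]
    refine hout.add_right (Commute.smul_right ?_ _)
    rw [← hk]
    exact (Commute.refl _).mul_right (Commute.refl _)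

end QuadraticRelations

/-! ### Symmetry of the relations under reversal. -/

section QuadraticRelations
variable {A : Type*} [Ring A] [Algebra ℂ A] {m : ℕ} {q g κ : ℂ} {c : Fin m → ℂ} {x : Fin m → A}

/-- The relations are symmetric under reversing products and conjugating indices. -/
theorem QRel.op (H : QRel q g c x) : QRel q g c (fun i => MulOpposite.op (x i.rev)) := by
  constructor
  · intro i j hij hj
    rw [← MulOpposite.op_mul, ← MulOpposite.op_mul, ← MulOpposite.op_smul, H.h1 j.rev i.rev (by grind) (by grind)]
  · intro i
    have h := congrArg MulOpposite.op (H.h2 i)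
    simpa only [TT, Fin.rev_rev, ← MulOpposite.op_mul, ← MulOpposite.op_smul, ← MulOpposite.op_zero,
      ← MulOpposite.op_sub, ← MulOpposite.op_add, ← apply_ite MulOpposite.op, ← Finset.op_sum] using h

theorem sqSum_op (c : Fin m → ℂ) (x : Fin m → A) :
    sqSum c (fun i => MulOpposite.op (x i.rev)) = MulOpposite.op (sqSum c x) := by
  simp only [sqSum, Fin.rev_rev, ← MulOpposite.op_mul, ← MulOpposite.op_smul, ← Finset.op_sum]

/-- Reversal exchanges k and k' and fixes x², so the case k ≤ k' suffices. -/
theorem commute_sqSum (hq : q ≠ 0) (hc : ∀ i, c i * c i.rev = 1)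
    (hne : ∀ i, q * c i + q⁻¹ * c i.rev ≠ 0) (H : QRel q g c x) (k : Fin m) :
    Commute (x k) (sqSum c x) := by
  rcases le_total k k.rev with hk | hk
  · exact sqSum_comm_of_lt hq hc hne H k hk
  · have h := sqSum_comm_of_lt hq hc hne H.op k.rev (by rwa [Fin.rev_rev])
    rw [sqSum_op, Fin.rev_rev] at h
    exact MulOpposite.commute_op.1 h

end QuadraticRelations

/-! ### Centrality of x² in 𝒫 and symmetry of the braiding under reversal. -/

section Derivatives
variable {m : ℕ} (q : Set.Ioo (0 : ℝ) 1)

theorem QRel_gen : QRel ((q : ℝ) : ℂ) (gam m q) (metricCoeff q) (gen (m := m) q) :=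
  QRel_of_rel q (gen q) (gen_rel q)

theorem metricCoeff_add_ne (i : Fin m) :
    ((q : ℝ) : ℂ) * metricCoeff q i + ((q : ℝ) : ℂ)⁻¹ * metricCoeff q i.rev ≠ 0 := by
  have h := q.2.1
  have h1 := Real.rpow_pos_of_pos h (-rho i)
  have h2 := Real.rpow_pos_of_pos h (-rho i.rev)
  have : (0 : ℝ) < (q : ℝ) * (q : ℝ) ^ (-rho i) + (q : ℝ)⁻¹ * (q : ℝ) ^ (-rho i.rev) := by positivity
  simp only [metricCoeff]
  exact_mod_cast this.ne'

theorem metric_apply (i j : Fin m) : metric m q i j = if j = i.rev then metricCoeff q i else 0 := rfl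

theorem sum_metric_smul {M : Type*} [AddCommMonoid M] [Module ℂ M] (f : Fin m → Fin m → M) :
    ∑ i, ∑ j, metric m q i j • f i j = ∑ i, metricCoeff q i • f i i.rev := by
  refine Finset.sum_congr rfl fun i _ => ?_
  simp only [metric_apply, ite_smul, zero_smul, Finset.sum_ite_eq', Finset.mem_univ, if_true]

theorem normSq_eq : normSq m q = sqSum (metricCoeff q) (gen q) := by
  rw [normSq, sum_metric_smul]; rfl

theorem laplacian_eq : laplacian m q = sqSum (metricCoeff q) (partialD q) := by
  rw [laplacian, sum_metric_smul]; rfl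

theorem commute_gen_normSq (k : Fin m) : Commute (gen q k) (normSq m q) := by
  rw [normSq_eq]
  exact commute_sqSum (Q_ne q) (cc_mul q) (metricCoeff_add_ne q) (QRel_gen q) k

theorem commute_normSq (f : Poly m q) : Commute f (normSq m q) := by
  induction f using poly_induction with
  | h0 => exact Commute.one_left _
  | h1 j f hf => exact (commute_gen_normSq q j).mul_left hf
  | h2 f g hf hg => exact hf.add_left hg
  | h3 c f hf => exact hf.smul_left c

/-- The braid matrix is invariant under reversing the order of the strands and conjugating. -/
theorem RhatInv_flip (i j k l : Fin m) :
    RhatInv m q (i, j) (k, l) = RhatInv m q (j.rev, i.rev) (l.rev, k.rev) := by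
  have e1 : (j.rev = i) = (j = i.rev) := by grind
  have e2 : (l.rev = k) = (l = k.rev) := by grind
  simp only [RhatInv, Matrix.of_apply, metric_apply, Fin.rev_rev, dw, Fin.rev_inj, Fin.rev_lt_rev]
  congr 1
  · congr 1
    · grind
    · simp only [and_left_comm]
  · by_cases h1 : j = i.rev
    · by_cases h2 : l = k.rev
      · subst h1 h2; simp only [Fin.rev_rev, if_true]
      · have h2' : ¬ k.rev = l := fun h => h2 h.symm
        simp [h2, h2']
    · have h1' : ¬ i.rev = j := fun h => h1 h.symm
      simp [h1, h1']

theorem Rhat_flip (i j k l : Fin m) :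
    Rhat m q (i, j) (k, l) = Rhat m q (j.rev, i.rev) (l.rev, k.rev) := by
  simp only [Rhat, Matrix.of_apply, metric_apply, Fin.rev_rev, Fin.rev_inj, Fin.rev_lt_rev]
  congr 1
  · congr 1
    · grind
    · simp only [and_left_comm]
  · by_cases h1 : j = i.rev
    · by_cases h2 : l = k.rev
      · subst h1 h2; simp only [Fin.rev_rev, if_true]; grind
      · have h2' : ¬ k.rev = l := fun h => h2 h.symm
        simp [h2, h2']
    · have h1' : ¬ i.rev = j := fun h => h1 h.symm
      simp [h1, h1']

theorem projAnti_flip (i j k l : Fin m) :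
    projAnti m q (i, j) (k, l) = projAnti m q (j.rev, i.rev) (l.rev, k.rev) := by
  simp only [projAnti, Matrix.smul_apply, Matrix.add_apply, Matrix.sub_apply, ← Rhat_flip]
  have h1 : projTrace m q (i, j) (k, l) = projTrace m q (j.rev, i.rev) (l.rev, k.rev) := by
    have m1 : ∀ i j : Fin m, metric m q j.rev i.rev = metric m q i j := by
      intro i j; simp only [metric_apply, Fin.rev_inj]
      by_cases h : j = i.rev
      · subst h; simp
      · have h' : ¬ i.rev = j := fun h' => h h'.symm
        have h'' : ¬ i = j.rev := by grind
        simp [h, h'']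
    simp only [projTrace, Matrix.of_apply, m1]
  have h2 : (1 : Matrix (Fin m × Fin m) (Fin m × Fin m) ℂ) (i, j) (k, l) =
      (1 : Matrix (Fin m × Fin m) (Fin m × Fin m) ℂ) (j.rev, i.rev) (l.rev, k.rev) := by
    simp only [Matrix.one_apply, Prod.mk.injEq, Fin.rev_inj, and_comm]
  rw [h1, h2]

theorem partialD_gen_mul_NN (a k : Fin m) (f : Poly m q) :
    partialD q a (gen q k * f) = (if a = k.rev then metricCoeff q a else 0) • f
      + ((q : ℝ) : ℂ) • ∑ e, NN ((q : ℝ) : ℂ) (metricCoeff q) (gen q) k a e * partialD q e f := by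
  rw [partialD_gen_mul, metric_apply]
  have h : (k = a.rev) = (a = k.rev) := by grind
  simp only [h]
  congr 2
  rw [Finset.sum_comm]
  refine Finset.sum_congr rfl fun e _ => ?_
  rw [← NN_eq, Finset.sum_mul]
  simp only [smul_mul_assoc]

/-! ### The derivatives satisfy the relations of the coordinates. -/

section Action
variable {V : Type*} [AddCommGroup V] [Module ℂ V] (ι : V →ₗ[ℂ] Poly m q) (D : Fin m → Module.End ℂ V)

/-- The conjugate derivatives in the opposite algebra. -/
def opD (D : Fin m → Module.End ℂ V) (i : Fin m) : (Module.End ℂ V)ᵐᵒᵖ := MulOpposite.op (D i.rev)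

/-- The rule for ∂^a x^k can be read as a matrix with coordinates as entries, as in `partialMatrix`,
or with derivatives as entries. `RhatInv_flip` shows that the second reading is the first one for
the conjugate derivatives in the opposite algebra, which makes `QRel_MM` available for it. -/
theorem unop_NN_opD (a k b : Fin m) (v : V) :
    (NN ((q : ℝ) : ℂ) (metricCoeff q) (opD D) a.rev k.rev b.rev).unop v =
      ∑ e, (Rhat m q)⁻¹ (a, k) (b, e) • D e v := by
  rw [← NN_eq, ← Equiv.sum_comp Fin.revPerm]
  simp only [Finset.unop_sum, MulOpposite.unop_smul, LinearMap.sum_apply, LinearMap.smul_apply,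
    Fin.revPerm_apply, Rhat_inv, opD, Fin.rev_rev, MulOpposite.unop_op]
  refine Finset.sum_congr rfl fun e _ => ?_
  rw [RhatInv_flip q a k b e]

variable (hι : ∀ i v, ι (D i v) = partialD q i (ι v))
include hι

/-- Here a labels the matrix and the coordinate is the vector index: column `none` holds the metric
term, column `some b.rev` the operator standing to the right of x^b. The map `ι` allows operators on
a space smaller than 𝒫, on which the relations are already known. -/
theorem partialD_gen_mul_map (a k : Fin m) (v : V) :
    partialD q a (gen q k * ι v) =
      ι ((MM ((q : ℝ) : ℂ) (metricCoeff q) (opD D) a.rev (some k.rev) none).unop v)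
      + ∑ b, gen q b * ι ((MM ((q : ℝ) : ℂ) (metricCoeff q) (opD D) a.rev (some k.rev) (some b.rev)).unop v) := by
  rw [partialD_gen_mul, metric_apply]
  congr 1
  · simp only [MM, Fin.rev_rev]
    by_cases h : k = a.rev
    · subst h; simp [Algebra.algebraMap_eq_smul_one]
    · have h' : ¬ k.rev = a := by grind
      simp [h, h']
  · simp only [MM, MulOpposite.unop_smul, LinearMap.smul_apply, unop_NN_opD, map_smul, map_sum, hι,
      Finset.mul_sum, mul_smul_comm, Finset.smul_sum]

/-- ∂^{a₂} acts first and yet gives the left factor: its matrix transforms the row of x^k first, and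
the entries are multiplied in the opposite algebra, where the left factor acts first. -/
theorem partialD_partialD_gen_mul (a₁ a₂ k : Fin m) (v : V) :
    partialD q a₁ (partialD q a₂ (gen q k * ι v)) =
      ι (((MM ((q : ℝ) : ℂ) (metricCoeff q) (opD D) a₂.rev * MM ((q : ℝ) : ℂ) (metricCoeff q) (opD D) a₁.rev)
        (some k.rev) none).unop v)
      + ∑ b, gen q b * ι (((MM ((q : ℝ) : ℂ) (metricCoeff q) (opD D) a₂.rev
          * MM ((q : ℝ) : ℂ) (metricCoeff q) (opD D) a₁.rev) (some k.rev) (some b.rev)).unop v) := by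
  rw [partialD_gen_mul_map q ι D hι, map_add, map_sum]
  simp only [partialD_gen_mul_map q ι D hι, ← hι, Matrix.mul_apply, Fintype.sum_option,
    MulOpposite.unop_add, Finset.unop_sum, MulOpposite.unop_mul, LinearMap.add_apply, LinearMap.sum_apply,
    Module.End.mul_apply, map_add, map_sum, Finset.sum_add_distrib]
  rw [← add_assoc]
  congr 1
  · congr 1
    · simp [MM, opD]
    · rw [← Equiv.sum_comp Fin.revPerm]
      simp only [Fin.revPerm_apply, Fin.rev_rev]
  · have h0 : ∀ b, MM ((q : ℝ) : ℂ) (metricCoeff q) (opD D) a₁.rev none (some b) = 0 := fun b => rfl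
    simp only [h0, MulOpposite.unop_zero, LinearMap.zero_apply, map_zero, zero_add, Finset.mul_sum]
    rw [Finset.sum_comm]
    refine Finset.sum_congr rfl fun b _ => ?_
    rw [← Equiv.sum_comp Fin.revPerm]
    simp only [Fin.revPerm_apply, Fin.rev_rev]

/-- By `QRel_MM` the matrices built from operators satisfying the relations satisfy them again. The
entries in the row of x^k of that matrix identity are the constant part and the coefficients of the
x^b. -/
theorem projAnti_partialD_gen_mul (H : QRel ((q : ℝ) : ℂ) (gam m q) (metricCoeff q) D) (i j k : Fin m) (v : V) :
    ∑ a, ∑ b, projAnti m q (i, j) (a, b) • partialD q a (partialD q b (gen q k * ι v)) = 0 := by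
  have hm : 1 ≤ m := by have := i.isLt; omega
  -- The pair (j', i'), together with `projAnti_flip`, undoes the reversed order and the conjugate
  -- indices of `partialD_partialD_gen_mul`.
  have HM := rel_of_QRel q _ (QRel_MM (Q_ne q) (cc_mul q) (cc_mid q) _ (Phi_cc q) (gam_eq q hm) H.op) j.rev i.rev
  have hent : ∀ s, ∑ a, ∑ b, projAnti m q (i, j) (a, b) •
      (((MM ((q : ℝ) : ℂ) (metricCoeff q) (opD D) b.rev * MM ((q : ℝ) : ℂ) (metricCoeff q) (opD D) a.rev)
      (some k.rev) s).unop v) = 0 := by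
    intro s
    have h := congrArg (fun M => (M (some k.rev) s).unop v) HM
    simp only [Matrix.sum_apply, Matrix.smul_apply, Matrix.zero_apply, Finset.unop_sum,
      MulOpposite.unop_smul, MulOpposite.unop_zero, LinearMap.sum_apply, LinearMap.smul_apply,
      LinearMap.zero_apply] at h
    rw [Finset.sum_comm]
    rw [← h, ← Equiv.sum_comp Fin.revPerm]
    refine Finset.sum_congr rfl fun a _ => ?_
    rw [← Equiv.sum_comp Fin.revPerm]
    refine Finset.sum_congr rfl fun b _ => ?_
    rw [projAnti_flip]
    simp only [Fin.revPerm_apply, Fin.rev_rev]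
    rfl
  have h2 := congrArg ι (hent none)
  have h3 := fun b : Fin m => congrArg (fun w => gen q b * ι w) (hent (some b.rev))
  simp only [map_sum, map_smul, map_zero, Finset.mul_sum, mul_smul_comm, mul_zero] at h2 h3
  simp only [partialD_partialD_gen_mul q ι D hι, smul_add, Finset.sum_add_distrib, h2, zero_add, Finset.smul_sum]
  rw [Finset.sum_congr rfl fun a _ => Finset.sum_comm, Finset.sum_comm]
  exact Finset.sum_eq_zero fun b _ => h3 b

end Action

/-- During the induction on degree the relations are known only on a stable subspace W, so the
operators are first restricted to W. -/
theorem projAnti_partialD_gen_mul_of_mem {M : Type*} [AddCommGroup M] [Module ℂ M] (φ : M →ₗ[ℂ] Poly m q)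
    (d : Fin m → Module.End ℂ M) (hφ : ∀ i v, φ (d i v) = partialD q i (φ v)) (W : Submodule ℂ M)
    (hd : ∀ i, ∀ v ∈ W, d i v ∈ W)
    (hW : ∀ v ∈ W, ∀ i j, ∑ k, ∑ l, projAnti m q (i, j) (k, l) • d k (d l v) = 0)
    (i j k : Fin m) (v : M) (hv : v ∈ W) :
    ∑ a, ∑ b, projAnti m q (i, j) (a, b) • partialD q a (partialD q b (gen q k * φ v)) = 0 := by
  have H : QRel ((q : ℝ) : ℂ) (gam m q) (metricCoeff q) (fun i => (d i).restrict (hd i)) := by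
    refine QRel_of_rel q _ fun i j => ?_
    ext v
    simpa [LinearMap.sum_apply] using hW v v.2 i j
  exact projAnti_partialD_gen_mul q (φ ∘ₗ W.subtype) (fun i => (d i).restrict (hd i))
    (fun i v => hφ i v) H i j k ⟨v, hv⟩

theorem gam_mul_mu (hm : 1 ≤ m) : gam m q * ((mu m q : ℝ) : ℂ) =
    - (((q : ℝ) : ℂ) * ((q : ℝ) : ℂ) ^ (1 - (m : ℤ)) * (((q : ℝ) : ℂ) - ((q : ℝ) : ℂ)⁻¹)) := by
  rw [← gam_eq q hm, mu]
  push_cast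
  rw [← zpow_one_add₀ (Q_ne q)]
  ring_nf

theorem mu_eq : ((mu m q : ℝ) : ℂ) = 1 + ((q : ℝ) : ℂ) * ((q : ℝ) : ℂ) ^ (1 - (m : ℤ)) := by
  rw [mu]
  push_cast
  rw [← zpow_one_add₀ (Q_ne q)]
  ring_nf

/-- Induction on the degree: derivatives preserve the polynomials of degree at most n, so the
relations there carry over to x^k times such polynomials. -/
theorem projAnti_partialD_lowDegree (n : ℕ) : ∀ f ∈ lowDegree m q n, ∀ i j,
    ∑ k, ∑ l, projAnti m q (i, j) (k, l) • partialD q k (partialD q l f) = 0 := by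
  induction n with
  | zero =>
    intro f hf i j
    simp [(partialD_lowDegree q 0 f hf _).1 rfl]
  | succ n ih =>
    have hD : ∀ i, ∀ v ∈ lowDegree m q n, partialD q i v ∈ lowDegree m q n := by
      intro i v hv
      rcases n with _ | n
      · rw [(partialD_lowDegree q 0 v hv i).1 rfl]; exact zero_mem _
      · exact lowDegree_succ q _ _ ((partialD_lowDegree q (n + 1) v hv i).2 n rfl)
    intro f hf i j
    rw [lowDegree, Submodule.mem_sup] at hf
    obtain ⟨a, ha, b, hb, rfl⟩ := hf
    rw [Submodule.mem_span_singleton] at ha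
    obtain ⟨c, rfl⟩ := ha
    simp only [map_add, map_smul, partialD_one, smul_zero, zero_add]
    induction hb using Submodule.iSup_induction' with
    | mem k x hx =>
      obtain ⟨y, hy, rfl⟩ := hx
      exact projAnti_partialD_gen_mul_of_mem q LinearMap.id (partialD q) (fun _ _ => rfl) _ hD ih i j k y hy
    | zero => simp
    | add x y _ _ hx hy => simp only [map_add, smul_add, Finset.sum_add_distrib, hx, hy, add_zero]

/-- This makes the substitution of ∂ for x, and hence the form ⟨a, b⟩, meaningful. -/
theorem projAnti_partialD (i j : Fin m) :
    ∑ k, ∑ l, projAnti m q (i, j) (k, l) • (partialD q k * partialD q l) = 0 := by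
  ext f
  obtain ⟨n, hn⟩ := exists_lowDegree q f
  simpa [LinearMap.sum_apply] using projAnti_partialD_lowDegree q n f hn i j

end Derivatives

/-! ### The operators a(∂), and the Leibniz rules for x², Δ and Λ. -/

section Operators
variable {m : ℕ} (q : Set.Ioo (0 : ℝ) 1)

theorem QRel_partialD : QRel ((q : ℝ) : ℂ) (gam m q) (metricCoeff q) (partialD (m := m) q) :=
  QRel_of_rel q _ (projAnti_partialD q)

/-- The action of `𝒫` on itself in which `x^i` acts by `∂^i`. -/
noncomputable def partialAlg (m : ℕ) (q : Set.Ioo (0 : ℝ) 1) : Poly m q →ₐ[ℂ] Module.End ℂ (Poly m q) :=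
  RingQuot.liftAlgHom ℂ ⟨FreeAlgebra.lift ℂ (partialD q), by
    rintro _ _ ⟨i, j⟩
    simp only [map_sum, map_smul, map_mul, map_zero, FreeAlgebra.lift_ι_apply]
    exact projAnti_partialD q i j⟩

theorem partialAlg_gen (i : Fin m) : partialAlg m q (gen q i) = partialD q i := by
  simp [partialAlg, gen]

theorem partialAlg_normSq : partialAlg m q (normSq m q) = laplacian m q := by
  simp only [normSq_eq, laplacian_eq, sqSum, map_sum, map_smul, map_mul, partialAlg_gen]

/-- Δ is x²(∂), so the centrality of x² carries over to it. -/
theorem partialD_laplacian (i : Fin m) (f : Poly m q) :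
    partialD q i (laplacian m q f) = laplacian m q (partialD q i f) := by
  have h := (commute_gen_normSq q i).map (partialAlg m q)
  rw [partialAlg_gen, partialAlg_normSq] at h
  exact LinearMap.congr_fun h f

/-- The block matrix of multiplication by x² on the column (f, ∂f): `sum_vv` gives the column
`none`, and `sum_NN_mul_NN` shows that the remaining block is scalar. -/
theorem partialHom_normSq (s : Option (Fin m)) (a : Fin m) :
    partialHom m q (normSq m q) (some a) s = match s with
      | none => ((mu m q : ℝ) : ℂ) • gen q a
      | some b => if a = b then ((q : ℝ) : ℂ) ^ 2 • normSq m q else 0 := by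
  have e : partialHom m q (normSq m q) = ∑ j, metricCoeff q j •
      (MM ((q : ℝ) : ℂ) (metricCoeff q) (gen q) j * MM ((q : ℝ) : ℂ) (metricCoeff q) (gen q) j.rev) := by
    simp only [normSq_eq, sqSum, map_sum, map_smul, map_mul, partialHom_gen, partialMatrix_eq]
  rw [e]
  simp only [Matrix.sum_apply, Matrix.smul_apply, MM_mul]
  rcases s with _ | b
  · rw [sum_vv (cc_mul q) (Phi_cc q), mu_eq]
  · have h := sum_NN_mul_NN (Q_ne q) (cc_mul q) (cc_mid q) (Phi_cc q) (QRel_gen q) a b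
    simp only [smul_comm (metricCoeff q _)]
    rw [← Finset.smul_sum, h, normSq_eq]
    split_ifs <;> simp

theorem partialD_normSq_mul (a : Fin m) (f : Poly m q) :
    partialD q a (normSq m q * f) = ((mu m q : ℝ) : ℂ) • (gen q a * f)
      + ((q : ℝ) : ℂ) ^ 2 • (normSq m q * partialD q a f) := by
  have h : partialD q a (normSq m q * f) = partialHom m q (normSq m q * f) (some a) none := rfl
  have h' : ∀ b, partialHom m q f (some b) none = partialD q b f := fun b => rfl
  rw [h, map_mul, Matrix.mul_apply, Fintype.sum_option]
  simp only [partialHom_normSq, (partialHom_none q f).1, h', ite_mul, zero_mul, Finset.sum_ite_eq,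
    Finset.mem_univ, if_true, smul_mul_assoc]

theorem laplacian_apply (f : Poly m q) :
    laplacian m q f = ∑ j, metricCoeff q j • partialD q j (partialD q j.rev f) := by
  rw [laplacian_eq, sqSum, LinearMap.sum_apply]; rfl

/-- The mirror image of `partialD_normSq_mul`: the same two contraction identities, applied in the
opposite algebra to the conjugate derivatives. -/
theorem laplacian_gen_mul (k : Fin m) (f : Poly m q) :
    laplacian m q (gen q k * f) = ((q : ℝ) : ℂ) ^ 2 • (gen q k * laplacian m q f)
      + ((mu m q : ℝ) : ℂ) • partialD q k f := by
  obtain ⟨X, hX⟩ : ∃ X : Fin m → Fin m → (Module.End ℂ (Poly m q))ᵐᵒᵖ, X = fun j b =>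
    ∑ e, NN ((q : ℝ) : ℂ) (metricCoeff q) (opD (partialD q)) j k.rev e *
      NN ((q : ℝ) : ℂ) (metricCoeff q) (opD (partialD q)) j.rev e b := ⟨_, rfl⟩
  have h : ∀ j : Fin m, partialD q j (partialD q j.rev (gen q k * f)) =
      (vv ((q : ℝ) : ℂ) (metricCoeff q) (opD (partialD q)) k.rev j j.rev).unop f
      + ∑ b, gen q b * (((q : ℝ) : ℂ) ^ 2 • (X j b.rev).unop f) := by
    intro j
    have h := partialD_partialD_gen_mul q LinearMap.id (partialD q) (fun _ _ => rfl) j j.rev k f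
    simp only [LinearMap.id_apply, MM_mul, Fin.rev_rev] at h
    rw [h, hX]
    rfl
  have h1 := congrArg (fun y => y.unop f)
    (sum_vv (q := ((q : ℝ) : ℂ)) (x := opD (partialD q)) (cc_mul q) (Phi_cc q) k.rev)
  have h2 : ∀ b, ∑ j, metricCoeff q j • X j b = if k.rev = b then MulOpposite.op (laplacian m q) else 0 := by
    intro b
    rw [hX, laplacian_eq, ← sqSum_op]
    exact sum_NN_mul_NN (Q_ne q) (cc_mul q) (cc_mid q) (Phi_cc q) (QRel_partialD q).op k.rev b
  have h3 : ∀ b : Fin m, ∑ j, metricCoeff q j • (gen q b * (((q : ℝ) : ℂ) ^ 2 • (X j b.rev).unop f)) =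
      if b = k then ((q : ℝ) : ℂ) ^ 2 • (gen q k * laplacian m q f) else 0 := by
    intro b
    have h4 := congrArg (fun y => ((q : ℝ) : ℂ) ^ 2 • (gen q b * y.unop f)) (h2 b.rev)
    simp only [Finset.unop_sum, MulOpposite.unop_smul, LinearMap.sum_apply, LinearMap.smul_apply,
      Finset.mul_sum, Finset.smul_sum, mul_smul_comm] at h4 ⊢
    simp only [smul_comm (metricCoeff q _)]
    rw [h4]
    have e : (k.rev = b.rev) = (b = k) := by rw [Fin.rev_inj]; exact propext eq_comm
    simp only [e]
    split_ifs with hb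
    · rw [hb, MulOpposite.unop_op]
    · simp
  simp only [Finset.unop_sum, MulOpposite.unop_smul, LinearMap.sum_apply, LinearMap.smul_apply, ← mu_eq] at h1
  rw [laplacian_apply]
  simp only [h, smul_add, Finset.sum_add_distrib, Finset.smul_sum]
  rw [h1, Finset.sum_comm, Finset.sum_congr rfl fun b _ => h3 b, Finset.sum_ite_eq', if_pos (Finset.mem_univ k),
    add_comm, opD, Fin.rev_rev, MulOpposite.unop_op]

/-- The operator `x^i C_{ij} ∂^j`. -/
noncomputable def radial (m : ℕ) (q : Set.Ioo (0 : ℝ) 1) (f : Poly m q) : Poly m q :=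
  ∑ i, metricCoeff q i • (gen q i * partialD q i.rev f)

theorem euler_apply (f : Poly m q) : euler m q f = f + (((q : ℝ) : ℂ) ^ 2 - 1) • radial m q f
    + ((((q : ℝ) : ℂ) ^ 2 - 1) ^ 2 / (((q : ℝ) : ℂ) ^ ((m : ℤ) - 2) * ((mu m q : ℝ) : ℂ) ^ 2)) •
      (normSq m q * laplacian m q f) := by
  rw [euler, sum_metric_smul]
  simp [radial, LinearMap.sum_apply]

theorem radial_gen_mul (k : Fin m) (f : Poly m q) : radial m q (gen q k * f) = gen q k * f
      + ((q : ℝ) : ℂ) ^ 2 • (gen q k * radial m q f)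
      + (((q : ℝ) : ℂ) * gam m q) • (normSq m q * partialD q k f) := by
  rw [radial, ← Equiv.sum_comp Fin.revPerm]
  simp only [Fin.revPerm_apply, Fin.rev_rev, partialD_gen_mul_NN, mul_add, smul_add, Finset.sum_add_distrib]
  rw [add_assoc]
  congr 1
  · rw [Finset.sum_eq_single k.rev]
    · rw [if_pos rfl, Fin.rev_rev, mul_smul_comm, smul_smul, cc_mul, one_smul]
    · intro b _ hb; simp [hb]
    · simp
  · have h := fun b => congrArg (fun y => y * partialD q b f)
      (sum_metric_NN (Q_ne q) (cc_mul q) (QRel_gen q) k b)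
    have e : ∑ i, metricCoeff q i.rev • (gen q i.rev * ((q : ℝ) : ℂ) • ∑ e,
        NN ((q : ℝ) : ℂ) (metricCoeff q) (gen q) k i e * partialD q e f) =
        ∑ b, (((q : ℝ) : ℂ) • ∑ e, metricCoeff q e.rev • (gen q e.rev *
          NN ((q : ℝ) : ℂ) (metricCoeff q) (gen q) k e b)) * partialD q b f := by
      simp only [Finset.smul_sum, Finset.mul_sum, Finset.sum_mul, mul_smul_comm, smul_mul_assoc, mul_assoc]
      rw [Finset.sum_comm]
      simp only [smul_comm ((q : ℝ) : ℂ)]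
    rw [e, Finset.sum_congr rfl fun b _ => h b]
    simp only [add_mul, Finset.sum_add_distrib, ite_mul, zero_mul, Finset.sum_ite_eq, Finset.mem_univ, if_true,
      smul_mul_assoc, ← normSq_eq]
    congr 1
    rw [radial, ← Equiv.sum_comp Fin.revPerm, Finset.mul_sum, Finset.smul_sum]
    refine Finset.sum_congr rfl fun b _ => ?_
    simp only [Fin.revPerm_apply, Fin.rev_rev, mul_smul_comm, smul_smul, mul_assoc]

theorem mu_pos : 0 < mu m q := by
  have := zpow_pos q.2.1 (2 - (m : ℤ))
  rw [mu]; linarith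

theorem mu_ne : ((mu m q : ℝ) : ℂ) ≠ 0 := by exact_mod_cast (mu_pos q).ne'

/-- Moving x^k to the left through x^i C_{ij} ∂^j and through x²Δ leaves in each case a multiple of
x² ∂^k, and in Λ these cancel. It follows that Λ multiplies words of length n by q^{2n}. -/
theorem euler_gen_mul (k : Fin m) (f : Poly m q) :
    euler m q (gen q k * f) = ((q : ℝ) : ℂ) ^ 2 • (gen q k * euler m q f) := by
  have hm : 1 ≤ m := by have := k.isLt; omega
  have hq := Q_ne q
  have hmu := mu_ne (m := m) q
  have hg := gam_mul_mu q hm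
  have hc : gen q k * (normSq m q * laplacian m q f) = normSq m q * (gen q k * laplacian m q f) := by
    rw [← mul_assoc, (commute_gen_normSq q k).eq, mul_assoc]
  simp only [euler_apply, radial_gen_mul, laplacian_gen_mul, mul_add, mul_smul_comm, hc]
  -- The total coefficient of x² ∂^k. Its vanishing determines the constant in front of x²Δ in the
  -- definition of Λ.
  have e1 : (((q : ℝ) : ℂ) ^ 2 - 1) * (((q : ℝ) : ℂ) * gam m q) +
      ((((q : ℝ) : ℂ) ^ 2 - 1) ^ 2 / (((q : ℝ) : ℂ) ^ ((m : ℤ) - 2) * ((mu m q : ℝ) : ℂ) ^ 2)) * ((mu m q : ℝ) : ℂ) = 0 := by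
    have z1 : ((q : ℝ) : ℂ) ^ ((m : ℤ) - 2) * ((q : ℝ) : ℂ) ^ (1 - (m : ℤ)) = ((q : ℝ) : ℂ)⁻¹ := by
      rw [← zpow_add₀ hq, show (m : ℤ) - 2 + (1 - m) = -1 by ring, zpow_neg_one]
    have z2 : ((q : ℝ) : ℂ) ^ ((m : ℤ) - 2) ≠ 0 := zpow_ne_zero _ hq
    have z3 : (((q : ℝ) : ℂ) ^ 2 - 1) * (((q : ℝ) : ℂ) * gam m q) * ((mu m q : ℝ) : ℂ) * ((q : ℝ) : ℂ) ^ ((m : ℤ) - 2) =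
        - (((q : ℝ) : ℂ) ^ 2 - 1) ^ 2 := by
      linear_combination ((((q : ℝ) : ℂ) ^ 2 - 1) * ((q : ℝ) : ℂ) * ((q : ℝ) : ℂ) ^ ((m : ℤ) - 2)) * hg
        - ((((q : ℝ) : ℂ) ^ 2 - 1) * ((q : ℝ) : ℂ) ^ 2 * (((q : ℝ) : ℂ) - ((q : ℝ) : ℂ)⁻¹)) * z1
        + (-(((q : ℝ) : ℂ) ^ 2 - 1) * (((q : ℝ) : ℂ) ^ 2 - 1 - ((q : ℝ) : ℂ) * ((q : ℝ) : ℂ)⁻¹ ))  * mul_inv_cancel₀ hq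
    generalize ((q : ℝ) : ℂ) ^ ((m : ℤ) - 2) = z at *
    field_simp
    linear_combination z3
  linear_combination (norm := module) e1 • (normSq m q * partialD q k f)

end Operators

/-! ### The anti-automorphism x^i ↦ x^{i'} and the braiding. -/

section Flip
variable {m : ℕ} (q : Set.Ioo (0 : ℝ) 1)

/-- The anti-automorphism `x^i ↦ x^{i'}`, as a homomorphism to the opposite algebra. -/
noncomputable def flipHom (m : ℕ) (q : Set.Ioo (0 : ℝ) 1) : Poly m q →ₐ[ℂ] (Poly m q)ᵐᵒᵖ :=
  RingQuot.liftAlgHom ℂ ⟨FreeAlgebra.lift ℂ (fun i => MulOpposite.op (gen q i.rev)), by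
    rintro _ _ ⟨i, j⟩
    simp only [map_sum, map_smul, map_mul, map_zero, FreeAlgebra.lift_ι_apply]
    exact rel_of_QRel q _ (QRel_gen q).op i j⟩

/-- The anti-automorphism `x^i ↦ x^{i'}` of `𝒫`. -/
noncomputable def flip (m : ℕ) (q : Set.Ioo (0 : ℝ) 1) : Poly m q →ₗ[ℂ] Poly m q :=
  (MulOpposite.opLinearEquiv ℂ).symm.toLinearMap ∘ₗ (flipHom m q).toLinearMap

theorem flip_gen (i : Fin m) : flip m q (gen q i) = gen q i.rev := by
  simp [flip, flipHom, gen]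

theorem flip_one : flip m q 1 = 1 := by simp [flip]

theorem flip_mul (f g : Poly m q) : flip m q (f * g) = flip m q g * flip m q f := by
  simp [flip]

theorem flip_flip (f : Poly m q) : flip m q (flip m q f) = f := by
  induction f using poly_induction with
  | h0 => rw [flip_one, flip_one]
  | h1 j f hf => rw [flip_mul, flip_mul, hf, flip_gen, flip_gen, Fin.rev_rev]
  | h2 f g hf hg => rw [map_add, map_add, hf, hg]
  | h3 c f hf => rw [map_smul, map_smul, hf]

/-- Appending letters on the right is prepending them on the left after `flip`. -/
theorem poly_induction_right {P : Poly m q → Prop} (h0 : P 1)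
    (h1 : ∀ j f, P f → P (f * gen q j)) (h2 : ∀ f g, P f → P g → P (f + g))
    (h3 : ∀ (c : ℂ) f, P f → P (c • f)) (f : Poly m q) : P f := by
  rw [← flip_flip q f]
  induction flip m q f using poly_induction with
  | h0 => rwa [flip_one]
  | h1 j f hf => rw [flip_mul, flip_gen]; exact h1 _ _ hf
  | h2 f g hf hg => rw [map_add]; exact h2 _ _ hf hg
  | h3 c f hf => rw [map_smul]; exact h3 _ _ hf

theorem flip_normSq : flip m q (normSq m q) = normSq m q := by
  simp only [normSq_eq, sqSum, map_sum, map_smul, flip_mul, flip_gen, Fin.rev_rev]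

theorem constTerm_flip (f : Poly m q) : constTerm m q (flip m q f) = constTerm m q f := by
  induction f using poly_induction with
  | h0 => rw [flip_one]
  | h1 j f hf => rw [flip_mul, flip_gen, map_mul, map_mul, constTerm_gen, constTerm_gen, mul_zero, zero_mul]
  | h2 f g hf hg => rw [map_add, map_add, map_add, hf, hg]
  | h3 c f hf => rw [map_smul, map_smul, map_smul, hf]

/-- The braiding coefficients `q (R̂⁻¹)^{ik}_{bl}` contracted with an array. -/
noncomputable def braid {M : Type*} [AddCommGroup M] [Module ℂ M] (i k : Fin m) (F : Fin m → Fin m → M) : M :=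
  ((q : ℝ) : ℂ) • ∑ b, ∑ l, (Rhat m q)⁻¹ (i, k) (b, l) • F b l

section braid
variable {M N : Type*} [AddCommGroup M] [Module ℂ M] [AddCommGroup N] [Module ℂ N] (i k : Fin m)

theorem braid_add (F G : Fin m → Fin m → M) :
    braid q i k (fun b l => F b l + G b l) = braid q i k F + braid q i k G := by
  simp only [braid, smul_add, Finset.sum_add_distrib]

theorem braid_sub (F G : Fin m → Fin m → M) :
    braid q i k (fun b l => F b l - G b l) = braid q i k F - braid q i k G := by
  simp only [braid, smul_sub, Finset.sum_sub_distrib]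

theorem map_braid (φ : M →ₗ[ℂ] N) (F : Fin m → Fin m → M) :
    φ (braid q i k F) = braid q i k (fun b l => φ (F b l)) := by
  simp only [braid, map_smul, map_sum]

theorem braid_smul (c : ℂ) (F : Fin m → Fin m → M) :
    braid q i k (fun b l => c • F b l) = c • braid q i k F := by
  have h := map_braid q i k (LinearMap.lsmul ℂ M c) F
  simp only [LinearMap.lsmul_apply] at h
  exact h.symm

theorem braid_zero : braid q i k (fun _ _ => (0 : M)) = 0 := by
  simp only [braid, smul_zero, Finset.sum_const_zero]

theorem braid_apply {α : Type*} (F : Fin m → Fin m → α → M) (a : α) :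
    braid q i k F a = braid q i k (fun b l => F b l a) := map_braid q i k (LinearMap.proj a) F

theorem braid_braid (i' k' : Fin m) (F : Fin m → Fin m → Fin m → Fin m → M) :
    braid q i k (fun b l => braid q i' k' (F b l)) =
      braid q i' k' (fun b' l' => braid q i k (fun b l => F b l b' l')) := by
  let φ : (Fin m → Fin m → M) →ₗ[ℂ] M :=
    { toFun := fun G => braid q i k G
      map_add' := fun G G' => braid_add q i k G G'
      map_smul' := fun c G => braid_smul q i k c G }
  have h := map_braid q i' k' φ (fun b' l' b l => F b l b' l')
  refine Eq.trans ?_ h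
  show _ = braid q i k _
  congr 1
  funext b l
  rw [braid_apply, braid_apply]

end braid

theorem mul_braid (i k : Fin m) (f : Poly m q) (F : Fin m → Fin m → Poly m q) :
    f * braid q i k F = braid q i k (fun b l => f * F b l) := map_braid q i k (LinearMap.mulLeft ℂ f) F

theorem braid_mul (i k : Fin m) (f : Poly m q) (F : Fin m → Fin m → Poly m q) :
    braid q i k F * f = braid q i k (fun b l => F b l * f) := map_braid q i k (LinearMap.mulRight ℂ f) F

theorem partialD_gen_mul_braid (i k : Fin m) (f : Poly m q) :
    partialD q i (gen q k * f) = metric m q i k • f + braid q i k (fun b l => gen q b * partialD q l f) :=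
  partialD_gen_mul q i k f

theorem braid_gen_gen (i k : Fin m) : braid q i k (fun b l => gen q b * gen q l) = gen q i * gen q k
    + ((((q : ℝ) : ℂ) * (((q : ℝ) : ℂ) - ((q : ℝ) : ℂ)⁻¹) + ((q : ℝ) : ℂ) * gam m q) * metric m q i k) •
      normSq m q := by
  have h := sum_NN_mul (Q_ne q) (cc_mul q) (QRel_gen q) k i
  rw [← normSq_eq] at h
  have e : braid q i k (fun b l => gen q b * gen q l) =
      ((q : ℝ) : ℂ) • ∑ l, NN ((q : ℝ) : ℂ) (metricCoeff q) (gen q) k i l * gen q l := by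
    rw [braid, Finset.sum_comm]
    congr 1
    refine Finset.sum_congr rfl fun l _ => ?_
    rw [← NN_eq, Finset.sum_mul]
    simp only [smul_mul_assoc]
  rw [e, h, metric_apply]
  have e : (k = i.rev) = (i = k.rev) := by grind
  simp only [e]
  split_ifs <;> simp

/-! ### Right derivatives and the invariance of Δ under reversal. -/

/-- The derivatives acting from the right, `∂^{i'}` conjugated by the anti-automorphism. -/
noncomputable def rightD (i : Fin m) : Poly m q →ₗ[ℂ] Poly m q :=
  flip m q ∘ₗ partialD q i.rev ∘ₗ flip m q

theorem rightD_apply (i : Fin m) (f : Poly m q) :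
    rightD q i f = flip m q (partialD q i.rev (flip m q f)) := rfl

theorem metric_flip (i j : Fin m) : metric m q j.rev i.rev = metric m q i j := by
  simp only [metric_apply, Fin.rev_inj]
  by_cases h : j = i.rev
  · subst h; simp
  · have h' : ¬ i.rev = j := fun h' => h h'.symm
    have h'' : ¬ i = j.rev := by grind
    simp [h, h'']

theorem rightD_one (i : Fin m) : rightD q i 1 = 0 := by
  rw [rightD_apply, flip_one, partialD_one, map_zero]

/-- By `RhatInv_flip` the same braiding coefficients govern left and right derivatives. This
coincidence makes `rightD` adjoint to left multiplication in `pairing_gen_mul`. -/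
theorem rightD_mul_gen (n j : Fin m) (f : Poly m q) :
    rightD q j (f * gen q n) = metric m q n j • f + braid q n j (fun c d => rightD q c f * gen q d) := by
  rw [rightD_apply, flip_mul, flip_gen, partialD_gen_mul_braid, map_add, map_smul, flip_flip, metric_flip,
    map_braid]
  congr 1
  rw [braid, braid]
  congr 1
  rw [Finset.sum_comm, ← Equiv.sum_comp Fin.revPerm]
  refine Finset.sum_congr rfl fun c _ => ?_
  rw [← Equiv.sum_comp Fin.revPerm]
  refine Finset.sum_congr rfl fun d _ => ?_
  simp only [Fin.revPerm_apply]
  rw [Rhat_inv, RhatInv_flip q n j c d, flip_mul, flip_gen, Fin.rev_rev, ← rightD_apply]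

theorem rightD_gen (j l : Fin m) : rightD q j (gen q l) = metric m q l j • 1 := by
  have h := rightD_mul_gen q l j 1
  simp only [one_mul, rightD_one, zero_mul] at h
  rw [h]; simp [braid]

/-- The skein relation R̂ − R̂⁻¹ = (q − q⁻¹)(1 − K), K^{ij}_{kl} = C^{ij} C_{kl}, with one leg bent
by the metric. In both braid terms the strand from i to j crosses the strand from k to b, in
opposite senses; the two metric terms are the two smoothings. Here it is verified entry by entry. -/
theorem metric_braid_aux {m : ℕ} (Q : ℂ) (hq : Q ≠ 0) (c : Fin m → ℂ) (hc : ∀ i, c i * c i.rev = 1)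
   (i k j b : Fin m) :
    (1 - Q ^ 2) * ((if j = k.rev then c k else 0) * (if i = b then 1 else 0) - (if k = i.rev then c i else 0) * (if j = b then 1 else 0))
     + Q * (c i * ((if k = b ∧ j = i.rev then dw Q k j else 0) - (if k = i.rev ∧ j = b ∧ j < k then Q - Q⁻¹ else 0)
        + (if i < k then (Q - Q⁻¹) * (if j = k.rev then c k else 0) * (if b = i then c i.rev else 0) else 0))
       - c j.rev * ((if i = j.rev ∧ k = b then dw Q i k else 0) - (if i = b ∧ k = j.rev ∧ k < i then Q - Q⁻¹ else 0)
        + (if b.rev < i then (Q - Q⁻¹) * (if k = i.rev then c i else 0) * (if j = b then c b else 0) else 0))) = 0 := by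
  have d1 : c i * ((if k = b ∧ j = i.rev then dw Q k j else 0) - (if k = i.rev ∧ j = b ∧ j < k then Q - Q⁻¹ else 0)
        + (if i < k then (Q - Q⁻¹) * (if j = k.rev then c k else 0) * (if b = i then c i.rev else 0) else 0)) =
      (if k = b ∧ j = i.rev then c i * dw Q k j else 0) - (if k = i.rev ∧ j = b ∧ i < j.rev then c i * (Q - Q⁻¹) else 0)
        + (if j = k.rev ∧ b = i ∧ i < k then c k * (Q - Q⁻¹) else 0) := by
    have := hc i
    grind
  have d2 : c j.rev * ((if i = j.rev ∧ k = b then dw Q i k else 0) - (if i = b ∧ k = j.rev ∧ k < i then Q - Q⁻¹ else 0)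
        + (if b.rev < i then (Q - Q⁻¹) * (if k = i.rev then c i else 0) * (if j = b then c b else 0) else 0)) =
      (if k = b ∧ j = i.rev then c i * dw Q i k else 0) - (if j = k.rev ∧ b = i ∧ k < i then c k * (Q - Q⁻¹) else 0)
        + (if k = i.rev ∧ j = b ∧ j.rev < i then c i * (Q - Q⁻¹) else 0) := by
    rw [mul_add, mul_sub]
    congr 1
    · congr 1 <;> grind
    · by_cases h1 : j = b
      · subst h1
        have := hc j
        by_cases h2 : k = i.rev
        · simp only [h2, if_true, true_and]
          split_ifs
          · linear_combination c i * (Q - Q⁻¹) * this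
          · simp
        · simp [h2]
      · simp [h1]
  rw [d1, d2]
  -- The difference of the two `dw` terms supplies the cases i = k and i = j' that the strict
  -- inequalities omit, so that `e4` and `e5` can drop the order conditions.
  have e3 : (if k = b ∧ j = i.rev then c i * dw Q k j else 0) - (if k = b ∧ j = i.rev then c i * dw Q i k else 0)
     = (if j = k.rev ∧ b = i ∧ i = k then c k * (Q - Q⁻¹) else 0) - (if k = i.rev ∧ j = b ∧ i = j.rev then c i * (Q - Q⁻¹) else 0) := by
    simp only [dw]; grind
  have e4 : (if j = k.rev ∧ b = i ∧ i < k then c k * (Q - Q⁻¹) else 0) + (if j = k.rev ∧ b = i ∧ k < i then c k * (Q - Q⁻¹) else 0)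
    + (if j = k.rev ∧ b = i ∧ i = k then c k * (Q - Q⁻¹) else 0) = (if j = k.rev ∧ b = i then c k * (Q - Q⁻¹) else 0) := by grind
  have e5 : (if k = i.rev ∧ j = b ∧ i < j.rev then c i * (Q - Q⁻¹) else 0) + (if k = i.rev ∧ j = b ∧ j.rev < i then c i * (Q - Q⁻¹) else 0)
    + (if k = i.rev ∧ j = b ∧ i = j.rev then c i * (Q - Q⁻¹) else 0) = (if k = i.rev ∧ j = b then c i * (Q - Q⁻¹) else 0) := by grind
  have e6 : Q * (if j = k.rev ∧ b = i then c k * (Q - Q⁻¹) else 0) = (Q ^ 2 - 1) * ((if j = k.rev then c k else 0) * (if i = b then 1 else 0)) := by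
    by_cases h1 : j = k.rev <;> by_cases h2 : b = i <;> simp [h1, h2, eq_comm] <;> (try field) <;> grind
  have e7 : Q * (if k = i.rev ∧ j = b then c i * (Q - Q⁻¹) else 0) = (Q ^ 2 - 1) * ((if k = i.rev then c i else 0) * (if j = b then 1 else 0)) := by
    by_cases h1 : k = i.rev <;> by_cases h2 : j = b <;> simp [h1, h2] <;> field
  linear_combination Q * e3 + Q * e4 - Q * e5 + e6 - e7
theorem metric_braid_coeff (i k j b : Fin m) :
    (1 - ((q : ℝ) : ℂ) ^ 2) * (metric m q k j * (if i = b then 1 else 0) - metric m q i k * (if j = b then 1 else 0))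
     + ((q : ℝ) : ℂ) * (metricCoeff q i * RhatInv m q (k, j) (i.rev, b)
       - metricCoeff q j.rev * RhatInv m q (i, k) (b, j.rev)) = 0 := by
  simp only [RhatInv, Matrix.of_apply, metric_apply, Fin.rev_rev, Fin.rev_inj]
  exact metric_braid_aux ((q : ℝ) : ℂ) (Q_ne q) (metricCoeff q) (cc_mul q) i k j b

theorem braid_metric (i k j : Fin m) :
    (1 - ((q : ℝ) : ℂ) ^ 2) • (metric m q k j • gen q i - metric m q i k • gen q j)
     + (braid q k j (fun a b => metric m q i a • gen q b) - braid q i k (fun b l => metric m q l j • gen q b)) = 0 := by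
  have h : ∑ b, ((1 - ((q : ℝ) : ℂ) ^ 2) * (metric m q k j * (if i = b then 1 else 0)
      - metric m q i k * (if j = b then 1 else 0))
     + ((q : ℝ) : ℂ) * (metricCoeff q i * RhatInv m q (k, j) (i.rev, b)
       - metricCoeff q j.rev * RhatInv m q (i, k) (b, j.rev))) • gen q b = 0 := by
    simp only [metric_braid_coeff, zero_smul, Finset.sum_const_zero]
  have h1 : braid q k j (fun a b => metric m q i a • gen q b) =
      ∑ b, (((q : ℝ) : ℂ) * (metricCoeff q i * RhatInv m q (k, j) (i.rev, b))) • gen q b := by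
    rw [braid, Finset.sum_eq_single i.rev]
    · rw [Finset.smul_sum]
      refine Finset.sum_congr rfl fun b _ => ?_
      rw [metric_apply, if_pos rfl, smul_smul, smul_smul, Rhat_inv, mul_comm (metricCoeff q i), mul_assoc]
    · intro a _ ha
      simp [metric_apply, ha]
    · simp
  have h2 : braid q i k (fun b l => metric m q l j • gen q b) =
      ∑ b, (((q : ℝ) : ℂ) * (metricCoeff q j.rev * RhatInv m q (i, k) (b, j.rev))) • gen q b := by
    rw [braid, Finset.sum_comm, Finset.sum_eq_single j.rev]
    · rw [Finset.smul_sum]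
      refine Finset.sum_congr rfl fun b _ => ?_
      rw [metric_apply, Fin.rev_rev, if_pos rfl, smul_smul, smul_smul, Rhat_inv, mul_comm (metricCoeff q j.rev), mul_assoc]
    · intro a _ ha
      have ha' : ¬ j = a.rev := by grind
      simp [metric_apply, ha']
    · simp
  have h3 : ∀ i : Fin m, gen q i = ∑ b, (if i = b then (1 : ℂ) else 0) • gen q b := by
    intro i; simp
  rw [← h, h1, h2, h3 i, h3 j]
  simp only [Finset.smul_sum, ← Finset.sum_sub_distrib, ← Finset.sum_add_distrib]
  refine Finset.sum_congr rfl fun b _ => ?_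
  module

/-- This is what remains of `partialD_mul_gen_sub` for x^k f after ∂^i has been moved past x^k.
Induction on the last letter of f: the braidings at the two ends of the word commute, and the x²
terms from `braid_gen_gen` match because x² is central. The base case is `braid_metric`. -/
theorem rightD_gen_mul_gen_mul (i k j : Fin m) (f : Poly m q) :
    rightD q j (gen q i * (gen q k * f)) - ((q : ℝ) : ℂ) ^ 2 • (gen q i * rightD q j (gen q k * f))
      - braid q i k (fun b l => gen q b * rightD q j (gen q l * f))
      + ((q : ℝ) : ℂ) ^ 2 • braid q i k (fun b l => gen q b * (gen q l * rightD q j f))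
      = ((1 - ((q : ℝ) : ℂ) ^ 2) * metric m q i k) • (f * gen q j) := by
  induction f using poly_induction_right generalizing j with
  | h0 =>
    simp only [mul_one, one_mul, rightD_one, mul_zero, rightD_mul_gen, rightD_gen, mul_smul_comm,
      smul_mul_assoc, braid_zero, smul_zero, add_zero]
    have h := braid_metric q i k j
    linear_combination (norm := module) h
  | h1 n f hf =>
    have e : ∀ g : Poly m q, g * (f * gen q n) = g * f * gen q n := fun g => (mul_assoc _ _ _).symm
    have e' : ∀ (g : Poly m q) (i : Fin m), g * f * gen q i = g * (f * gen q i) := fun g i => mul_assoc _ _ _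
    have A1 : ∀ l, rightD q j (gen q l * (f * gen q n)) = metric m q n j • (gen q l * f)
        + braid q n j (fun c d => rightD q c (gen q l * f) * gen q d) := fun l => by
      rw [e, rightD_mul_gen]
    have A2 : rightD q j (gen q i * (gen q k * (f * gen q n))) = metric m q n j • (gen q i * (gen q k * f))
        + braid q n j (fun c d => rightD q c (gen q i * (gen q k * f)) * gen q d) := by
      rw [← rightD_mul_gen]; simp only [mul_assoc]
    have C1 : braid q i k (fun b l => gen q b * rightD q j (gen q l * (f * gen q n))) =
        metric m q n j • braid q i k (fun b l => gen q b * (gen q l * f))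
        + braid q n j (fun c d => braid q i k (fun b l => gen q b * (rightD q c (gen q l * f) * gen q d))) := by
      rw [← braid_braid]
      simp only [A1, mul_add, braid_add, mul_braid, mul_smul_comm, braid_smul]
    have C2 : braid q i k (fun b l => gen q b * (gen q l * rightD q j (f * gen q n))) =
        metric m q n j • braid q i k (fun b l => gen q b * (gen q l * f))
        + braid q n j (fun c d => braid q i k (fun b l => gen q b * (gen q l * (rightD q c f * gen q d)))) := by
      rw [← braid_braid]
      simp only [rightD_mul_gen, mul_add, braid_add, mul_braid, mul_smul_comm, braid_smul]
    have G : braid q i k (fun b l => gen q b * (gen q l * f)) = braid q i k (fun b l => gen q b * gen q l) * f := by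
      rw [braid_mul]; simp only [mul_assoc]
    -- The induction hypothesis for every right derivative c, multiplied by x^d and braided at (n,
    -- j).
    have B : braid q n j (fun c d => _) = braid q n j (fun c d => _) :=
      congrArg (braid q n j) (funext fun c => funext fun d => congrArg (fun y => y * gen q d) (hf c))
    have G' : braid q n j (fun c d => f * (gen q c * gen q d)) = f * braid q n j (fun b l => gen q b * gen q l) := by
      rw [mul_braid]
    simp only [sub_mul, add_mul, braid_sub, braid_add, smul_mul_assoc, braid_smul, mul_assoc, G', braid_mul] at B
    rw [A2, A1, C1, C2, G]
    simp only [braid_gen_gen, add_mul, mul_add, smul_mul_assoc, mul_smul_comm, mul_assoc,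
      (commute_normSq q f).eq, mul_braid] at B ⊢
    linear_combination (norm := module) B
  | h2 f g hf hg =>
    simp only [mul_add, map_add, add_mul, braid_add, smul_add]
    rw [← hf, ← hg]; abel
  | h3 c f hf =>
    simp only [mul_smul_comm, map_smul, smul_mul_assoc, braid_smul]
    have h := hf j
    linear_combination (norm := module) c • h

/-- The consistency condition for computing Δ(x^i f x^j) in two ways, with `laplacian_gen_mul` on
the left and the intended `laplacian_mul_gen` on the right. -/
theorem partialD_mul_gen_sub (i j : Fin m) (f : Poly m q) :
    partialD q i (f * gen q j) - ((q : ℝ) : ℂ) ^ 2 • (partialD q i f * gen q j) =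
      rightD q j (gen q i * f) - ((q : ℝ) : ℂ) ^ 2 • (gen q i * rightD q j f) := by
  induction f using poly_induction generalizing i with
  | h0 =>
    simp only [one_mul, mul_one, partialD_one, rightD_one, zero_mul, mul_zero, smul_zero, sub_zero, rightD_gen]
    have h := partialD_gen_mul_braid q i j 1
    rw [mul_one] at h
    simp only [partialD_one, mul_zero, braid_zero, add_zero] at h
    rw [h]
  | h1 k f hf =>
    have hZ := rightD_gen_mul_gen_mul q i k j f
    have hf' : ∀ l, partialD q l (f * gen q j) = ((q : ℝ) : ℂ) ^ 2 • (partialD q l f * gen q j) +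
      (rightD q j (gen q l * f) - ((q : ℝ) : ℂ) ^ 2 • (gen q l * rightD q j f)) := fun l => by
      rw [← hf l]; abel
    rw [mul_assoc]
    simp only [partialD_gen_mul_braid, hf', mul_add, mul_sub, braid_add, braid_sub, mul_smul_comm, braid_smul,
      add_mul, braid_mul, smul_add, mul_assoc, smul_mul_assoc]
    linear_combination (norm := module) (-1 : ℂ) • hZ
  | h2 f g hf hg =>
    simp only [mul_add, map_add, add_mul, smul_add]
    linear_combination (norm := module) hf i + hg i
  | h3 c f hf =>
    simp only [mul_smul_comm, map_smul, smul_mul_assoc]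
    linear_combination (norm := module) c • hf i

/-- Δ is built from left derivatives, so its behaviour on the right is not automatic. With this rule
Δ treats both ends of a word alike, and `laplacian_flip` follows. -/
theorem laplacian_mul_gen (j : Fin m) (f : Poly m q) :
    laplacian m q (f * gen q j) = ((q : ℝ) : ℂ) ^ 2 • (laplacian m q f * gen q j)
      + ((mu m q : ℝ) : ℂ) • rightD q j f := by
  have h1 : laplacian m q 1 = 0 := by simp [laplacian_apply, partialD_one]
  induction f using poly_induction with
  | h0 =>
    have h := laplacian_gen_mul q j 1
    rw [mul_one] at h
    rw [one_mul, h, h1, rightD_one, partialD_one]; simp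
  | h1 k f hf =>
    rw [mul_assoc, laplacian_gen_mul, laplacian_gen_mul, hf]
    have h := partialD_mul_gen_sub q k j f
    simp only [mul_add, add_mul, smul_add, mul_smul_comm, smul_mul_assoc, mul_assoc]
    linear_combination (norm := module) ((mu m q : ℝ) : ℂ) • h
  | h2 f g hf hg =>
    simp only [map_add, add_mul, smul_add, hf, hg]; abel
  | h3 c f hf =>
    simp only [map_smul, smul_mul_assoc, hf]; module

theorem laplacian_flip (f : Poly m q) : laplacian m q (flip m q f) = flip m q (laplacian m q f) := by
  induction f using poly_induction with
  | h0 =>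
    have h1 : laplacian m q 1 = 0 := by simp [laplacian_apply, partialD_one]
    rw [flip_one, h1, map_zero]
  | h1 k f hf =>
    rw [flip_mul, flip_gen, laplacian_mul_gen, hf, laplacian_gen_mul, map_add, map_smul, map_smul, flip_mul,
      flip_gen, rightD_apply, Fin.rev_rev, flip_flip]
  | h2 f g hf hg => simp only [map_add, hf, hg]
  | h3 c f hf => simp only [map_smul, hf]

/-! ### The bilinear form and its symmetry. -/

/-- The pairing `⟨a, b⟩ = (a(∂) b)(0)`. -/
noncomputable def pairing (m : ℕ) (q : Set.Ioo (0 : ℝ) 1) : Poly m q →ₗ[ℂ] Poly m q →ₗ[ℂ] ℂ :=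
  LinearMap.mk₂ ℂ (fun a b => constTerm m q (partialAlg m q a b))
    (by intros; simp) (by intros; simp) (by intros; simp) (by intros; simp)

theorem pairing_apply (a b : Poly m q) : pairing m q a b = constTerm m q (partialAlg m q a b) := rfl

theorem pairing_mul (a b f : Poly m q) : pairing m q (a * b) f = pairing m q a (partialAlg m q b f) := by
  rw [pairing_apply, pairing_apply, map_mul, Module.End.mul_apply]

theorem pairing_mul_gen (a f : Poly m q) (i : Fin m) :
    pairing m q (a * gen q i) f = pairing m q a (partialD q i f) := by
  rw [pairing_mul, partialAlg_gen]

theorem pairing_one_left (f : Poly m q) : pairing m q 1 f = constTerm m q f := by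
  rw [pairing_apply, map_one, Module.End.one_apply]

theorem pairing_one_right (a : Poly m q) : pairing m q a 1 = constTerm m q a := by
  induction a using poly_induction_right with
  | h0 => rw [pairing_one_left]
  | h1 j f hf => rw [pairing_mul_gen, partialD_one, map_zero, map_mul, constTerm_gen, mul_zero]
  | h2 f g hf hg => rw [map_add, map_add, LinearMap.add_apply, hf, hg]
  | h3 c f hf => rw [map_smul, map_smul, LinearMap.smul_apply, hf]

/-- Passing from a to a x^j, the braid that arises from moving ∂^j past x^i is the one that arises
from differentiating a x^j from the right, so adjointness is inherited. -/
theorem pairing_gen_mul (a b : Poly m q) (i : Fin m) :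
    pairing m q a (gen q i * b) = pairing m q (rightD q i a) b := by
  induction a using poly_induction_right generalizing b i with
  | h0 => rw [pairing_one_left, map_mul, constTerm_gen, zero_mul, rightD_one, map_zero, LinearMap.zero_apply]
  | h1 j a ha =>
    rw [pairing_mul_gen, partialD_gen_mul_braid, rightD_mul_gen, map_add, map_add, map_smul, map_smul,
      LinearMap.add_apply, LinearMap.smul_apply, map_braid, map_braid]
    congr 1
    have e : ∀ F : Fin m → Fin m → Poly m q →ₗ[ℂ] ℂ, (braid q j i F) b = braid q j i (fun c d => F c d b) :=
      fun F => map_braid q j i (LinearMap.applyₗ b) F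
    rw [e]
    simp only [ha, pairing_mul_gen]
  | h2 f g hf hg => simp only [map_add, LinearMap.add_apply, hf, hg]
  | h3 c f hf => simp only [map_smul, LinearMap.smul_apply, hf]

/-- Induction on the first letter x^j of b: on the left it is removed by `rightD j` acting on a; on
the right it has become a last letter, removed by ∂^{j'} acting on `flip a`. These agree by the
definition of `rightD`. -/
theorem pairing_flip (a b : Poly m q) : pairing m q a b = pairing m q (flip m q b) (flip m q a) := by
  induction b using poly_induction generalizing a with
  | h0 => rw [pairing_one_right, flip_one, pairing_one_left, constTerm_flip]
  | h1 j b hb =>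
    rw [pairing_gen_mul, hb, flip_mul, flip_gen, pairing_mul_gen, rightD_apply, flip_flip]
  | h2 f g hf hg => simp only [map_add, LinearMap.add_apply, hf, hg]
  | h3 c f hf => simp only [map_smul, LinearMap.smul_apply, hf]

end Flip

/-! ### Homogeneous polynomials as spans of words. -/

section Grading
variable {m : ℕ} (q : Set.Ioo (0 : ℝ) 1)

/-- The span of the words of length `n` in the generators. -/
noncomputable def words (m : ℕ) (q : Set.Ioo (0 : ℝ) 1) : ℕ → Submodule ℂ (Poly m q)
  | 0 => Submodule.span ℂ {1}
  | n + 1 => ⨆ j, (words m q n).map (LinearMap.mulLeft ℂ (gen q j))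

theorem one_mem_words : (1 : Poly m q) ∈ words m q 0 := Submodule.mem_span_singleton_self 1

theorem gen_mul_mem_words (n : ℕ) (j : Fin m) (f : Poly m q) (hf : f ∈ words m q n) :
    gen q j * f ∈ words m q (n + 1) := by
  rw [words]
  exact Submodule.mem_iSup_of_mem j (Submodule.mem_map_of_mem hf)

theorem words_induction {P : ℕ → Poly m q → Prop} (h0 : P 0 1)
    (h1 : ∀ n j f, f ∈ words m q n → P n f → P (n + 1) (gen q j * f))
    (h2 : ∀ n f g, P n f → P n g → P n (f + g))
    (h3 : ∀ n (c : ℂ) f, P n f → P n (c • f)) (hz : ∀ n, P n 0) (n : ℕ) :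
    ∀ f ∈ words m q n, P n f := by
  induction n with
  | zero =>
    intro f hf
    rw [words, Submodule.mem_span_singleton] at hf
    obtain ⟨c, rfl⟩ := hf
    exact h3 _ _ _ h0
  | succ n ih =>
    intro f hf
    rw [words] at hf
    induction hf using Submodule.iSup_induction' with
    | mem j x hx =>
      obtain ⟨y, hy, rfl⟩ := hx
      exact h1 n j y hy (ih y hy)
    | zero => exact hz _
    | add x y _ _ hx hy => exact h2 _ _ _ hx hy

instance finiteDimensional_words (n : ℕ) : FiniteDimensional ℂ (words m q n) := by
  induction n with
  | zero => rw [words]; infer_instance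
  | succ n ih => rw [words]; infer_instance

theorem euler_one : euler m q 1 = 1 := by
  simp [euler_apply, radial, laplacian_apply, partialD_one]

theorem words_le_homogeneous (n : ℕ) : words m q n ≤ homogeneous m q n := by
  intro f hf
  rw [homogeneous, Module.End.mem_eigenspace_iff]
  refine words_induction q (P := fun n f => euler m q f = ((q : ℝ) : ℂ) ^ (2 * n) • f) ?_ ?_ ?_ ?_ ?_ n f hf
  · simp [euler_one]
  · intro n j f _ hf
    rw [euler_gen_mul, hf, mul_smul_comm, smul_smul]
    congr 1; ring
  · intro n f g hf hg; rw [map_add, hf, hg, smul_add]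
  · intro n c f hf; rw [map_smul, hf, smul_comm]
  · simp

theorem iSup_words : ⨆ n, words m q n = ⊤ := by
  rw [eq_top_iff]
  rintro f -
  induction f using poly_induction with
  | h0 => exact Submodule.mem_iSup_of_mem 0 (one_mem_words q)
  | h1 j f hf =>
    induction hf using Submodule.iSup_induction' with
    | mem n x hx => exact Submodule.mem_iSup_of_mem (n + 1) (gen_mul_mem_words q n j x hx)
    | zero => rw [mul_zero]; exact zero_mem _
    | add x y _ _ hx hy => rw [mul_add]; exact add_mem hx hy
  | h2 f g hf hg => exact add_mem hf hg
  | h3 c f hf => exact Submodule.smul_mem _ c hf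

theorem Q_pow_injective : Function.Injective (fun n : ℕ => ((q : ℝ) : ℂ) ^ (2 * n)) := by
  intro a b h
  have h' : (q : ℝ) ^ (2 * a) = (q : ℝ) ^ (2 * b) := by
    simp only at h
    exact_mod_cast h
  have := pow_right_injective₀ q.2.1 q.2.2.ne h'
  omega

/-- Words of length n are eigenvectors for q^{2n}, these eigenvalues are distinct because 0 < q < 1,
and all words together span 𝒫. Thus an eigenspace has no room for anything else, and the spectral
definition becomes one that allows induction on letters. -/
theorem homogeneous_eq_words (n : ℕ) : homogeneous m q n = words m q n := by
  refine le_antisymm (fun f hf => ?_) (words_le_homogeneous q n)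
  have hind : iSupIndep (homogeneous m q) :=
    (Module.End.eigenspaces_iSupIndep (euler m q)).comp (Q_pow_injective q)
  have hle : (⊤ : Submodule ℂ (Poly m q)) ≤ words m q n ⊔ ⨆ j, ⨆ (_ : j ≠ n), homogeneous m q j := by
    rw [← iSup_words]
    refine iSup_le fun j => ?_
    by_cases hj : j = n
    · subst hj; exact le_sup_left
    · exact (words_le_homogeneous q j).trans ((le_iSup₂_of_le (f := fun j (_ : j ≠ n) => homogeneous m q j) j hj le_rfl).trans le_sup_right)
  obtain ⟨g, hg, h, hh, e⟩ := Submodule.mem_sup.1 (hle (Submodule.mem_top (x := f)))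
  -- h = f − g has degree n, yet it is a sum of elements of other degrees.
  have h0 : h = 0 := by
    refine (Submodule.disjoint_def.1 (hind n)) h ?_ hh
    have : h = f - g := by rw [← e]; abel
    rw [this]
    exact sub_mem hf (words_le_homogeneous q n hg)
  rw [← e, h0, add_zero]
  exact hg

theorem mul_mem_words (a b : ℕ) (f g : Poly m q) (hf : f ∈ words m q a) (hg : g ∈ words m q b) :
    f * g ∈ words m q (a + b) := by
  refine words_induction q (P := fun a f => f * g ∈ words m q (a + b)) ?_ ?_ ?_ ?_ ?_ a f hf
  · rwa [one_mul, zero_add]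
  · intro n j f _ hf
    rw [mul_assoc, add_right_comm]
    exact gen_mul_mem_words q _ j _ hf
  · intro n f g hf hg; rw [add_mul]; exact add_mem hf hg
  · intro n c f hf; rw [smul_mul_assoc]; exact Submodule.smul_mem _ c hf
  · simp

theorem gen_mem_words (j : Fin m) : gen q j ∈ words m q 1 := by
  rw [← mul_one (gen q j)]
  exact gen_mul_mem_words q 0 j 1 (one_mem_words q)

theorem normSq_mem_words : normSq m q ∈ words m q 2 := by
  rw [normSq_eq, sqSum]
  exact sum_mem fun j _ => Submodule.smul_mem _ _ (gen_mul_mem_words q 1 _ _ (gen_mem_words q _))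

theorem normSq_pow_mem_words (n : ℕ) : normSq m q ^ n ∈ words m q (2 * n) := by
  induction n with
  | zero => rw [pow_zero]; exact one_mem_words q
  | succ n ih => rw [pow_succ]; exact mul_mem_words q (2 * n) 2 _ _ ih (normSq_mem_words q)

theorem flip_mem_words (n : ℕ) (f : Poly m q) (hf : f ∈ words m q n) : flip m q f ∈ words m q n := by
  refine words_induction q (P := fun n f => flip m q f ∈ words m q n) ?_ ?_ ?_ ?_ ?_ n f hf
  · rw [flip_one]; exact one_mem_words q
  · intro n j f _ hf
    rw [flip_mul, flip_gen]
    exact mul_mem_words q n 1 _ _ hf (gen_mem_words q _)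
  · intro n f g hf hg; rw [map_add]; exact add_mem hf hg
  · intro n c f hf; rw [map_smul]; exact Submodule.smul_mem _ c hf
  · simp

theorem partialD_words_zero (f : Poly m q) (hf : f ∈ words m q 0) (i : Fin m) : partialD q i f = 0 := by
  rw [words, Submodule.mem_span_singleton] at hf
  obtain ⟨c, rfl⟩ := hf
  rw [map_smul, partialD_one, smul_zero]

theorem partialD_mem_words (n : ℕ) (f : Poly m q) (hf : f ∈ words m q (n + 1)) (i : Fin m) :
    partialD q i f ∈ words m q n := by
  have key := words_induction q (P := fun k f => ∀ i, (k = 0 → partialD q i f = 0) ∧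
    (∀ n, k = n + 1 → partialD q i f ∈ words m q n)) ?_ ?_ ?_ ?_ ?_ (n + 1) f hf i
  · exact key.2 n rfl
  · intro i; rw [partialD_one]; exact ⟨fun _ => rfl, fun _ _ => zero_mem _⟩
  · intro k j f hfk hf i
    refine ⟨fun h => by omega, fun n hn => ?_⟩
    obtain rfl : k = n := by omega
    rw [partialD_gen_mul]
    refine add_mem (Submodule.smul_mem _ _ hfk) (Submodule.smul_mem _ _ ?_)
    refine sum_mem fun a _ => sum_mem fun b _ => Submodule.smul_mem _ _ ?_
    rcases k with _ | k
    · rw [(hf b).1 rfl, mul_zero]; exact zero_mem _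
    · exact gen_mul_mem_words q k a _ ((hf b).2 k rfl)
  · intro k f g hf hg i
    rw [map_add]
    exact ⟨fun h => by rw [(hf i).1 h, (hg i).1 h, add_zero],
      fun k hk => add_mem ((hf i).2 k hk) ((hg i).2 k hk)⟩
  · intro n c f hf i
    rw [map_smul]
    exact ⟨fun h => by rw [(hf i).1 h, smul_zero], fun k hk => Submodule.smul_mem _ c ((hf i).2 k hk)⟩
  · simp

theorem laplacian_mem_words (n : ℕ) (f : Poly m q) (hf : f ∈ words m q (n + 2)) :
    laplacian m q f ∈ words m q n := by
  rw [laplacian_apply]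
  exact sum_mem fun j _ => Submodule.smul_mem _ _
    (partialD_mem_words q n _ (partialD_mem_words q (n + 1) f hf _) _)

theorem laplacian_words_one (f : Poly m q) (hf : f ∈ words m q 1) : laplacian m q f = 0 := by
  rw [laplacian_apply]
  refine Finset.sum_eq_zero fun j _ => ?_
  rw [partialD_words_zero q _ (partialD_mem_words q 0 f hf _), smul_zero]

theorem laplacian_words_zero (f : Poly m q) (hf : f ∈ words m q 0) : laplacian m q f = 0 := by
  rw [laplacian_apply]
  refine Finset.sum_eq_zero fun j _ => ?_
  rw [partialD_words_zero q _ hf, map_zero, smul_zero]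

theorem constTerm_words_succ (n : ℕ) (f : Poly m q) (hf : f ∈ words m q (n + 1)) : constTerm m q f = 0 := by
  refine words_induction q (P := fun k f => 1 ≤ k → constTerm m q f = 0) ?_ ?_ ?_ ?_ ?_ (n + 1) f hf (by omega)
  · intro h; omega
  · intro k j f _ _ _; rw [map_mul, constTerm_gen, zero_mul]
  · intro k f g hf hg h; rw [map_add, hf h, hg h, add_zero]
  · intro k c f hf h; rw [map_smul, hf h, smul_zero]
  · simp

/-- Δ shortens words by two letters, so after k steps only words of length 2k have reached the
constants. -/
theorem constTerm_laplacian_pow (k : ℕ) : ∀ (n : ℕ) (f : Poly m q), f ∈ words m q n → n ≠ 2 * k →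
    constTerm m q ((laplacian m q ^ k) f) = 0 := by
  induction k with
  | zero =>
    intro n f hf hn
    obtain ⟨n, rfl⟩ : ∃ j, n = j + 1 := ⟨n - 1, by omega⟩
    rw [pow_zero, Module.End.one_apply, constTerm_words_succ q n f hf]
  | succ k ih =>
    intro n f hf hn
    rw [pow_succ, Module.End.mul_apply]
    match n, hf, hn with
    | 0, hf, _ => rw [laplacian_words_zero q f hf, map_zero, map_zero]
    | 1, hf, _ => rw [laplacian_words_one q f hf, map_zero, map_zero]
    | n + 2, hf, hn => exact ih n _ (laplacian_mem_words q n f hf) (by omega)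

theorem constTerm_laplacian_pow_eq (k : ℕ) (f : Poly m q) :
    constTerm m q ((laplacian m q ^ k) f) = pairing m q (normSq m q ^ k) f := by
  rw [pairing_apply, map_pow, partialAlg_normSq]

theorem sphereIntegral_words_even (s : ℕ) (f : Poly m q) (hf : f ∈ words m q (2 * s)) :
    sphereIntegral m q f = ((pizzettiCoeff m q s : ℝ) : ℂ) * pairing m q (normSq m q ^ s) f := by
  show ∑ᶠ k : ℕ, _ = _
  rw [finsum_eq_single _ s, constTerm_laplacian_pow_eq]
  intro k hk
  rw [constTerm_laplacian_pow q k (2 * s) f hf (by omega), mul_zero]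

theorem sphereIntegral_words_odd (n : ℕ) (hn : ¬ Even n) (f : Poly m q) (hf : f ∈ words m q n) :
    sphereIntegral m q f = 0 := by
  show ∑ᶠ k : ℕ, _ = _
  rw [finsum_eq_zero_of_forall_eq_zero]
  intro k
  rw [constTerm_laplacian_pow q k n f hf (by rintro rfl; exact hn (even_two_mul k)), mul_zero]

/-! ### Harmonic operators S(∂) acting on powers of x². -/

/-- The `q²`-integer `[n]_{q²}`. -/
noncomputable def qint (q : Set.Ioo (0 : ℝ) 1) (n : ℕ) : ℂ := (((q : ℝ) : ℂ) ^ (2 * n) - 1) / (((q : ℝ) : ℂ) ^ 2 - 1)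

theorem Q_pow_sub_ne (n : ℕ) : ((q : ℝ) : ℂ) ^ (2 * (n + 1)) - 1 ≠ 0 := by
  have h := (Q_pow_injective q).ne (Nat.succ_ne_zero n)
  simpa [sub_eq_zero] using h

theorem Q_sq_sub_ne : ((q : ℝ) : ℂ) ^ 2 - 1 ≠ 0 := Q_pow_sub_ne q 0

theorem qint_succ_ne (n : ℕ) : qint q (n + 1) ≠ 0 := div_ne_zero (Q_pow_sub_ne q n) (Q_sq_sub_ne q)

/-- The q-analogue of Euler's identity: on the kernel of Δ the operator Λ reduces to its first-order
part. -/
theorem radial_eq (n : ℕ) (f : Poly m q) (hf : f ∈ words m q n) (h : laplacian m q f = 0) :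
    radial m q f = qint q n • f := by
  have h1 := words_le_homogeneous q n hf
  rw [homogeneous, Module.End.mem_eigenspace_iff, euler_apply, h, mul_zero, smul_zero, add_zero] at h1
  have h2 : (((q : ℝ) : ℂ) ^ 2 - 1) • radial m q f = (((q : ℝ) : ℂ) ^ (2 * n) - 1) • f := by
    linear_combination (norm := module) h1
  rw [qint, div_eq_inv_mul, mul_smul, ← h2, smul_smul, inv_mul_cancel₀ (Q_sq_sub_ne q), one_smul]

theorem partialD_normSq_pow_mul (t : ℕ) (a : Fin m) (f : Poly m q) :
    partialD q a (normSq m q ^ (t + 1) * f) =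
      (((mu m q : ℝ) : ℂ) * qint q (t + 1)) • (normSq m q ^ t * (gen q a * f))
      + ((q : ℝ) : ℂ) ^ (2 * (t + 1)) • (normSq m q ^ (t + 1) * partialD q a f) := by
  induction t with
  | zero =>
    have e : qint q 1 = 1 := div_self (Q_sq_sub_ne q)
    simp [partialD_normSq_mul, e]
  | succ t ih =>
    have hq : qint q (t + 1 + 1) = 1 + ((q : ℝ) : ℂ) ^ 2 * qint q (t + 1) := by
      have := Q_sq_sub_ne q
      rw [qint, qint]; field_simp; ring
    have hc : gen q a * (normSq m q ^ (t + 1) * f) = normSq m q ^ (t + 1) * (gen q a * f) := by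
      rw [← mul_assoc, ((commute_gen_normSq q a).pow_right _).eq, mul_assoc]
    rw [pow_succ' _ (t + 1), mul_assoc, partialD_normSq_mul, ih, hc, hq, mul_add, mul_smul_comm, mul_smul_comm,
      ← mul_assoc (normSq m q), ← pow_succ', ← mul_assoc (normSq m q), ← pow_succ']
    simp only [← mul_assoc]
    module

/-- Euler's identity with ∂ substituted for x. It expresses S(∂) through operators of one degree
less. -/
theorem radial_eq_sum_partialAlg (k : ℕ) (S : Poly m q) (hS : S ∈ words m q k) (h : laplacian m q S = 0)
    (f : Poly m q) : qint q k • partialAlg m q S f =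
      ∑ i, metricCoeff q i • partialD q i (partialAlg m q (partialD q i.rev S) f) := by
  rw [← LinearMap.smul_apply, ← map_smul, ← radial_eq q k S hS h, radial, map_sum, LinearMap.sum_apply]
  simp only [map_smul, map_mul, partialAlg_gen, LinearMap.smul_apply, Module.End.mul_apply]

/-- The coefficient in `S(∂) x^{2(k+t)} = hobson k t • x^{2t} S` for `S` harmonic of degree `k`. -/
noncomputable def hobson (m : ℕ) (q : Set.Ioo (0 : ℝ) 1) (k t : ℕ) : ℂ :=
  ∏ i ∈ Finset.range k, (((mu m q : ℝ) : ℂ) * qint q (t + i + 1))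

theorem hobson_succ (k t : ℕ) :
    hobson m q (k + 1) t = hobson m q k (t + 1) * (((mu m q : ℝ) : ℂ) * qint q (t + 1)) := by
  rw [hobson, Finset.prod_range_succ', hobson]
  congr 1
  refine Finset.prod_congr rfl fun i _ => ?_
  rw [show t + (i + 1) + 1 = t + 1 + i + 1 by ring]

/-- Induction on k through `radial_eq_sum_partialAlg`, since each ∂^{i'} S is again harmonic. When
∂^i is applied to x^{2(t+1)} ∂^{i'} S, the terms with second derivatives of S sum to a multiple of
ΔS = 0. The others sum to x^{2t} times the Euler operator on S, which returns the q-integer by which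
the recursion was multiplied. -/
theorem partialAlg_harmonic_normSq_pow (k : ℕ) : ∀ S ∈ words m q k, laplacian m q S = 0 →
    (∀ s < k, partialAlg m q S (normSq m q ^ s) = 0) ∧
    (∀ t, partialAlg m q S (normSq m q ^ (k + t)) = hobson m q k t • (normSq m q ^ t * S)) := by
  induction k with
  | zero =>
    intro S hS _
    refine ⟨fun s hs => by omega, fun t => ?_⟩
    rw [words, Submodule.mem_span_singleton] at hS
    obtain ⟨c, rfl⟩ := hS
    simp [hobson]
  | succ k ih =>
    intro S hS h
    have ih' := fun j => ih (partialD q j S) (partialD_mem_words q k S hS j)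
      (by rw [← partialD_laplacian, h, map_zero])
    have hr := radial_eq_sum_partialAlg q (k + 1) S hS h
    have hn := qint_succ_ne q k
    constructor
    · intro s hs
      rw [← smul_eq_zero_iff_right hn, hr]
      rcases Nat.lt_succ_iff_lt_or_eq.1 hs with hs | rfl
      · simp only [(ih' _).1 s hs, map_zero, smul_zero, Finset.sum_const_zero]
      -- At the borderline power the derivatives of S reappear with t = 0, and their sum is a
      -- multiple of ΔS.
      · have e := fun j => (ih' j).2 0
        simp only [add_zero, pow_zero, one_mul] at e
        simp only [e, map_smul, smul_comm (metricCoeff q _)]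
        rw [← Finset.smul_sum, ← laplacian_apply, h, smul_zero]
    · intro t
      have e := fun j => (ih' j).2 (t + 1)
      have hrad := radial_eq q (k + 1) S hS h
      rw [← smul_right_inj hn, hr, show k + 1 + t = k + (t + 1) by ring]
      simp only [e, map_smul, partialD_normSq_pow_mul, smul_add, Finset.sum_add_distrib, hobson_succ]
      have e1 : ∑ i, metricCoeff q i • hobson m q k (t + 1) • (((mu m q : ℝ) : ℂ) * qint q (t + 1)) •
          (normSq m q ^ t * (gen q i * partialD q i.rev S)) =
          (hobson m q k (t + 1) * (((mu m q : ℝ) : ℂ) * qint q (t + 1))) • (normSq m q ^ t * radial m q S) := by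
        rw [radial, Finset.mul_sum, Finset.smul_sum]
        refine Finset.sum_congr rfl fun i _ => ?_
        rw [mul_smul_comm]; module
      have e2 : ∑ i, metricCoeff q i • hobson m q k (t + 1) • ((q : ℝ) : ℂ) ^ (2 * (t + 1)) •
          (normSq m q ^ (t + 1) * partialD q i (partialD q i.rev S)) =
          (hobson m q k (t + 1) * ((q : ℝ) : ℂ) ^ (2 * (t + 1))) • (normSq m q ^ (t + 1) * laplacian m q S) := by
        rw [laplacian_apply, Finset.mul_sum, Finset.smul_sum]
        refine Finset.sum_congr rfl fun i _ => ?_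
        rw [mul_smul_comm]; module
      rw [e1, e2, h, hrad, mul_zero, smul_zero, add_zero, mul_smul_comm, smul_comm]

theorem flip_normSq_pow (s : ℕ) : flip m q (normSq m q ^ s) = normSq m q ^ s := by
  induction s with
  | zero => rw [pow_zero, flip_one]
  | succ s ih => rw [pow_succ, flip_mul, ih, flip_normSq, ← pow_succ', pow_succ]

/-- Transposition reverses S g and moves it to the operator side, where `flip S` is the factor that
acts first on x^{2s}. -/
theorem pairing_normSq_pow_harmonic_mul (s : ℕ) (S g : Poly m q) :
    pairing m q (normSq m q ^ s) (S * g) =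
      pairing m q (flip m q g) (partialAlg m q (flip m q S) (normSq m q ^ s)) := by
  rw [pairing_flip, flip_normSq_pow, flip_mul, pairing_mul]

theorem pairing_normSq_pow_of_lt (k s : ℕ) (hs : s < k) (S : Poly m q) (hS : S ∈ words m q k)
    (h : laplacian m q S = 0) (g : Poly m q) : pairing m q (normSq m q ^ s) (S * g) = 0 := by
  rw [pairing_normSq_pow_harmonic_mul, (partialAlg_harmonic_normSq_pow q k _ (flip_mem_words q k S hS)
    (by rw [laplacian_flip, h, map_zero])).1 s hs, map_zero]

/-- A second transposition brings g back to the right-hand argument and restores the order S x^{2t}.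
-/
theorem pairing_normSq_pow_add (k t : ℕ) (S : Poly m q) (hS : S ∈ words m q k)
    (h : laplacian m q S = 0) (g : Poly m q) : pairing m q (normSq m q ^ (k + t)) (S * g) =
      hobson m q k t * pairing m q (S * normSq m q ^ t) g := by
  rw [pairing_normSq_pow_harmonic_mul, (partialAlg_harmonic_normSq_pow q k _ (flip_mem_words q k S hS)
    (by rw [laplacian_flip, h, map_zero])).2 t, map_smul, smul_eq_mul, pairing_flip, flip_flip, flip_mul,
    flip_flip, flip_normSq_pow]

end Grading

/-- A bilinear form that is nondegenerate on a finite-dimensional subspace admits dual bases. -/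
theorem exists_dual_bases_of_separating {K V : Type*} [Field K] [AddCommGroup V] [Module K V]
    (β : V →ₗ[K] V →ₗ[K] K) (W : Submodule K V) (hW : FiniteDimensional K W)
    (hl : ∀ a ∈ W, (∀ g ∈ W, β a g = 0) → a = 0) (hr : ∀ g ∈ W, (∀ a ∈ W, β a g = 0) → g = 0) :
    ∃ (r : ℕ) (e a : Fin r → V), (∀ i, e i ∈ W) ∧ (∀ i, a i ∈ W) ∧
      (∀ w ∈ W, ∑ i, β (a i) w • e i = w) ∧ (∀ w ∈ W, ∑ i, β w (e i) • a i = w) := by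
  let B : LinearMap.BilinForm K W := β.domRestrict₁₂ W W
  have hB : B.Nondegenerate := by
    constructor
    · intro a h
      exact Subtype.ext (hl a a.2 fun g hg => h ⟨g, hg⟩)
    · intro g h
      exact Subtype.ext (hr g g.2 fun a ha => h ⟨a, ha⟩)
  let e := Module.finBasis K W
  let a := B.dualBasis hB e
  refine ⟨_, fun i => e i, fun i => a i, fun i => (e i).2, fun i => (a i).2, fun w hw => ?_, fun w hw => ?_⟩
  -- Dualising again for the transposed form returns e, so the coordinates along e are the values of
  -- β (a i).
  · have h1 : B.flip.dualBasis hB.flip a = e := LinearMap.BilinForm.dualBasis_flip_dualBasis hB e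
    have h2 := e.sum_repr ⟨w, hw⟩
    have h3 : ∀ i, e.repr ⟨w, hw⟩ i = β (a i) w := by
      intro i
      rw [← h1, LinearMap.BilinForm.dualBasis_repr_apply]
      rfl
    simp only [h3] at h2
    simpa using congrArg Subtype.val h2
  · have h2 := a.sum_repr ⟨w, hw⟩
    have h3 : ∀ i, a.repr ⟨w, hw⟩ i = β w (e i) := by
      intro i
      rw [LinearMap.BilinForm.dualBasis_repr_apply]
      rfl
    simp only [h3] at h2
    simpa using congrArg Subtype.val h2

/-! ### Existence and uniqueness of the powers (x;y)^{(l)}. -/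

section InnerPowers
variable {m : ℕ} (q : Set.Ioo (0 : ℝ) 1)

theorem words_induction_right {P : ℕ → Poly m q → Prop} (h0 : P 0 1)
    (h1 : ∀ n j f, f ∈ words m q n → P n f → P (n + 1) (f * gen q j))
    (h2 : ∀ n f g, P n f → P n g → P n (f + g))
    (h3 : ∀ n (c : ℂ) f, P n f → P n (c • f)) (hz : ∀ n, P n 0) (n : ℕ)
    (f : Poly m q) (hf : f ∈ words m q n) : P n f := by
  rw [← flip_flip q f]
  refine words_induction q (P := fun n f => P n (flip m q f)) ?_ ?_ ?_ ?_ ?_ n _ (flip_mem_words q n f hf)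
  · rwa [flip_one]
  · intro n j f hf h
    rw [flip_mul, flip_gen]
    exact h1 n _ _ (flip_mem_words q n f hf) h
  · intro n f g hf hg; rw [map_add]; exact h2 _ _ _ hf hg
  · intro n c f hf; rw [map_smul]; exact h3 _ _ _ hf
  · intro n; rw [map_zero]; exact hz n

theorem mul_gen_mem_words (n : ℕ) (j : Fin m) (f : Poly m q) (hf : f ∈ words m q n) :
    f * gen q j ∈ words m q (n + 1) := mul_mem_words q n 1 f _ hf (gen_mem_words q j)

/-- If all derivatives vanish then Λ f = f, while degree n + 1 forces Λ f = q^{2(n+1)} f. -/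
theorem eq_zero_of_partialD_eq_zero (n : ℕ) (f : Poly m q) (hf : f ∈ words m q (n + 1))
    (h : ∀ i, partialD q i f = 0) : f = 0 := by
  have h1 := words_le_homogeneous q (n + 1) hf
  rw [homogeneous, Module.End.mem_eigenspace_iff, euler_apply, laplacian_apply, radial] at h1
  simp only [h, map_zero, smul_zero, mul_zero, Finset.sum_const_zero, add_zero] at h1
  have h2 : (((q : ℝ) : ℂ) ^ (2 * (n + 1)) - 1) • f = 0 := by
    linear_combination (norm := module) -h1
  exact (smul_eq_zero.1 h2).resolve_left (Q_pow_sub_ne q n)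

/-- Testing g against a x^j is testing ∂^j g against a, so by induction all derivatives of g vanish.
-/
theorem pairing_separatingRight (n : ℕ) : ∀ g ∈ words m q n,
    (∀ a ∈ words m q n, pairing m q a g = 0) → g = 0 := by
  induction n with
  | zero =>
    intro g hg h
    have h1 := h 1 (one_mem_words q)
    rw [words, Submodule.mem_span_singleton] at hg
    obtain ⟨c, rfl⟩ := hg
    rw [pairing_one_left, map_smul, map_one, smul_eq_mul, mul_one] at h1
    rw [h1, zero_smul]
  | succ n ih =>
    intro g hg h
    refine eq_zero_of_partialD_eq_zero q n g hg fun j => ih _ (partialD_mem_words q n g hg j) fun a ha => ?_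
    rw [← pairing_mul_gen]
    exact h _ (mul_gen_mem_words q n j a ha)

theorem pairing_separatingLeft (n : ℕ) (a : Poly m q) (ha : a ∈ words m q n)
    (h : ∀ g ∈ words m q n, pairing m q a g = 0) : a = 0 := by
  have : flip m q a = 0 := by
    refine pairing_separatingRight q n _ (flip_mem_words q n a ha) fun b hb => ?_
    rw [pairing_flip, flip_flip]
    exact h _ (flip_mem_words q n b hb)
  rw [← flip_flip q a, this, map_zero]

/-- Dual bases of the space of words of length `n` with respect to `pairing`. -/
theorem exists_dual_bases (m : ℕ) (n : ℕ) : ∃ (r : ℕ) (e a : Fin r → Poly m q),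
    (∀ i, e i ∈ words m q n) ∧ (∀ i, a i ∈ words m q n) ∧
    (∀ w ∈ words m q n, ∑ i, pairing m q (a i) w • e i = w) ∧
    (∀ w ∈ words m q n, ∑ i, pairing m q w (e i) • a i = w) :=
  exists_dual_bases_of_separating (pairing m q) (words m q n) (finiteDimensional_words q n)
    (pairing_separatingLeft q n) (pairing_separatingRight q n)

/-- The contraction of the left tensor factor with `a`. -/
noncomputable def contract (a : Poly m q) : Poly m q ⊗[ℂ] Poly m q →ₗ[ℂ] Poly m q :=
  (TensorProduct.lid ℂ (Poly m q)).toLinearMap ∘ₗ (pairing m q a).rTensor (Poly m q)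

theorem contract_tmul (a w p : Poly m q) : contract q a (w ⊗ₜ p) = pairing m q a w • p := by
  simp [contract]

theorem contract_mul_gen (a : Poly m q) (j : Fin m) (T : Poly m q ⊗[ℂ] Poly m q) :
    contract q (a * gen q j) T = contract q a ((partialD q j).rTensor (Poly m q) T) := by
  induction T using TensorProduct.induction_on with
  | zero => simp only [map_zero]
  | tmul w p => rw [LinearMap.rTensor_tmul, contract_tmul, contract_tmul, pairing_mul_gen]
  | add x y hx hy => simp only [map_add, hx, hy]

theorem contract_lTensor (a b : Poly m q) (T : Poly m q ⊗[ℂ] Poly m q) :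
    contract q a ((LinearMap.mulRight ℂ b).lTensor (Poly m q) T) = contract q a T * b := by
  induction T using TensorProduct.induction_on with
  | zero => simp only [map_zero, zero_mul]
  | tmul w p => rw [LinearMap.lTensor_tmul, contract_tmul, contract_tmul, LinearMap.mulRight_apply, smul_mul_assoc]
  | add x y hx hy => simp only [map_add, hx, hy, add_mul]

theorem contract_add (a b : Poly m q) (T : Poly m q ⊗[ℂ] Poly m q) :
    contract q (a + b) T = contract q a T + contract q b T := by
  rw [contract, contract, contract, map_add, LinearMap.rTensor_add]
  simp

theorem contract_smul (c : ℂ) (a : Poly m q) (T : Poly m q ⊗[ℂ] Poly m q) :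
    contract q (c • a) T = c • contract q a T := by
  rw [contract, contract, map_smul, LinearMap.rTensor_smul]
  simp

/-- The tensors whose left factors are words of length `n`. -/
noncomputable def leftWords (m : ℕ) (q : Set.Ioo (0 : ℝ) 1) (n : ℕ) : Submodule ℂ (Poly m q ⊗[ℂ] Poly m q) :=
  LinearMap.range ((words m q n).subtype.rTensor (Poly m q))

theorem tmul_mem_leftWords (n : ℕ) (w p : Poly m q) (hw : w ∈ words m q n) : w ⊗ₜ p ∈ leftWords m q n :=
  ⟨⟨w, hw⟩ ⊗ₜ p, by rw [LinearMap.rTensor_tmul, Submodule.subtype_apply]⟩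

theorem leftWords_induction {n : ℕ} {P : Poly m q ⊗[ℂ] Poly m q → Prop} (h0 : P 0)
    (h1 : ∀ w ∈ words m q n, ∀ p, P (w ⊗ₜ p)) (h2 : ∀ x y, P x → P y → P (x + y))
    (T : Poly m q ⊗[ℂ] Poly m q) (hT : T ∈ leftWords m q n) : P T := by
  obtain ⟨t, rfl⟩ := hT
  induction t using TensorProduct.induction_on with
  | zero => rwa [map_zero]
  | tmul w p => exact h1 w w.2 p
  | add x y hx hy => rw [map_add]; exact h2 _ _ hx hy

/-- Dual bases recover the tensor from its contractions: T is the sum of e_i ⊗ `contract q (a i) T`.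
-/
theorem eq_of_contract_eq (n : ℕ) (T T' : Poly m q ⊗[ℂ] Poly m q) (hT : T ∈ leftWords m q n)
    (hT' : T' ∈ leftWords m q n) (h : ∀ a ∈ words m q n, contract q a T = contract q a T') : T = T' := by
  obtain ⟨r, e, a, he, ha, h1, -⟩ := exists_dual_bases q m n
  have key : ∀ T ∈ leftWords m q n, ∑ i, e i ⊗ₜ[ℂ] contract q (a i) T = T := by
    refine leftWords_induction q ?_ ?_ ?_
    · simp
    · intro w hw p
      simp only [contract_tmul, TensorProduct.tmul_smul]
      simp only [TensorProduct.smul_tmul', ← TensorProduct.sum_tmul, h1 w hw]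
    · intro x y hx hy
      simp only [map_add, TensorProduct.tmul_add, Finset.sum_add_distrib, hx, hy]
  rw [← key T hT, ← key T' hT']
  exact Finset.sum_congr rfl fun i _ => by rw [h _ (ha i)]

theorem rTensor_partialD_mem (n : ℕ) (j : Fin m) (T : Poly m q ⊗[ℂ] Poly m q)
    (hT : T ∈ leftWords m q (n + 1)) : (partialD q j).rTensor (Poly m q) T ∈ leftWords m q n := by
  refine leftWords_induction q (P := fun T => (partialD q j).rTensor (Poly m q) T ∈ leftWords m q n) ?_ ?_ ?_ T hT
  · rw [map_zero]; exact zero_mem _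
  · intro w hw p
    rw [LinearMap.rTensor_tmul]
    exact tmul_mem_leftWords q n _ _ (partialD_mem_words q n w hw j)
  · intro x y hx hy; rw [map_add]; exact add_mem hx hy

theorem lTensor_mem_leftWords (n : ℕ) (g : Poly m q →ₗ[ℂ] Poly m q) (T : Poly m q ⊗[ℂ] Poly m q)
    (hT : T ∈ leftWords m q n) : g.lTensor (Poly m q) T ∈ leftWords m q n := by
  refine leftWords_induction q (P := fun T => g.lTensor (Poly m q) T ∈ leftWords m q n) ?_ ?_ ?_ T hT
  · rw [map_zero]; exact zero_mem _
  · intro w hw p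
    rw [LinearMap.lTensor_tmul]
    exact tmul_mem_leftWords q n _ _ hw
  · intro x y hx hy; rw [map_add]; exact add_mem hx hy

theorem qFactorial_succ (p : ℝ) (l : ℕ) : qFactorial p (l + 1) = qFactorial p l * qNumber p ((l : ℝ) + 1) := by
  rw [qFactorial, Finset.prod_range_succ, qFactorial]

theorem qFactorial_zero (p : ℝ) : qFactorial p 0 = 1 := by rw [qFactorial, Finset.prod_range_zero]

variable {q} in
-- Homogeneity in x is the only part of the degree condition that the uniqueness argument uses.
theorem IsInnerPowers.mem_leftWords {E : ℕ → Poly m q ⊗[ℂ] Poly m q} (hE : IsInnerPowers q E) (l : ℕ) :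
    E l ∈ leftWords m q l := by
  obtain ⟨t, ht⟩ := hE.degree l
  rw [← ht]
  clear ht
  induction t using TensorProduct.induction_on with
  | zero => rw [map_zero]; exact zero_mem _
  | tmul w p =>
    rw [TensorProduct.map_tmul]
    exact tmul_mem_leftWords q l _ _ ((homogeneous_eq_words q l).le w.2)
  | add x y hx hy => rw [map_add]; exact add_mem hx hy

variable {q} in
-- The reproducing property. The defining recursion removes the last letter x^j of a as a derivative
-- in x and restores it as a right factor in y, at the cost of one q-number.
theorem IsInnerPowers.contract_eq {E : ℕ → Poly m q ⊗[ℂ] Poly m q} (hE : IsInnerPowers q E) (l : ℕ)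
    (a : Poly m q) (ha : a ∈ words m q l) :
    contract q a (E l) = ((qFactorial (((q : ℝ) ^ 2)⁻¹) l : ℝ) : ℂ) • a := by
  refine words_induction_right q (P := fun l a =>
    contract q a (E l) = ((qFactorial (((q : ℝ) ^ 2)⁻¹) l : ℝ) : ℂ) • a) ?_ ?_ ?_ ?_ ?_ l a ha
  · rw [hE.zero, contract_tmul, pairing_one_left, map_one, qFactorial_zero, Complex.ofReal_one]
  · intro l j a _ h
    rw [contract_mul_gen, hE.partialD_succ, map_smul, contract_lTensor, h, qFactorial_succ, Complex.ofReal_mul,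
      smul_mul_assoc, smul_smul, mul_comm]
  · intro l f g hf hg; rw [contract_add, hf, hg, smul_add]
  · intro l c f hf; rw [contract_smul, hf, smul_comm]
  · intro l
    have := contract_smul q 0 0 (E l)
    rw [zero_smul, zero_smul] at this
    rw [this, smul_zero]

variable {q} in
theorem IsInnerPowers.unique {E E' : ℕ → Poly m q ⊗[ℂ] Poly m q} (hE : IsInnerPowers q E)
    (hE' : IsInnerPowers q E') : E = E' :=
  funext fun l => eq_of_contract_eq q l _ _ (hE.mem_leftWords l) (hE'.mem_leftWords l)
    fun a ha => by rw [hE.contract_eq l a ha, hE'.contract_eq l a ha]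

theorem exists_isInnerPowers (m : ℕ) : ∃ E : ℕ → Poly m q ⊗[ℂ] Poly m q, IsInnerPowers q E := by
  have h : ∀ l, ∃ T : Poly m q ⊗[ℂ] Poly m q, T ∈ LinearMap.range
      (TensorProduct.map (homogeneous m q l).subtype (homogeneous m q l).subtype) ∧ T ∈ leftWords m q l ∧
      ∀ a ∈ words m q l, contract q a T = ((qFactorial (((q : ℝ) ^ 2)⁻¹) l : ℝ) : ℂ) • a := by
    intro l
    obtain ⟨r, e, a, he, ha, -, h2⟩ := exists_dual_bases q m l
    -- The canonical tensor Σ e_i ⊗ a_i returns every element of degree l under contraction; the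
    -- factorial makes the recursion hold with its q-number.
    refine ⟨((qFactorial (((q : ℝ) ^ 2)⁻¹) l : ℝ) : ℂ) • ∑ i, e i ⊗ₜ[ℂ] a i, ?_, ?_, ?_⟩
    · refine Submodule.smul_mem _ _ (sum_mem fun i _ => ?_)
      exact ⟨⟨e i, words_le_homogeneous q l (he i)⟩ ⊗ₜ ⟨a i, words_le_homogeneous q l (ha i)⟩,
        by rw [TensorProduct.map_tmul]; rfl⟩
    · exact Submodule.smul_mem _ _ (sum_mem fun i _ => tmul_mem_leftWords q l _ _ (he i))
    · intro b hb
      simp only [map_smul, map_sum, contract_tmul, h2 b hb]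
  choose E h1 h2 h3 using h
  refine ⟨E, ?_, h1, fun l j => ?_⟩
  -- The remaining two axioms equate tensors of fixed degree in x, so contraction can test them.
  · refine eq_of_contract_eq q 0 _ _ (h2 0) (tmul_mem_leftWords q 0 _ _ (one_mem_words q)) fun a ha => ?_
    rw [h3 0 a ha, contract_tmul, pairing_one_right, qFactorial_zero, Complex.ofReal_one, one_smul]
    rw [words, Submodule.mem_span_singleton] at ha
    obtain ⟨c, rfl⟩ := ha
    simp
  · refine eq_of_contract_eq q l _ _ (rTensor_partialD_mem q l j _ (h2 (l + 1)))
      (Submodule.smul_mem _ _ (lTensor_mem_leftWords q l _ _ (h2 l))) fun a ha => ?_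
    rw [← contract_mul_gen, h3 (l + 1) _ (mul_gen_mem_words q l j a ha), map_smul, contract_lTensor, h3 l a ha,
      qFactorial_succ, Complex.ofReal_mul, smul_mul_assoc, smul_smul, mul_comm]

end InnerPowers

/-! ### Evaluation of the integral and of its constant. -/

section FunkHecke
variable {m : ℕ} (q : Set.Ioo (0 : ℝ) 1)

theorem qint_eq (n : ℕ) : qint q (n + 1) = ((qNumber ((q : ℝ) ^ 2) ((n : ℝ) + 1) : ℝ) : ℂ) := by
  have h : ((q : ℝ) ^ 2) ^ ((n : ℝ) + 1) = (q : ℝ) ^ (2 * (n + 1)) := by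
    rw [pow_mul, ← Nat.cast_succ, Real.rpow_natCast]
  rw [qint, qNumber, h]
  push_cast
  rfl

/-- The product telescopes to μ^k [k+t]_{q²}!/[t]_{q²}!. -/
theorem hobson_mul_qFactorial (k : ℕ) : ∀ t,
    hobson m q k t * ((qFactorial ((q : ℝ) ^ 2) t : ℝ) : ℂ) =
      ((mu m q : ℝ) : ℂ) ^ k * ((qFactorial ((q : ℝ) ^ 2) (k + t) : ℝ) : ℂ) := by
  induction k with
  | zero => intro t; rw [hobson, Finset.prod_range_zero, pow_zero, zero_add]
  | succ k ih =>
    intro t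
    have h := ih (t + 1)
    rw [qFactorial_succ, Complex.ofReal_mul, ← qint_eq] at h
    rw [hobson_succ, show k + 1 + t = k + (t + 1) by ring, pow_succ _ k]
    linear_combination ((mu m q : ℝ) : ℂ) * h

theorem qFactorial_ne_zero {p : ℝ} (hp : 0 < p) (hp1 : p ≠ 1) (n : ℕ) : qFactorial p n ≠ 0 := by
  refine Finset.prod_ne_zero_iff.2 fun i _ => div_ne_zero (sub_ne_zero.2 ?_) (sub_ne_zero.2 hp1)
  rw [← Nat.cast_succ, Real.rpow_natCast]
  exact fun h => hp1 ((pow_eq_one_iff_of_nonneg hp.le i.succ_ne_zero).1 h)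

/-- If integration against S is represented on 𝒫_l by c ⟨a, ·⟩, then on the x-factor it is c times
contraction with a. -/
theorem sphereIntegralLeft_mul (S a : Poly m q) (c : ℂ) (l : ℕ)
    (h : ∀ g ∈ words m q l, sphereIntegral m q (S * g) = c * pairing m q a g)
    (T : Poly m q ⊗[ℂ] Poly m q) (hT : T ∈ leftWords m q l) :
    sphereIntegralLeft m q ((S ⊗ₜ[ℂ] 1) * T) = c • contract q a T := by
  refine leftWords_induction q (n := l) (P := fun T => sphereIntegralLeft m q ((S ⊗ₜ[ℂ] 1) * T) = c • contract q a T)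
    ?_ ?_ ?_ T hT
  · simp only [mul_zero, map_zero, smul_zero]
  · intro w hw p
    rw [Algebra.TensorProduct.tmul_mul_tmul, one_mul, contract_tmul, sphereIntegralLeft, LinearMap.comp_apply,
      LinearMap.rTensor_tmul, h w hw, smul_smul]
    rfl
  · intro x y hx hy; simp only [mul_add, map_add, smul_add, hx, hy]

/-- There are two separate reasons: in odd total degree no power of Δ ends in a nonzero constant,
and for l < k the exponent s = (k + l)/2 is below k, so `flip S` as an operator kills x^{2s}. -/
theorem sphereIntegral_harmonic_mul_eq_zero (k l : ℕ) (S g : Poly m q) (hS : S ∈ words m q k)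
    (h : laplacian m q S = 0) (hg : g ∈ words m q l) (hkl : ¬ (Even (k + l) ∧ k ≤ l)) :
    sphereIntegral m q (S * g) = 0 := by
  have hw := mul_mem_words q k l S g hS hg
  by_cases he : Even (k + l)
  · obtain ⟨s, hs⟩ := he
    rw [← two_mul] at hs
    rw [hs] at hw
    have hlt : ¬ k ≤ l := fun hl => hkl ⟨⟨s, by omega⟩, hl⟩
    rw [sphereIntegral_words_even q s _ hw, pairing_normSq_pow_of_lt q k s (by omega) S hS h, mul_zero]
  · exact sphereIntegral_words_odd q _ he _ hw

theorem sphereIntegral_harmonic_mul (k t : ℕ) (S g : Poly m q) (hS : S ∈ words m q k)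
    (h : laplacian m q S = 0) (hg : g ∈ words m q (k + 2 * t)) :
    sphereIntegral m q (S * g) =
      ((pizzettiCoeff m q (k + t) : ℝ) : ℂ) * hobson m q k t * pairing m q (S * normSq m q ^ t) g := by
  have hw := mul_mem_words q k _ S g hS hg
  rw [show k + (k + 2 * t) = 2 * (k + t) by ring] at hw
  rw [sphereIntegral_words_even q (k + t) _ hw, pairing_normSq_pow_add q k t S hS h, mul_assoc]

theorem pizzettiCoeff_mul_hobson (k t : ℕ) :
    ((qFactorial (q : ℝ) (k + 2 * t) : ℝ) : ℂ) * (((pizzettiCoeff m q (k + t) : ℝ) : ℂ) * hobson m q k t) =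
      ((funkHeckeCoeff m q k (k + 2 * t) : ℝ) : ℂ) := by
  have h0 : (0 : ℝ) < (q : ℝ) ^ 2 := pow_pos q.2.1 2
  have h1 : (q : ℝ) ^ 2 ≠ 1 := (pow_lt_one₀ q.2.1.le q.2.2 two_ne_zero).ne
  have f1 := Complex.ofReal_ne_zero.2 (qFactorial_ne_zero h0 h1 t)
  have f2 := Complex.ofReal_ne_zero.2 (qFactorial_ne_zero h0 h1 (k + t))
  have hmu : ((mu m q : ℝ) : ℂ) ≠ 0 := mu_ne q
  have hh := hobson_mul_qFactorial (m := m) q k t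
  rw [← eq_div_iff f1] at hh
  have e : ((k : ℝ) + ((k + 2 * t : ℕ) : ℝ) + m) / 2 = ((k + t : ℕ) : ℝ) + m / 2 := by push_cast; ring
  rw [funkHeckeCoeff, if_pos ⟨⟨k + t, by ring⟩, by omega⟩, pizzettiCoeff, hh, e,
    show (k + 2 * t - k) / 2 = t by omega]
  push_cast
  -- One factor μ^k is cancelled by `hobson`; the other factor μ^l, with l = k + 2t, stays in α.
  rw [show ((mu m q : ℝ) : ℂ) ^ (2 * (k + t)) = ((mu m q : ℝ) : ℂ) ^ k * ((mu m q : ℝ) : ℂ) ^ (k + 2 * t) by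
    rw [← pow_add]; congr 1; ring]
  have hk := pow_ne_zero k hmu
  have hk2 := pow_ne_zero (k + 2 * t) hmu
  generalize ((mu m q : ℝ) : ℂ) ^ k = u at *
  generalize ((mu m q : ℝ) : ℂ) ^ (k + 2 * t) = v at *
  generalize ((qGamma ((q : ℝ) ^ 2) ((k : ℝ) + t + m / 2) : ℝ) : ℂ) = G
  -- No nonvanishing of the q-Gamma value is required: if it were zero, both sides would be zero by
  -- the convention for division.
  by_cases hG : G = 0
  · simp [hG]
  · field_simp

theorem sphereIntegralLeft_innerPow {E : ℕ → Poly m q ⊗[ℂ] Poly m q} (hE : IsInnerPowers q E) (k l : ℕ)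
    (S : Poly m q) (hS : S ∈ harmonic m q k) :
    sphereIntegralLeft m q ((S ⊗ₜ[ℂ] 1) * innerPow q E l) =
      ((funkHeckeCoeff m q k l : ℝ) : ℂ) • (S * normSq m q ^ ((l - k) / 2)) := by
  have hw : S ∈ words m q k := (homogeneous_eq_words q k).le hS.1
  have hΔ : laplacian m q S = 0 := hS.2
  rw [innerPow, mul_smul_comm, map_smul]
  by_cases hkl : Even (k + l) ∧ k ≤ l
  · obtain ⟨t, rfl⟩ : ∃ t, l = k + 2 * t := by
      obtain ⟨⟨s, hs⟩, hl⟩ := hkl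
      exact ⟨s - k, by omega⟩
    have h0 : (0 : ℝ) < ((q : ℝ) ^ 2)⁻¹ := inv_pos.2 (pow_pos q.2.1 2)
    have h1 : ((q : ℝ) ^ 2)⁻¹ ≠ 1 := inv_ne_one.2 (pow_lt_one₀ q.2.1.le q.2.2 two_ne_zero).ne
    have hf := Complex.ofReal_ne_zero.2 (qFactorial_ne_zero h0 h1 (k + 2 * t))
    -- The integral is represented by S x^{2t}, which the kernel returns multiplied by
    -- [l]_{q^{-2}}!; the normalisation of ⟨x|y⟩^{(l)} exchanges this for [l]_q!.
    rw [sphereIntegralLeft_mul q S (S * normSq m q ^ t) _ (k + 2 * t)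
      (fun g hg => sphereIntegral_harmonic_mul q k t S g hw hΔ hg) _ (hE.mem_leftWords _),
      hE.contract_eq _ _ (mul_mem_words q k (2 * t) _ _ hw (normSq_pow_mem_words q t)),
      ← pizzettiCoeff_mul_hobson, show (k + 2 * t - k) / 2 = t by omega, smul_smul, smul_smul,
      Complex.ofReal_div]
    generalize ((q : ℝ) ^ 2)⁻¹ = p at *
    congr 1
    field_simp
  -- The functional is zero on 𝒫_l, so a = 0 and c = 0 represent it. The truncated exponent in the
  -- statement is harmless because α vanishes.
  · rw [sphereIntegralLeft_mul q S 0 0 l (fun g hg => by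
      rw [sphereIntegral_harmonic_mul_eq_zero q k l S g hw hΔ hg hkl, zero_mul]) _ (hE.mem_leftWords l),
      funkHeckeCoeff, if_neg hkl, zero_smul, smul_zero, Complex.ofReal_zero, zero_smul]

end FunkHecke

end QEuclid

theorem theorem6p1 (m : ℕ) (hm : 1 ≤ m) (q : Set.Ioo (0 : ℝ) 1) :
    (∃! E : ℕ → Poly m q ⊗[ℂ] Poly m q, IsInnerPowers q E) ∧
    ∀ E : ℕ → Poly m q ⊗[ℂ] Poly m q, IsInnerPowers q E →
      ∀ (k l : ℕ), ∀ S ∈ harmonic m q k,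
        sphereIntegralLeft m q ((S ⊗ₜ[ℂ] 1) * innerPow q E l) =
          ((funkHeckeCoeff m q k l : ℝ) : ℂ) • (S * normSq m q ^ ((l - k) / 2)) :=
  ⟨(exists_isInnerPowers q m).imp fun _ hE => ⟨hE, fun _ hE' => hE'.unique hE⟩,
    fun _ hE k l S hS => sphereIntegralLeft_innerPow q hE k l S hS⟩
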